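/- **Proposition 2.6.** Let $X$ be an oriented smooth 4-manifold with a smooth pseudofree involution $g$ (its fixed point set is discrete) preserving the orientation and a Riemannian metric. Let $F$ be the bundle of oriented orthonormal frames, let $\hat F\to F$ be a spin structure, where $\hat F$ is a $\mathrm{Spin}(4)$-bundle with $\mathrm{Spin}(4)=Sp(1)\times Sp(1)$, and let $\hat g:\hat F\to\hat F$ be a lift of $g$ to the spin structure, i.e. a $\mathrm{Spin}(4)$-equivariant homeomorphism covering $g_*:F\to F$. For a fixed point $P$ let $$\nu(P)=\frac{\operatorname{tr}(\hat g|_{S_+(P)})-\operatorname{tr}(\hat g|_{S_-(P)})}{|\det(1-dg_P)|}$$ be its contribution to the Lefschetz number of $\hat g$ on the Dirac complex, where $S_\pm$ are the bundles of half spinors, and let the Atiyah–Bott sign $\varepsilon(P)$ be the sign of $\nu(P)$. The link of the image of $P$ in $X/g$ is an $\mathbb{RP}^3=S^3/\{\pm1\}$, identified by orientation-preserving smooth coordinates at $P$ in which $g$ is $x\mapsto -x$, and $\hat F/\hat g$ induces a spin structure on it. Let $D_\pm$ be the disk bundle of degree $\pm2$ over $S^2$, with $\partial D_\pm=\mathbb{RP}^3$,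 and let $s_\pm$ be the restriction to $\partial D_\pm$ of the unique spin structure of $D_\pm$. The point $P$ has spin type $s_+$ or $s_-$ according to which of the two the induced spin structure on its link is isomorphic to. Let $P$ and $Q$ be distinct fixed points of $g$. Then $\varepsilon(P)=\varepsilon(Q)$ if and only if $P$ and $Q$ have the same spin type, and $\varepsilon(P)=-\varepsilon(Q)$ if and only if $P$ and $Q$ have different spin types. -/

import Mathlib

open scoped Manifold ContDiff Quaternion Topology Matrix

noncomputable section

namespace SpinFour

/-! ### The group `Spin(4) = Sp(1) × Sp(1)` -/

/-- The group `Sp(1)` of unit quaternions. -/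
abbrev Sp1 : Type := unitary ℍ[ℝ]

/-- `Spin(4) = Sp(1) × Sp(1)`. -/
abbrev Spin4 : Type := Sp1 × Sp1

/-- The canonical homomorphism `Spin(4) → SO(4)`, where `SO(4)` acts on `ℝ⁴ = ℍ`:
the pair `(a, b)` acts by `x ↦ a x b⁻¹`. -/
def rot (s : Spin4) (x : ℍ[ℝ]) : ℍ[ℝ] := (s.1 : ℍ[ℝ]) * x * star (s.2 : ℍ[ℝ])

/-- The unit quaternion acting on `ℂ²`, i.e. the standard isomorphism `Sp(1) ≅ SU(2)`:
`z + w j ↦ [[z, w], [-conj w, conj z]]`. -/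
def su2 (q : ℍ[ℝ]) : Matrix (Fin 2) (Fin 2) ℂ :=
  !![⟨q.re, q.imI⟩, ⟨q.imJ, q.imK⟩; ⟨-q.imJ, q.imK⟩, ⟨q.re, -q.imI⟩]

/-- The positive half-spin representation `Δ₊` of `Spin(4)` on `ℂ²`. -/
def spinPlus (s : Spin4) : Matrix (Fin 2) (Fin 2) ℂ := su2 (s.1 : ℍ[ℝ])

/-- The negative half-spin representation `Δ₋` of `Spin(4)` on `ℂ²`. -/
def spinMinus (s : Spin4) : Matrix (Fin 2) (Fin 2) ℂ := su2 (s.2 : ℍ[ℝ])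

/-! ### Spin structures

A frame at a point `x` of a `4`-manifold is a linear isomorphism from `ℝ⁴ = ℍ` onto the tangent
space at `x`. It is recorded as the function from `ℍ` to the total space `Y` of the tangent bundle,
and a frame bundle is a set of such functions. It carries the topology of pointwise convergence
(which, by linearity, is that of the `4`-tuples of frame vectors) and the right action
of `Spin(4)`, through `SO(4)`, by precomposition. -/

/-- A spin structure on an oriented Riemannian `4`-manifold with oriented orthonormal frame
bundle `B`: a `Spin(4)`-space `Total` with a `Spin(4)`-equivariant double covering
`proj : Total → B` whose deck transformation is the action of `-1 ∈ Spin(4)`. -/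
structure SpinStructure.{u, v} {Y : Type u} [TopologicalSpace Y] (B : Set (ℍ[ℝ] → Y)) where
  /-- The total space of the `Spin(4)`-bundle. -/
  Total : Type v
  [topology : TopologicalSpace Total]
  /-- The right action of `Spin(4)`. -/
  act : Total → Spin4 → Total
  act_one : ∀ y, act y 1 = y
  act_mul : ∀ y s t, act y (s * t) = act (act y s) t
  continuous_act : Continuous fun p : Total × Spin4 => act p.1 p.2
  /-- The covering of the frame bundle. -/
  proj : Total → B
  isCoveringMap : IsCoveringMap proj
  surjective : Function.Surjective proj
  proj_act : ∀ y s, (proj (act y s)).1 = fun a => (proj y).1 (rot s a)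
  proj_eq_iff : ∀ y y', proj y' = proj y ↔ y' = y ∨ y' = act y (-1)
  act_neg_one_ne : ∀ y, act y (-1) ≠ y

attribute [instance] SpinStructure.topology

/-! ### Oriented Riemannian `4`-manifolds -/

/-- Euclidean `4`-space. -/
abbrev E4 : Type := EuclideanSpace ℝ (Fin 4)

section Manifold

variable {X : Type*} [TopologicalSpace X] [ChartedSpace E4 X] [IsManifold 𝓘(ℝ, E4) ∞ X]

/-- A smooth Riemannian metric on the smooth `4`-manifold `X`. -/
abbrev Metric (X : Type*) [TopologicalSpace X] [ChartedSpace E4 X] [IsManifold 𝓘(ℝ, E4) ∞ X] :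
    Type _ :=
  Bundle.ContMDiffRiemannianMetric 𝓘(ℝ, E4) ∞ E4 (fun x : X => TangentSpace 𝓘(ℝ, E4) x)

/-- An orientation of the smooth `4`-manifold `X`: orientations of all tangent spaces which are
locally constant in the local trivializations of the tangent bundle. -/
structure ManifoldOrientation (X : Type*) [TopologicalSpace X] [ChartedSpace E4 X]
    [IsManifold 𝓘(ℝ, E4) ∞ X] where
  /-- The orientation of each tangent space. -/
  at_point : ∀ x : X, Orientation ℝ (TangentSpace 𝓘(ℝ, E4) x) (Fin 4)
  locally_constant : ∀ x₀ : X, ∃ θ : Orientation ℝ E4 (Fin 4), ∀ᶠ x in 𝓝 x₀,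
    ∀ hx : x ∈ (trivializationAt E4 (TangentSpace 𝓘(ℝ, E4) : X → Type) x₀).baseSet,
      Orientation.map (Fin 4)
        ((trivializationAt E4 (TangentSpace 𝓘(ℝ, E4) : X → Type) x₀).linearEquivAt ℝ x hx)
        (at_point x) = θ

/-- The orientation induced on `V` by a linear isomorphism `ℍ ≃ V`, where `ℍ` is oriented by the
basis `1, i, j, k`. -/
def frameOrientation {V : Type*} [AddCommGroup V] [Module ℝ V] (L : ℍ[ℝ] ≃ₗ[ℝ] V) :
    Orientation ℝ V (Fin 4) :=
  ((QuaternionAlgebra.basisOneIJK (-1 : ℝ) 0 (-1)).map L).orientation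

/-- The bundle `F` of oriented orthonormal frames of `X`. -/
def frames (G : Metric X) (o : ManifoldOrientation X) :
    Set (ℍ[ℝ] → TangentBundle 𝓘(ℝ, E4) X) :=
  {f | ∃ (x : X) (L : ℍ[ℝ] ≃ₗ[ℝ] TangentSpace 𝓘(ℝ, E4) x),
    (∀ a, f a = ⟨x, L a⟩) ∧ (∀ a b, G.inner x (L a) (L b) = inner ℝ a b) ∧
      frameOrientation L = o.at_point x}

/-- The diffeomorphism `g` preserves the metric. -/
def PreservesMetric (G : Metric X) (g : X → X) : Prop :=
  ∀ (x : X) (v w : TangentSpace 𝓘(ℝ, E4) x),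
    G.inner (g x) (mfderiv 𝓘(ℝ, E4) 𝓘(ℝ, E4) g x v) (mfderiv 𝓘(ℝ, E4) 𝓘(ℝ, E4) g x w)
      = G.inner x v w

/-- The diffeomorphism `g` preserves the orientation: `dg` carries positively oriented (linear)
frames to positively oriented frames. -/
def PreservesOrientation (o : ManifoldOrientation X) (g : X → X) : Prop :=
  ∀ (x : X) (L : ℍ[ℝ] ≃ₗ[ℝ] TangentSpace 𝓘(ℝ, E4) x), frameOrientation L = o.at_point x →
    ∃ L' : ℍ[ℝ] ≃ₗ[ℝ] TangentSpace 𝓘(ℝ, E4) (g x),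
      (∀ a, L' a = mfderiv 𝓘(ℝ, E4) 𝓘(ℝ, E4) g x (L a)) ∧ frameOrientation L' = o.at_point (g x)

variable {G : Metric X} {o : ManifoldOrientation X}

/-- The base point in `X` of an element of the `Spin(4)`-bundle. -/
def SpinStructure.base (S : SpinStructure (frames G o)) (y : S.Total) : X :=
  ((S.proj y).1 0).proj

/-- A lift of the map `g` to the spin structure `S`: a `Spin(4)`-equivariant homeomorphism of the
`Spin(4)`-bundle covering the map `g_*` of the frame bundle induced by the differential of `g`. -/
structure Lift (S : SpinStructure (frames G o)) (g : X → X) where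
  /-- The lifted homeomorphism. -/
  toHomeo : S.Total ≃ₜ S.Total
  equivariant : ∀ y s, toHomeo (S.act y s) = S.act (toHomeo y) s
  covers : ∀ y, (S.proj (toHomeo y)).1 =
    fun a => tangentMap 𝓘(ℝ, E4) 𝓘(ℝ, E4) g ((S.proj y).1 a)

theorem SpinStructure.base_act (S : SpinStructure (frames G o)) (y : S.Total) (s : Spin4) :
    S.base (S.act y s) = S.base y := by
  simp [SpinStructure.base, S.proj_act, rot]

theorem Lift.base_toHomeo {S : SpinStructure (frames G o)} {g : X → X} (l : Lift S g)
    (y : S.Total) : S.base (l.toHomeo y) = g (S.base y) := by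
  simp [SpinStructure.base, l.covers, tangentMap]

theorem Lift.base_symm {S : SpinStructure (frames G o)} {g : X → X} (l : Lift S g)
    (hg : Function.Involutive g) {P : X} (hP : g P = P) {y : S.Total} (hy : S.base y = P) :
    S.base (l.toHomeo.symm y) = P := by
  have h := l.base_toHomeo (l.toHomeo.symm y)
  rw [Homeomorph.apply_symm_apply, hy] at h
  exact hg.injective (h.symm.trans hP.symm)

theorem Lift.symm_act {S : SpinStructure (frames G o)} {g : X → X} (l : Lift S g)
    (y : S.Total) (s : Spin4) :
    l.toHomeo.symm (S.act y s) = S.act (l.toHomeo.symm y) s := by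
  rw [Homeomorph.symm_apply_eq, l.equivariant, Homeomorph.apply_symm_apply]

/-! ### The Atiyah–Bott sign -/

/-- The fibre at `x` of the vector bundle associated to the `Spin(4)`-bundle and the representation
`r` of `Spin(4)` on `ℂ²`: the equivariant functions `σ` from the fibre of the `Spin(4)`-bundle to
`ℂ²`, that is `σ(y s) = r(s)⁻¹ σ(y)`. For `r = Δ±` this is the fibre of the bundle `S±` of half
spinors. -/
def spinorFibre (S : SpinStructure (frames G o)) (r : Spin4 → Matrix (Fin 2) (Fin 2) ℂ) (x : X) :
    Submodule ℂ ({y : S.Total // S.base y = x} → Fin 2 → ℂ) where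
  carrier := {σ | ∀ (y : {y : S.Total // S.base y = x}) (s : Spin4),
    r s *ᵥ σ ⟨S.act y.1 s, (S.base_act y.1 s).trans y.2⟩ = σ y}
  add_mem' := by
    intro σ τ hσ hτ y s
    simp only [Pi.add_apply, Matrix.mulVec_add, hσ y s, hτ y s]
  zero_mem' := by
    intro y s
    simp
  smul_mem' := by
    intro c σ hσ y s
    simp only [Pi.smul_apply, Matrix.mulVec_smul, hσ y s]

/-- The action of the lift of `g` on the fibre of the associated bundle at a fixed point `P`
of `g`: `(ĝ σ)(y) = σ(ĝ⁻¹ y)`. -/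
def Lift.onSpinors {S : SpinStructure (frames G o)} {g : X → X} (l : Lift S g)
    (r : Spin4 → Matrix (Fin 2) (Fin 2) ℂ) (hg : Function.Involutive g) {P : X} (hP : g P = P) :
    spinorFibre S r P →ₗ[ℂ] spinorFibre S r P where
  toFun σ := ⟨fun y => σ.1 ⟨l.toHomeo.symm y.1, l.base_symm hg hP y.2⟩, by
    intro y s
    have h := σ.2 ⟨l.toHomeo.symm y.1, l.base_symm hg hP y.2⟩ s
    simp only [← l.symm_act] at h
    exact h⟩
  map_add' _ _ := rfl
  map_smul' _ _ := rfl

/-- The differential of `g` at a fixed point `P`, as an endomorphism of the tangent space at `P`. -/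
def differentialAt (g : X → X) {P : X} (hP : g P = P) :
    TangentSpace 𝓘(ℝ, E4) P →ₗ[ℝ] TangentSpace 𝓘(ℝ, E4) P :=
  Eq.rec (motive := fun Q _ => TangentSpace 𝓘(ℝ, E4) P →ₗ[ℝ] TangentSpace 𝓘(ℝ, E4) Q)
    (mfderiv 𝓘(ℝ, E4) 𝓘(ℝ, E4) g P).toLinearMap hP

/-- The contribution `ν(P)` of the isolated fixed point `P` to the Lefschetz number of the lift
acting on the Dirac complex `Γ(S₊) → Γ(S₋)` (the Spin-number):
`ν(P) = (tr ĝ|S₊(P) - tr ĝ|S₋(P)) / |det (1 - dg(P))|`. -/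
def Lift.nu {S : SpinStructure (frames G o)} {g : X → X} (l : Lift S g)
    (hg : Function.Involutive g) {P : X} (hP : g P = P) : ℂ :=
  (LinearMap.trace ℂ _ (l.onSpinors spinPlus hg hP)
      - LinearMap.trace ℂ _ (l.onSpinors spinMinus hg hP))
    / ((|LinearMap.det (LinearMap.id - differentialAt g hP)| : ℝ) : ℂ)

/-- The Atiyah–Bott sign `ε(P)`: the sign of the (real) number `ν(P)`. -/
def Lift.epsilon {S : SpinStructure (frames G o)} {g : X → X} (l : Lift S g)
    (hg : Function.Involutive g) {P : X} (hP : g P = P) : SignType :=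
  SignType.sign (l.nu hg hP).re

end Manifold

/-! ### The disk bundles of degree `±2` over the sphere -/

/-- The two spin types `s₊` and `s₋`. -/
inductive SpinType : Type
  | plus
  | minus

/-- The unit disk bundle of the tangent bundle of the sphere `S²` of unit imaginary quaternions:
pairs `(u, v)` of imaginary quaternions with `|u| = 1`, `v ⟂ u` and `|v| ≤ 1`. -/
def diskBundle : Set (ℍ[ℝ] × ℍ[ℝ]) :=
  {p | p.1.re = 0 ∧ p.2.re = 0 ∧ ‖p.1‖ = 1 ∧ inner ℝ p.1 p.2 = 0 ∧ ‖p.2‖ ≤ 1}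

/-- `w` is tangent at `p` to the manifold of all pairs `(u, v)` of imaginary quaternions with
`|u| = 1` and `v ⟂ u`. -/
def IsTangent (p w : ℍ[ℝ] × ℍ[ℝ]) : Prop :=
  w.1.re = 0 ∧ w.2.re = 0 ∧ inner ℝ p.1 w.1 = 0 ∧ inner ℝ p.1 w.2 + inner ℝ w.1 p.2 = 0

/-- The Sasaki metric of the tangent bundle of `S²`: the component of `w.2` orthogonal to the base
point `p.1` of the sphere is the covariant derivative. -/
def diskMetric (p w w' : ℍ[ℝ] × ℍ[ℝ]) : ℝ :=
  inner ℝ w.1 w'.1 + (inner ℝ w.2 w'.2 - inner ℝ p.1 w.2 * inner ℝ p.1 w'.2)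

/-- The coordinates in `ℝ³ × ℝ³` of a pair of imaginary quaternions. -/
def coords (w : ℍ[ℝ] × ℍ[ℝ]) : Fin 6 → ℝ :=
  ![w.1.imI, w.1.imJ, w.1.imK, w.2.imI, w.2.imJ, w.2.imK]

/-- A determinant which is positive on a quadruple of tangent vectors at `p` if and only if it is
a positive basis for the orientation "base, then fibre" of the tangent bundle of `S²`. With this
orientation the zero section has self-intersection number `+2`. -/
def diskDet (p : ℍ[ℝ] × ℍ[ℝ]) (L : ℍ[ℝ] → ℍ[ℝ] × ℍ[ℝ]) : ℝ :=
  Matrix.det (Matrix.of ![coords (p.1, 0), coords (L ⟨1, 0, 0, 0⟩), coords (L ⟨0, 1, 0, 0⟩),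
    coords (0, p.1), coords (L ⟨0, 0, 1, 0⟩), coords (L ⟨0, 0, 0, 1⟩)])

/-- The orientation condition for frames of the disk bundle: `D₊`, of degree `+2`, has the
orientation "base, then fibre", and `D₋`, of degree `-2`, has the opposite orientation. -/
def IsPositive : SpinType → (ℍ[ℝ] × ℍ[ℝ]) → (ℍ[ℝ] → ℍ[ℝ] × ℍ[ℝ]) → Prop
  | .plus, p, L => 0 < diskDet p L
  | .minus, p, L => diskDet p L < 0

/-- The oriented orthonormal frame bundle of the disk bundle `D±`. The tangent bundle of `D±` is
realized by pairs (point, vector) in `(ℍ × ℍ) × (ℍ × ℍ)`. -/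
def diskFrames (τ : SpinType) : Set (ℍ[ℝ] → (ℍ[ℝ] × ℍ[ℝ]) × (ℍ[ℝ] × ℍ[ℝ])) :=
  {f | ∃ p ∈ diskBundle, ∃ L : ℍ[ℝ] →ₗ[ℝ] ℍ[ℝ] × ℍ[ℝ],
    (∀ a, f a = (p, L a)) ∧ (∀ a, IsTangent p (L a)) ∧
      (∀ a b, diskMetric p (L a) (L b) = inner ℝ a b) ∧ IsPositive τ p L}

/-- The orientation-preserving identification of `(ℍ ∖ 0)/±1` with the complement of the zero
section in the rank two bundle containing `D±`, given by
`x ↦ (x i x* / |x|², x j x*)` for `D₊`, and by this formula with `x*` in place of `x` for `D₋`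
(`x*` is the conjugate of `x`, and `x ↦ x*` reverses the orientation of `ℍ`).
On the unit sphere it is the identification of `ℝP³ = S³/±1` with the boundary of `D±`. -/
def psi : SpinType → ℍ[ℝ] → ℍ[ℝ] × ℍ[ℝ]
  | .plus, x => ((‖x‖ ^ 2)⁻¹ • (x * ⟨0, 1, 0, 0⟩ * star x), x * ⟨0, 0, 1, 0⟩ * star x)
  | .minus, x => ((‖x‖ ^ 2)⁻¹ • (star x * ⟨0, 1, 0, 0⟩ * x), star x * ⟨0, 0, 1, 0⟩ * x)

/-! ### The spin type of a fixed point -/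

section Types

variable {X : Type*} [TopologicalSpace X] [ChartedSpace E4 X] [IsManifold 𝓘(ℝ, E4) ∞ X]
  {G : Metric X} {o : ManifoldOrientation X}

/-- Linearizing coordinates at a fixed point `P` of `g`: an orientation-preserving smooth
parametrization of a neighbourhood of `P` by the ball of radius `2` in `ℝ⁴ = ℍ`, in which `P` is
the origin and `g` is the antipodal map. The image of the unit sphere `S³` is then a sphere around
`P`, and its quotient by `g` is the link `ℝP³ = S³/±1` of the image of `P` in `X/g`. -/
structure AntipodalChart (o : ManifoldOrientation X) (g : X → X) (P : X) where
  /-- The parametrization. -/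
  e : OpenPartialHomeomorph ℍ[ℝ] X
  source_eq : e.source = Metric.ball 0 2
  map_zero : e 0 = P
  smooth : ContMDiffOn 𝓘(ℝ, ℍ[ℝ]) 𝓘(ℝ, E4) ∞ e e.source
  smooth_symm : ContMDiffOn 𝓘(ℝ, E4) 𝓘(ℝ, ℍ[ℝ]) ∞ e.symm e.target
  antipodal : ∀ x ∈ e.source, e (-x) = g (e x)
  oriented : ∀ x ∈ e.source, ∃ L : ℍ[ℝ] ≃ₗ[ℝ] TangentSpace 𝓘(ℝ, E4) (e x),
    (∀ a : ℍ[ℝ], L a = mfderiv 𝓘(ℝ, ℍ[ℝ]) 𝓘(ℝ, E4) e x a) ∧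
      frameOrientation L = o.at_point (e x)

/-- The fixed point `P` of `g` has spin type `s±`: the spin structure on its link `ℝP³` induced
by the quotient by `g` is isomorphic to the restriction to `∂D± = ℝP³` of the spin structure of
the disk bundle `D±`.

The spin structure of the quotient is the quotient of the `Spin(4)`-bundle by the lift `ĝ`, so an
isomorphism is given, on the part of the `Spin(4)`-bundle over the sphere around `P`, by
a `ĝ`-invariant `Spin(4)`-equivariant map `Φ` to the `Spin(4)`-bundle of `D±`. It covers the
identification `e x ↦ ψ x` of the link with `∂D±`: if `y` lies over the frame `de ∘ w` at `e x`,
then `Φ y` lies over the orthonormal frame at `ψ x` obtained from the frame `dψ ∘ w` by polar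
decomposition (the orthonormal frame `u` such that `u⁻¹ ∘ dψ ∘ w` is symmetric and positive). -/
def Lift.HasSpinType {S : SpinStructure (frames G o)} {g : X → X} (l : Lift S g) (P : X)
    (τ : SpinType) : Prop :=
  ∃ (c : AntipodalChart o g P) (T : SpinStructure.{0, 0} (diskFrames τ)) (Φ : S.Total → T.Total),
    ContinuousOn Φ {y | S.base y ∈ c.e '' Metric.sphere 0 1} ∧
    ∀ y, S.base y ∈ c.e '' Metric.sphere 0 1 →
      (∀ s, Φ (S.act y s) = T.act (Φ y) s) ∧
      Φ (l.toHomeo y) = Φ y ∧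
      ∀ x ∈ Metric.sphere (0 : ℍ[ℝ]) 1, ∀ w : ℍ[ℝ] →L[ℝ] ℍ[ℝ],
        (∀ a, (S.proj y).1 a = tangentMap 𝓘(ℝ, ℍ[ℝ]) 𝓘(ℝ, E4) c.e ⟨x, w a⟩) →
          (∀ a, ((T.proj (Φ y)).1 a).1 = psi τ x) ∧
          (∀ a b, diskMetric (psi τ x) ((T.proj (Φ y)).1 a).2 (fderiv ℝ (psi τ) x (w b))
            = diskMetric (psi τ x) ((T.proj (Φ y)).1 b).2 (fderiv ℝ (psi τ) x (w a))) ∧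
          ∀ a, a ≠ 0 →
            0 < diskMetric (psi τ x) ((T.proj (Φ y)).1 a).2 (fderiv ℝ (psi τ) x (w a))

end Types

end SpinFour

end

noncomputable section

namespace SpinFour


/-! ### Quaternions and the covering `Spin(4) → SO(4)` -/

/-! Both invariants of a fixed point are governed by one bit. Near an isolated fixed point P the
involution is x ↦ -x in suitable coordinates (`nonempty_antipodalChart`), so the lift acts on the
fibre of the Spin(4)-bundle over P through one of the two elements of Spin(4) above -1 ∈ SO(4): (-1,
1), which is `antipode .plus`, or (1, -1), which is `antipode .minus` (`Lift.exists_actsAs`). Call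
the label τ. It is shown that τ determines the sign injectively and that τ is the spin type
(`Lift.exists_type`); the proposition is then a comparison of two labels.

The sign: `antipode τ` is -1 on one half-spin representation and +1 on the other, so the difference
of traces is -4 for τ = plus and +4 for τ = minus, while det(1 - dg) = det(2) = 16. Hence ε(P) = -1
for plus and +1 for minus (`Lift.epsilon_eq`).

The spin type, on the side of X: correcting the coordinate frame by the inverse square root of the
metric gives an orthonormal frame field on the unit ball, which lifts to a section F of the
Spin(4)-bundle. Unique path lifting carries the action at the centre out to the sphere: ĝ F(x) =
F(-x) · `antipode τ` (`Lift.toHomeo_section`).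

On the side of the disk bundle, ½ dψ is an orthonormal frame along the boundary and lifts to a
section over S³. The path exp(it), 0 ≤ t ≤ π, from 1 to -1 covers a fibre circle, and that circle
bounds a disk in the fibre. At the centre of the disk the frame is merely rotated by left
multiplication by exp(it), and the lift of this rotation ends at (-1, 1). For D₋ quaternionic
conjugation exchanges the two factors and the end is (1, -1). By homotopy lifting this monodromy is
the same in every spin structure of D± (`lift_neg_one`), so uniqueness of the spin structure is
never invoked.

The two sides are matched by polar decomposition: since the correcting operator is symmetric and
positive, an isomorphism Φ must send F(x) to a lift of ½ dψ (`rot_eq_id_of_polar`). Its invariance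
under ĝ then forces the two monodromies to agree (`Lift.eq_of_hasSpinType`). Conversely, when they
agree, F(x)t ↦ `boundaryLift` x · t is an isomorphism (`Lift.hasSpinType_of_actsAs`). -/

/-- The quaternion `i`. -/
def qI : ℍ[ℝ] := ⟨0, 1, 0, 0⟩

/-- The quaternion `j`. -/
def qJ : ℍ[ℝ] := ⟨0, 0, 1, 0⟩

/-- The quaternion `k`. -/
def qK : ℍ[ℝ] := ⟨0, 0, 0, 1⟩

@[simp] theorem re_qI : qI.re = 0 := rfl
@[simp] theorem imI_qI : qI.imI = 1 := rfl
@[simp] theorem imJ_qI : qI.imJ = 0 := rfl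
@[simp] theorem imK_qI : qI.imK = 0 := rfl
@[simp] theorem re_qJ : qJ.re = 0 := rfl
@[simp] theorem imI_qJ : qJ.imI = 0 := rfl
@[simp] theorem imJ_qJ : qJ.imJ = 1 := rfl
@[simp] theorem imK_qJ : qJ.imK = 0 := rfl
@[simp] theorem re_qK : qK.re = 0 := rfl
@[simp] theorem imI_qK : qK.imI = 0 := rfl
@[simp] theorem imJ_qK : qK.imJ = 0 := rfl
@[simp] theorem imK_qK : qK.imK = 1 := rfl

theorem inner_eq (a b : ℍ[ℝ]) :
    inner ℝ a b = a.re * b.re + a.imI * b.imI + a.imJ * b.imJ + a.imK * b.imK := by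
  simp [Quaternion.inner_def]

theorem normSq_eq_norm_sq (a : ℍ[ℝ]) : Quaternion.normSq a = ‖a‖ ^ 2 := by
  rw [Quaternion.normSq_eq_norm_mul_self, sq]

theorem norm_sq_eq (a : ℍ[ℝ]) :
    ‖a‖ ^ 2 = a.re ^ 2 + a.imI ^ 2 + a.imJ ^ 2 + a.imK ^ 2 := by
  rw [← normSq_eq_norm_sq, Quaternion.normSq_def']

theorem norm_eq_one_of_sq {a : ℍ[ℝ]}
    (h : a.re ^ 2 + a.imI ^ 2 + a.imJ ^ 2 + a.imK ^ 2 = 1) : ‖a‖ = 1 := by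
  rw [← norm_sq_eq] at h
  nlinarith [norm_nonneg a]

theorem norm_qI : ‖qI‖ = 1 := norm_eq_one_of_sq (by simp)

theorem norm_qJ : ‖qJ‖ = 1 := norm_eq_one_of_sq (by simp)

theorem star_mul_self_of_norm {x : ℍ[ℝ]} (hx : ‖x‖ = 1) : star x * x = 1 := by
  rw [Quaternion.star_mul_self, normSq_eq_norm_sq, hx]; simp

theorem mul_star_self_of_norm {x : ℍ[ℝ]} (hx : ‖x‖ = 1) : x * star x = 1 := by
  rw [Quaternion.self_mul_star, normSq_eq_norm_sq, hx]; simp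

theorem norm_sp1 (a : Sp1) : ‖(a : ℍ[ℝ])‖ = 1 := by
  have h : star (a : ℍ[ℝ]) * a = 1 := Unitary.coe_star_mul_self a
  rw [Quaternion.star_mul_self, normSq_eq_norm_sq] at h
  have h2 : ‖(a : ℍ[ℝ])‖ ^ 2 = 1 := by simp
  nlinarith [norm_nonneg (a : ℍ[ℝ])]

/-- A unit quaternion as an element of `Sp(1)`. -/
def toSp1 (x : ℍ[ℝ]) (hx : ‖x‖ = 1) : Sp1 :=
  ⟨x, Unitary.mem_iff.2 ⟨star_mul_self_of_norm hx, mul_star_self_of_norm hx⟩⟩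

@[simp] theorem coe_toSp1 (x : ℍ[ℝ]) (hx : ‖x‖ = 1) : (toSp1 x hx : ℍ[ℝ]) = x := rfl

@[simp] theorem rot_one (a : ℍ[ℝ]) : rot 1 a = a := by simp [rot]

theorem rot_mul (s t : Spin4) (a : ℍ[ℝ]) : rot (s * t) a = rot s (rot t a) := by
  simp [rot, mul_assoc]

@[simp] theorem rot_neg_one (a : ℍ[ℝ]) : rot (-1) a = a := by
  simp [rot, Unitary.coe_neg]

/-- The action of an element of `Spin(4)` on `ℍ`, as a linear map. -/
def rotL (s : Spin4) : ℍ[ℝ] →ₗ[ℝ] ℍ[ℝ] where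
  toFun := rot s
  map_add' a b := by simp [rot, mul_add, add_mul]
  map_smul' c a := by simp [rot]

@[simp] theorem rotL_apply (s : Spin4) (a : ℍ[ℝ]) : rotL s a = rot s a := rfl

theorem inner_eq_re (a b : ℍ[ℝ]) : inner ℝ a b = (star b * a).re := by
  rw [inner_eq]; simp; ring

theorem inner_mul_left_of_norm {x : ℍ[ℝ]} (hx : ‖x‖ = 1) (a b : ℍ[ℝ]) :
    inner ℝ (x * a) (x * b) = (inner ℝ a b : ℝ) := by
  rw [inner_eq_re, inner_eq_re, star_mul, mul_assoc, ← mul_assoc (star x), star_mul_self_of_norm hx,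
    one_mul]

theorem inner_mul_right_of_norm {x : ℍ[ℝ]} (hx : ‖x‖ = 1) (a b : ℍ[ℝ]) :
    inner ℝ (a * x) (b * x) = (inner ℝ a b : ℝ) := by
  rw [Quaternion.inner_def, Quaternion.inner_def, star_mul, mul_assoc, ← mul_assoc x,
    mul_star_self_of_norm hx, one_mul]

theorem inner_star_star (a b : ℍ[ℝ]) : inner ℝ (star a) (star b) = (inner ℝ a b : ℝ) := by
  simp [inner_eq]

theorem inner_rot (s : Spin4) (a b : ℍ[ℝ]) : inner ℝ (rot s a) (rot s b) = (inner ℝ a b : ℝ) := by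
  rw [rot, rot, inner_mul_right_of_norm (by rw [norm_star]; exact norm_sp1 s.2),
    inner_mul_left_of_norm (norm_sp1 s.1)]

theorem rot_inv_rot (s : Spin4) (a : ℍ[ℝ]) : rot s⁻¹ (rot s a) = a := by
  rw [← rot_mul]; simp

theorem rot_rot_inv (s : Spin4) (a : ℍ[ℝ]) : rot s (rot s⁻¹ a) = a := by
  rw [← rot_mul]; simp

/-- Evaluation at 1 makes the two components equal; the common value then commutes with i and j,
hence is real of norm one. -/
theorem eq_or_eq_neg_of_rot_eq_id {s : Spin4} (h : ∀ a, rot s a = a) : s = 1 ∨ s = -1 := by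
  have h1 : (s.1 : ℍ[ℝ]) = s.2 := by
    have := congrArg (· * (s.2 : ℍ[ℝ])) (h 1)
    simpa [rot, mul_assoc, star_mul_self_of_norm (norm_sp1 s.2)] using this
  have h2 : ∀ a : ℍ[ℝ], (s.2 : ℍ[ℝ]) * a = a * s.2 := by
    intro a
    have := congrArg (· * (s.2 : ℍ[ℝ])) (h a)
    simpa [rot, mul_assoc, star_mul_self_of_norm (norm_sp1 s.2), h1] using this
  have hi := h2 qI
  have hj := h2 qJ
  have hn := norm_sq_eq (s.2 : ℍ[ℝ])
  rw [norm_sp1] at hn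
  set q := (s.2 : ℍ[ℝ]) with hq
  have i1 := congrArg QuaternionAlgebra.imJ hi
  have i2 := congrArg QuaternionAlgebra.imK hi
  have i3 := congrArg QuaternionAlgebra.imK hj
  simp only [Quaternion.imJ_mul, Quaternion.imK_mul, re_qI, imI_qI, imJ_qI, imK_qI, re_qJ, imI_qJ,
    imJ_qJ, imK_qJ] at i1 i2 i3
  have e1 : q.imK = 0 := by linarith
  have e2 : q.imJ = 0 := by linarith
  have e3 : q.imI = 0 := by linarith
  rw [e1, e2, e3] at hn
  have h4 : q.re = 1 ∨ q.re = -1 := by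
    rcases eq_or_eq_neg_of_sq_eq_sq q.re 1 (by linarith) with h | h <;> simp [h]
  rcases h4 with h4 | h4
  · left
    have hq1 : q = 1 := by ext <;> simp [e1, e2, e3, h4]
    ext1
    · apply Subtype.ext; rw [h1, hq1]; rfl
    · apply Subtype.ext; exact hq1
  · right
    have hq1 : q = -1 := by ext <;> simp [e1, e2, e3, h4]
    ext1
    · apply Subtype.ext; rw [h1, hq1]; rfl
    · apply Subtype.ext; exact hq1

theorem eq_or_eq_of_rot_eq {s t : Spin4} (h : ∀ a, rot s a = rot t a) :
    s = t ∨ s = t * (-1) := by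
  have : ∀ a, rot (t⁻¹ * s) a = a := fun a => by rw [rot_mul, h, rot_inv_rot]
  rcases eq_or_eq_neg_of_rot_eq_id this with h | h
  · left; rw [inv_mul_eq_one] at h; exact h.symm
  · right; rw [← h]; simp

/-- The identity (1 + a)² = |1 + a|² a for a unit quaternion a shows that the normalized 1 + a is a
square root. For a = -1 one takes i. -/
theorem exists_norm_one_sq (a : ℍ[ℝ]) (ha : ‖a‖ = 1) : ∃ c : ℍ[ℝ], ‖c‖ = 1 ∧ c * c = a := by
  by_cases h : 1 + a = 0
  · refine ⟨qI, norm_qI, ?_⟩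
    · rw [eq_neg_of_add_eq_zero_right h]
      ext <;> simp
  · have hn : ‖1 + a‖ ≠ 0 := by simpa using h
    refine ⟨‖1 + a‖⁻¹ • (1 + a), by rw [norm_smul]; simp [hn], ?_⟩
    have h2 : (1 + a) * (1 + a) = (‖1 + a‖ ^ 2) • a := by
      have := norm_sq_eq a
      rw [ha] at this
      have h3 : ‖1 + a‖ ^ 2 = 2 + 2 * a.re := by
        rw [norm_sq_eq]; simp; linear_combination -this
      rw [h3]
      ext <;> simp
      · linear_combination this
      all_goals ring
    rw [smul_mul_smul_comm, h2, smul_smul]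
    field_simp
    simp

theorem rotL_mul (s t : Spin4) : rotL (s * t) = rotL s ∘ₗ rotL t := by
  ext1 a; exact rot_mul s t a

/-- Every element of Spin(4) is a square, so its determinant is a nonzero square. This replaces a
connectedness argument. -/
theorem det_rotL_pos (s : Spin4) : 0 < LinearMap.det (rotL s) := by
  obtain ⟨c, hc, hc2⟩ := exists_norm_one_sq s.1 (norm_sp1 s.1)
  obtain ⟨d, hd, hd2⟩ := exists_norm_one_sq s.2 (norm_sp1 s.2)
  let t : Spin4 := (toSp1 c hc, toSp1 d hd)
  have hs : s = t * t := by
    ext1 <;> apply Subtype.ext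
    · exact hc2.symm
    · exact hd2.symm
  have h1 : LinearMap.det (rotL s) = LinearMap.det (rotL t) * LinearMap.det (rotL t) := by
    rw [hs, rotL_mul, LinearMap.det_comp]
  have h2 : LinearMap.det (rotL s) * LinearMap.det (rotL s⁻¹) = 1 := by
    rw [← LinearMap.det_comp, ← rotL_mul, mul_inv_cancel]
    have : rotL 1 = LinearMap.id := by ext1 a; simp
    rw [this, LinearMap.det_id]
  have h3 : LinearMap.det (rotL s) ≠ 0 := left_ne_zero_of_mul_eq_one h2
  rw [h1] at h3 ⊢
  exact lt_of_le_of_ne (mul_self_nonneg _) h3.symm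

theorem sq_eq_neg_one_of_imaginary {u : ℍ[ℝ]} (h0 : u.re = 0) (h1 : ‖u‖ = 1) : u * u = -1 := by
  have h2 : star u = -u := by ext <;> simp [h0]
  have := mul_star_self_of_norm h1
  rw [h2, mul_neg] at this
  rw [← this, neg_neg]

/-- From (1 - uv)v = u + v = u(1 - uv), the normalized 1 - uv conjugates v to u; it vanishes only if
u = -v. The explicit form is kept because `exists_rot_map_qJ` needs x to commute with i. -/
theorem exists_conj_eq {u v : ℍ[ℝ]} (hu0 : u.re = 0) (hu : ‖u‖ = 1) (hv0 : v.re = 0)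
    (hv : ‖v‖ = 1) (h : u ≠ -v) :
    ∃ r : ℝ, ∃ x : ℍ[ℝ], x = r • (1 - u * v) ∧ ‖x‖ = 1 ∧ x * v * star x = u := by
  have hne : 1 - u * v ≠ 0 := by
    intro h0
    apply h
    have h3 : u * (1 - u * v) = 0 := by rw [h0, mul_zero]
    rw [mul_sub, ← mul_assoc, sq_eq_neg_one_of_imaginary hu0 hu] at h3
    rw [eq_neg_iff_add_eq_zero]
    simpa using h3
  refine ⟨‖1 - u * v‖⁻¹, _, rfl, ?_, ?_⟩
  · rw [norm_smul]; simp [hne]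
  · have hx : ‖‖1 - u * v‖⁻¹ • (1 - u * v)‖ = 1 := by rw [norm_smul]; simp [hne]
    set x := ‖1 - u * v‖⁻¹ • (1 - u * v) with hxdef
    have : x * v = u * x := by
      rw [hxdef, smul_mul_assoc, mul_smul_comm, sub_mul, mul_sub, mul_assoc, ← mul_assoc u u v,
        sq_eq_neg_one_of_imaginary hu0 hu, sq_eq_neg_one_of_imaginary hv0 hv]
      simp [add_comm]
    rw [this, mul_assoc, mul_star_self_of_norm hx, mul_one]

theorem exists_conj_I_eq {u : ℍ[ℝ]} (hu0 : u.re = 0) (hu : ‖u‖ = 1) :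
    ∃ x : ℍ[ℝ], ‖x‖ = 1 ∧ x * qI * star x = u := by
  by_cases h : u = -qI
  · refine ⟨qJ, norm_qJ, ?_⟩
    · rw [h]; ext <;> simp
  · obtain ⟨r, x, -, hx, hxu⟩ := exists_conj_eq hu0 hu rfl norm_qI h
    exact ⟨x, hx, hxu⟩

/-- The basis `1, i, j, k` of the quaternions. -/
def qBasis : Module.Basis (Fin 4) ℝ ℍ[ℝ] := QuaternionAlgebra.basisOneIJK (-1 : ℝ) 0 (-1)

theorem qBasis_repr (q : ℍ[ℝ]) (i : Fin 4) :
    qBasis.repr q i = ![q.re, q.imI, q.imJ, q.imK] i := rfl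

theorem qBasis_zero : qBasis 0 = 1 := by
  apply qBasis.repr.injective
  ext i
  rw [Module.Basis.repr_self, qBasis_repr]
  fin_cases i <;> simp

theorem qBasis_one : qBasis 1 = qI := by
  apply qBasis.repr.injective
  ext i
  rw [Module.Basis.repr_self, qBasis_repr]
  fin_cases i <;> simp

theorem qBasis_two : qBasis 2 = qJ := by
  apply qBasis.repr.injective
  ext i
  rw [Module.Basis.repr_self, qBasis_repr]
  fin_cases i <;> simp

theorem qBasis_three : qBasis 3 = qK := by
  apply qBasis.repr.injective
  ext i
  rw [Module.Basis.repr_self, qBasis_repr]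
  fin_cases i <;> simp

theorem eq_of_inner_imaginary_frame {v : ℍ[ℝ]} (h0 : v.re = 0) (h1 : v.imI = 0) (h2 : v.imJ = 0)
    (h : ‖v‖ = 1) : v = qK ∨ v = -qK := by
  have hn := norm_sq_eq v
  rw [h, h0, h1, h2] at hn
  rcases eq_or_eq_neg_of_sq_eq_sq v.imK 1 (by linarith) with h3 | h3
  · left; ext <;> simp [h0, h1, h2, h3]
  · right; ext <;> simp [h0, h1, h2, h3]

/-- A quaternion linear map is determined by its values on the basis `1, i, j, k`. -/
theorem linearMap_apply_eq (R : ℍ[ℝ] →ₗ[ℝ] ℍ[ℝ]) (a : ℍ[ℝ]) :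
    R a = a.re • R 1 + a.imI • R qI + a.imJ • R qJ + a.imK • R qK := by
  have : a = a.re • 1 + a.imI • qI + a.imJ • qJ + a.imK • qK := by ext <;> simp
  conv_lhs => rw [this]
  simp

theorem linearMap_eq_id {R : ℍ[ℝ] →ₗ[ℝ] ℍ[ℝ]} (h1 : R 1 = 1) (hi : R qI = qI) (hj : R qJ = qJ)
    (hk : R qK = qK) (a : ℍ[ℝ]) : R a = a := by
  rw [linearMap_apply_eq, h1, hi, hj, hk]
  ext <;> simp

/-- A linear isometry fixing `1`, `i` and `j`, of positive determinant, is the identity. -/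
theorem isometry_eq_id {R : ℍ[ℝ] →ₗ[ℝ] ℍ[ℝ]} (hR : ∀ a b, inner ℝ (R a) (R b) = (inner ℝ a b : ℝ))
    (hdet : 0 < LinearMap.det R) (h1 : R 1 = 1) (hi : R qI = qI) (hj : R qJ = qJ) (a : ℍ[ℝ]) :
    R a = a := by
  have k1 := hR qK 1
  have k2 := hR qK qI
  have k3 := hR qK qJ
  have k4 := hR qK qK
  rw [h1] at k1
  rw [hi] at k2
  rw [hj] at k3
  simp only [inner_eq] at k1 k2 k3 k4
  simp at k1 k2 k3 k4
  have hn : ‖R qK‖ = 1 := norm_eq_one_of_sq (by linear_combination k4)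
  rcases eq_of_inner_imaginary_frame k1 k2 k3 hn with hk | hk
  · exact linearMap_eq_id h1 hi hj hk a
  · exfalso
    have hd : LinearMap.det R = -1 := by
      have hm : LinearMap.toMatrix qBasis qBasis R = Matrix.diagonal ![1, 1, 1, -1] := by
        ext i j
        rw [LinearMap.toMatrix_apply]
        fin_cases j <;> simp [qBasis_zero, qBasis_one, qBasis_two, qBasis_three, h1, hi, hj, hk] <;>
          fin_cases i <;> simp [qBasis_repr]
      rw [← LinearMap.det_toMatrix qBasis, hm, Matrix.det_diagonal]
      simp [Fin.prod_univ_four]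
    linarith

theorem imaginary_conj {x q : ℍ[ℝ]} (hq : q.re = 0) : (x * q * star x).re = 0 := by
  simp [hq]; ring

theorem isometry_comp_rot {R : ℍ[ℝ] →ₗ[ℝ] ℍ[ℝ]}
    (hR : ∀ a b, inner ℝ (R a) (R b) = (inner ℝ a b : ℝ)) (s : Spin4) (a b : ℍ[ℝ]) :
    inner ℝ ((rotL s ∘ₗ R) a) ((rotL s ∘ₗ R) b) = (inner ℝ a b : ℝ) := by
  simp [inner_rot, hR]

theorem exists_rot_map_one {v : ℍ[ℝ]} (hv : ‖v‖ = 1) : ∃ s : Spin4, rot s v = 1 :=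
  ⟨(toSp1 (star v) (by rw [norm_star, hv]), 1), by
    simp [rot, star_mul_self_of_norm hv]⟩

/-- The conjugation action of `Sp(1)` on the imaginary quaternions. -/
theorem rot_diag {x : ℍ[ℝ]} (hx : ‖x‖ = 1) (a : ℍ[ℝ]) :
    rot (toSp1 x hx, toSp1 x hx) a = x * a * star x := rfl

theorem exists_rot_map_qI {u : ℍ[ℝ]} (hu0 : u.re = 0) (hu : ‖u‖ = 1) :
    ∃ s : Spin4, rot s 1 = 1 ∧ rot s u = qI := by
  obtain ⟨x, hx, hxu⟩ := exists_conj_I_eq hu0 hu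
  have hs : ‖star x‖ = 1 := by rw [norm_star, hx]
  refine ⟨(toSp1 _ hs, toSp1 _ hs), ?_, ?_⟩
  · rw [rot_diag, mul_one, star_star, star_mul_self_of_norm hx]
  · rw [rot_diag, ← hxu, star_star]
    calc star x * (x * qI * star x) * x = (star x * x) * qI * (star x * x) := by noncomm_ring
      _ = qI := by rw [star_mul_self_of_norm hx]; simp

/-- For u in the plane of j and k, the conjugating element 1 - ju lies in the plane of 1 and i, so
conjugation by it fixes i. For u = -j conjugation by i itself works. -/
theorem exists_rot_map_qJ {u : ℍ[ℝ]} (hu0 : u.re = 0) (hu1 : u.imI = 0) (hu : ‖u‖ = 1) :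
    ∃ s : Spin4, rot s 1 = 1 ∧ rot s qI = qI ∧ rot s u = qJ := by
  have key : ∃ x : ℍ[ℝ], ‖x‖ = 1 ∧ x * qI = qI * x ∧ x * u * star x = qJ := by
    by_cases h : qJ = -u
    · refine ⟨qI, norm_qI, rfl, ?_⟩
      rw [eq_neg_iff_add_eq_zero, ← neg_eq_iff_add_eq_zero] at h
      rw [← h]
      ext <;> simp
    · obtain ⟨r, x, hr, hx, hxu⟩ := exists_conj_eq re_qJ norm_qJ hu0 hu h
      refine ⟨x, hx, ?_, hxu⟩
      rw [hr]
      ext <;> simp [hu0, hu1]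
  obtain ⟨x, hx, hxi, hxu⟩ := key
  refine ⟨(toSp1 _ hx, toSp1 _ hx), ?_, ?_, ?_⟩
  · rw [rot_diag, mul_one, mul_star_self_of_norm hx]
  · rw [rot_diag, hxi, mul_assoc, mul_star_self_of_norm hx, mul_one]
  · rw [rot_diag, hxu]

theorem norm_eq_one_of_inner {v : ℍ[ℝ]} (h : inner ℝ v v = (1 : ℝ)) : ‖v‖ = 1 := by
  rw [real_inner_self_eq_norm_sq] at h
  nlinarith [norm_nonneg v]

/-- `Spin(4) → SO(4)` is surjective. -/
theorem exists_rot_eq {R : ℍ[ℝ] →ₗ[ℝ] ℍ[ℝ]}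
    (hR : ∀ a b, inner ℝ (R a) (R b) = (inner ℝ a b : ℝ)) (hdet : 0 < LinearMap.det R) :
    ∃ s : Spin4, ∀ a, R a = rot s a := by
  have hn : ∀ v, ‖v‖ = 1 → ‖R v‖ = 1 := fun v hv => norm_eq_one_of_inner (by
    rw [hR, real_inner_self_eq_norm_sq, hv]; simp)
  obtain ⟨s₁, h1⟩ := exists_rot_map_one (hn 1 (by simp))
  have hR1 := isometry_comp_rot hR s₁
  set R₁ := rotL s₁ ∘ₗ R with hR₁
  have e11 : R₁ 1 = 1 := h1
  have i1 : (R₁ qI).re = 0 := by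
    have := hR1 qI 1
    rw [e11, inner_eq, inner_eq] at this
    simpa using this
  have n1 : ‖R₁ qI‖ = 1 := norm_eq_one_of_inner (by
    rw [hR1, real_inner_self_eq_norm_sq, norm_qI]; simp)
  obtain ⟨s₂, h21, h2⟩ := exists_rot_map_qI i1 n1
  have hR2 := isometry_comp_rot hR1 s₂
  set R₂ := rotL s₂ ∘ₗ R₁ with hR₂
  have e21 : R₂ 1 = 1 := by rw [hR₂, LinearMap.comp_apply, e11]; exact h21
  have e22 : R₂ qI = qI := h2
  have j1 : (R₂ qJ).re = 0 := by
    have := hR2 qJ 1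
    rw [e21, inner_eq, inner_eq] at this
    simpa using this
  have j2 : (R₂ qJ).imI = 0 := by
    have := hR2 qJ qI
    rw [e22, inner_eq, inner_eq] at this
    simpa using this
  have n2 : ‖R₂ qJ‖ = 1 := norm_eq_one_of_inner (by
    rw [hR2, real_inner_self_eq_norm_sq, norm_qJ]; simp)
  obtain ⟨s₃, h31, h32, h3⟩ := exists_rot_map_qJ j1 j2 n2
  have hR3 := isometry_comp_rot hR2 s₃
  -- The images of 1, i, j have been straightened in turn, each rotation fixing the earlier vectors;
  -- positivity of the determinant now excludes k ↦ -k.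
  have hid : ∀ a, (rotL s₃ ∘ₗ R₂) a = a := by
    apply isometry_eq_id hR3
    · rw [LinearMap.det_comp, hR₂, LinearMap.det_comp, hR₁, LinearMap.det_comp]
      exact mul_pos (det_rotL_pos _) (mul_pos (det_rotL_pos _) (mul_pos (det_rotL_pos _) hdet))
    · rw [LinearMap.comp_apply, e21]; exact h31
    · rw [LinearMap.comp_apply, e22]; exact h32
    · exact h3
  refine ⟨(s₃ * s₂ * s₁)⁻¹, fun a => ?_⟩
  have h4 : rot s₃ (rot s₂ (rot s₁ (R a))) = a := hid a
  rw [← rot_mul, ← rot_mul] at h4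
  rw [← rot_inv_rot (s₃ * s₂ * s₁) (R a), h4]


/-! ### Positive definite operators and their square roots -/

section PosDef

variable {E : Type*} [NormedAddCommGroup E] [InnerProductSpace ℝ E]

/-- Symmetric positive definite operators on a real inner product space. -/
def IsPosDef (T : E →L[ℝ] E) : Prop :=
  (∀ a b, inner ℝ (T a) b = (inner ℝ a (T b) : ℝ)) ∧ ∀ a, a ≠ 0 → 0 < (inner ℝ (T a) a : ℝ)

theorem IsPosDef.isSymmetric {T : E →L[ℝ] E} (hT : IsPosDef T) :
    (T : E →ₗ[ℝ] E).IsSymmetric := hT.1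

theorem IsPosDef.injective {T : E →L[ℝ] E} (hT : IsPosDef T) : Function.Injective T := by
  rw [injective_iff_map_eq_zero]
  intro a ha
  by_contra h
  have := hT.2 a h
  rw [ha, inner_zero_left] at this
  exact lt_irrefl _ this

/-- The operator with prescribed eigenvalues in an orthonormal basis. -/
def diagOp {ι : Type*} [Fintype ι] (b : OrthonormalBasis ι ℝ E) (c : ι → ℝ) : E →L[ℝ] E :=
  ∑ i, c i • (innerSL ℝ (b i)).smulRight (b i)

theorem diagOp_apply {ι : Type*} [Fintype ι] (b : OrthonormalBasis ι ℝ E) (c : ι → ℝ) (a : E) :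
    diagOp b c a = ∑ i, (c i * inner ℝ (b i) a) • b i := by
  simp [diagOp, smul_smul]

theorem inner_diagOp {ι : Type*} [Fintype ι] (b : OrthonormalBasis ι ℝ E) (c : ι → ℝ) (a d : E) :
    inner ℝ (diagOp b c a) d = ∑ i, c i * inner ℝ (b i) a * inner ℝ (b i) d := by
  simp [diagOp_apply, sum_inner, inner_smul_left]

theorem isPosDef_diagOp {ι : Type*} [Fintype ι] (b : OrthonormalBasis ι ℝ E) {c : ι → ℝ}
    (hc : ∀ i, 0 < c i) : IsPosDef (diagOp b c) := by
  refine ⟨fun a d => ?_, fun a ha => ?_⟩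
  · rw [inner_diagOp, real_inner_comm, inner_diagOp]
    exact Finset.sum_congr rfl fun i _ => by ring
  · rw [inner_diagOp]
    apply Finset.sum_pos'
    · intro i _
      rw [mul_assoc]
      exact mul_nonneg (hc i).le (mul_self_nonneg _)
    · by_contra! h
      apply ha
      have h0 : ∀ i, inner ℝ (b i) a = (0 : ℝ) := by
        intro i
        have := h i (Finset.mem_univ i)
        rw [mul_assoc] at this
        have h2 := mul_self_nonneg (inner ℝ (b i) a : ℝ)
        have h3 : (inner ℝ (b i) a : ℝ) * inner ℝ (b i) a = 0 := by
          by_contra h4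
          have := mul_pos (hc i) (lt_of_le_of_ne h2 (Ne.symm h4))
          linarith
        exact mul_self_eq_zero.1 h3
      have h5 := b.sum_sq_norm_inner_right a
      simp only [h0, norm_zero] at h5
      simpa using h5.symm

theorem diagOp_basis {ι : Type*} [Fintype ι] [DecidableEq ι] (b : OrthonormalBasis ι ℝ E)
    (c : ι → ℝ) (j : ι) : diagOp b c (b j) = c j • b j := by
  rw [diagOp_apply, Finset.sum_eq_single j]
  · simp
  · intro i _ hij
    rw [b.inner_eq_ite, if_neg hij]; simp
  · simp

variable [FiniteDimensional ℝ E]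

theorem IsPosDef.isUnit {T : E →L[ℝ] E} (hT : IsPosDef T) : IsUnit T := by
  have hs : Function.Surjective T := LinearMap.surjective_of_injective (f := (T : E →ₗ[ℝ] E))
    hT.injective
  have : CompleteSpace E := FiniteDimensional.complete ℝ E
  exact ContinuousLinearMap.isUnit_iff_bijective.2 ⟨hT.injective, hs⟩

theorem IsPosDef.inverse {T : E →L[ℝ] E} (hT : IsPosDef T) : IsPosDef (Ring.inverse T) := by
  obtain ⟨u, rfl⟩ := hT.isUnit
  rw [Ring.inverse_unit]
  have h1 : ∀ a, (u : E →L[ℝ] E) ((↑u⁻¹ : E →L[ℝ] E) a) = a := fun a => by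
    rw [← mul_apply_eq_comp, Units.mul_inv]; rfl
  refine ⟨fun a b => ?_, fun a ha => ?_⟩
  · conv_lhs => rw [← h1 b]
    rw [← hT.1, h1]
  · have h2 : (↑u⁻¹ : E →L[ℝ] E) a ≠ 0 := by
      intro h
      apply ha
      rw [← h1 a, h, map_zero]
    have := hT.2 _ h2
    rwa [h1, real_inner_comm] at this

theorem IsPosDef.exists_sqrt {T : E →L[ℝ] E} (hT : IsPosDef T) :
    ∃ p : E →L[ℝ] E, IsPosDef p ∧ p * p = T := by
  have hS := hT.isSymmetric
  let b := hS.eigenvectorBasis rfl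
  have hb : ∀ i, T (b i) = hS.eigenvalues rfl i • b i := fun i => hS.apply_eigenvectorBasis rfl i
  have hpos : ∀ i, 0 < hS.eigenvalues rfl i := by
    intro i
    have h1 := hT.2 (b i) (b.orthonormal.ne_zero i)
    rw [hb i, inner_smul_left, real_inner_self_eq_norm_sq, b.orthonormal.1 i] at h1
    simpa using h1
  refine ⟨diagOp b fun i => Real.sqrt (hS.eigenvalues rfl i),
    isPosDef_diagOp b fun i => Real.sqrt_pos.2 (hpos i), ?_⟩
  have : ((diagOp b fun i => Real.sqrt (hS.eigenvalues rfl i)) *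
      (diagOp b fun i => Real.sqrt (hS.eigenvalues rfl i)) : E →ₗ[ℝ] E) = T := by
    apply b.toBasis.ext
    intro i
    simp only [OrthonormalBasis.coe_toBasis]
    change diagOp b _ (diagOp b _ (b i)) = T (b i)
    rw [diagOp_basis, map_smul, diagOp_basis, hb, smul_smul, Real.mul_self_sqrt (hpos i).le]
  ext a
  exact congrArg (fun f : E →ₗ[ℝ] E => f a) this

/-- On a unit eigenvector b of p - q with eigenvalue μ, the form of p² - q² = p(p - q) + (p - q)q
takes the value μ(⟨pb, b⟩ + ⟨qb, b⟩), and the bracket is at least c. The estimate yields both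
uniqueness and continuity of positive square roots. -/
theorem IsPosDef.norm_sub_le {p q : E →L[ℝ] E} (hp : IsPosDef p) (hq : IsPosDef q) {c : ℝ}
    (hc : 0 < c) (hpc : ∀ v, c * ‖v‖ ^ 2 ≤ inner ℝ (p v) v) :
    ‖p - q‖ ≤ c⁻¹ * ‖p * p - q * q‖ := by
  have hS : ((p - q : E →L[ℝ] E) : E →ₗ[ℝ] E).IsSymmetric := fun a b => by
    simp [inner_sub_left, inner_sub_right, hp.1 a b, hq.1 a b]
  let b := hS.eigenvectorBasis rfl
  set μ := hS.eigenvalues rfl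
  have hb : ∀ i, (p - q) (b i) = μ i • b i := fun i => hS.apply_eigenvectorBasis rfl i
  have hM : ∀ i, |μ i| ≤ c⁻¹ * ‖p * p - q * q‖ := by
    intro i
    have hn : ‖b i‖ = 1 := b.orthonormal.1 i
    have e1 : inner ℝ ((p * p - q * q) (b i)) (b i)
        = μ i * (inner ℝ (p (b i)) (b i) + inner ℝ (q (b i)) (b i)) := by
      have : (p * p - q * q) (b i) = p ((p - q) (b i)) + (p - q) (q (b i)) := by
        simp
      rw [this, inner_add_left, hb, map_smul, inner_smul_left]
      have h2 : inner ℝ ((p - q) (q (b i))) (b i) = (inner ℝ (q (b i)) ((p - q) (b i)) : ℝ) :=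
        hS _ _
      rw [h2, hb, inner_smul_right]
      simp
      ring
    have e2 : |inner ℝ ((p * p - q * q) (b i)) (b i)| ≤ ‖p * p - q * q‖ := by
      refine (abs_real_inner_le_norm _ _).trans ?_
      rw [hn, mul_one]
      simpa [hn] using (p * p - q * q).le_opNorm (b i)
    have e3 : c ≤ inner ℝ (p (b i)) (b i) + inner ℝ (q (b i)) (b i) := by
      have h1 := hpc (b i)
      have h2 := hq.2 (b i) (b.orthonormal.ne_zero i)
      rw [hn] at h1
      linarith
    rw [e1, abs_mul, abs_of_pos (lt_of_lt_of_le hc e3)] at e2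
    rw [inv_mul_eq_div, le_div_iff₀ hc]
    exact (mul_le_mul_of_nonneg_left e3 (abs_nonneg _)).trans e2
  have hK : 0 ≤ c⁻¹ * ‖p * p - q * q‖ := by positivity
  refine ContinuousLinearMap.opNorm_le_bound _ hK fun a => ?_
  refine le_of_sq_le_sq ?_ (by positivity)
  rw [← b.sum_sq_norm_inner_right ((p - q) a), mul_pow, ← b.sum_sq_norm_inner_right a,
    Finset.mul_sum]
  refine Finset.sum_le_sum fun i _ => ?_
  have h2 : inner ℝ (b i) ((p - q) a) = μ i * inner ℝ (b i) a := by
    have : inner ℝ ((p - q) (b i)) a = (inner ℝ (b i) ((p - q) a) : ℝ) := hS _ _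
    rw [← this, hb, inner_smul_left]; simp
  rw [h2, norm_mul, mul_pow]
  gcongr
  exact hM i

theorem IsPosDef.exists_lower_bound [Nontrivial E] {p : E →L[ℝ] E} (hp : IsPosDef p) :
    ∃ c : ℝ, 0 < c ∧ ∀ v, c * ‖v‖ ^ 2 ≤ inner ℝ (p v) v := by
  have : ProperSpace E := FiniteDimensional.proper ℝ E
  obtain ⟨x, hx, hmin⟩ := (isCompact_sphere (0 : E) 1).exists_isMinOn
    (NormedSpace.sphere_nonempty.2 zero_le_one)
    (f := fun v => (inner ℝ (p v) v : ℝ)) (by fun_prop)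
  have hx0 : x ≠ 0 := by rintro rfl; simp at hx
  refine ⟨_, hp.2 x hx0, fun v => ?_⟩
  by_cases hv : v = 0
  · simp [hv]
  · have hv' : ‖v‖ ≠ 0 := norm_ne_zero_iff.2 hv
    have h1 := hmin (show ‖v‖⁻¹ • v ∈ Metric.sphere (0 : E) 1 by
      simp [norm_smul, hv'])
    simp only [Set.mem_ofPred_eq, map_smul, inner_smul_left, inner_smul_right] at h1
    simp only [conj_trivial] at h1
    calc _ ≤ ‖v‖⁻¹ * (‖v‖⁻¹ * inner ℝ (p v) v) * ‖v‖ ^ 2 := by gcongr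
      _ = _ := by field_simp

theorem IsPosDef.eq_of_mul_self_eq [Nontrivial E] {p q : E →L[ℝ] E} (hp : IsPosDef p)
    (hq : IsPosDef q) (h : p * p = q * q) : p = q := by
  obtain ⟨c, hc, hpc⟩ := hp.exists_lower_bound
  have := hp.norm_sub_le hq hc hpc
  rw [h, sub_self, norm_zero, mul_zero] at this
  exact sub_eq_zero.1 (norm_le_zero_iff.1 this)

open Classical in
/-- The inverse square root of a positive definite operator. -/
def invSqrt (T : E →L[ℝ] E) : E →L[ℝ] E :=
  if h : IsPosDef T then h.inverse.exists_sqrt.choose else 0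

theorem isPosDef_invSqrt {T : E →L[ℝ] E} (h : IsPosDef T) : IsPosDef (invSqrt T) := by
  rw [invSqrt, dif_pos h]; exact h.inverse.exists_sqrt.choose_spec.1

theorem invSqrt_mul_self {T : E →L[ℝ] E} (h : IsPosDef T) :
    invSqrt T * invSqrt T = Ring.inverse T := by
  rw [invSqrt, dif_pos h]; exact h.inverse.exists_sqrt.choose_spec.2

theorem invSqrt_mul_mul {T : E →L[ℝ] E} (h : IsPosDef T) :
    invSqrt T * T * invSqrt T = 1 := by
  have h1 : invSqrt T * (invSqrt T * T) = 1 := by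
    rw [← mul_assoc, invSqrt_mul_self h, Ring.inverse_mul_cancel _ h.isUnit]
  exact (isPosDef_invSqrt h).isUnit.isRegular.left (by
    change invSqrt T * (invSqrt T * T * invSqrt T) = invSqrt T * 1
    rw [← mul_assoc, h1, one_mul, mul_one])

/-- The bound of `IsPosDef.norm_sub_le` needs a lower bound for only one of the two roots, so the
constant at y₀ serves for all y, and continuity follows from that of inversion. -/
theorem continuous_invSqrt [Nontrivial E] {Y : Type*} [TopologicalSpace Y] {H : Y → E →L[ℝ] E}
    (hH : ∀ y, IsPosDef (H y)) (hc : Continuous H) : Continuous fun y => invSqrt (H y) := by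
  have : CompleteSpace E := FiniteDimensional.complete ℝ E
  have hinv : Continuous fun y => Ring.inverse (H y) := by
    rw [continuous_iff_continuousAt]
    intro y
    obtain ⟨u, hu⟩ := (hH y).isUnit
    have := NormedRing.inverse_continuousAt u
    rw [hu] at this
    exact this.comp hc.continuousAt
  rw [continuous_iff_continuousAt]
  intro y₀
  obtain ⟨c, hc0, hpc⟩ := (isPosDef_invSqrt (hH y₀)).exists_lower_bound
  rw [ContinuousAt, tendsto_iff_norm_sub_tendsto_zero]
  have hlim : Filter.Tendsto (fun y => c⁻¹ * ‖Ring.inverse (H y) - Ring.inverse (H y₀)‖) (𝓝 y₀)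
      (𝓝 0) := by
    have := (tendsto_iff_norm_sub_tendsto_zero.1 (hinv.tendsto y₀)).const_mul c⁻¹
    rwa [mul_zero] at this
  refine squeeze_zero (fun _ => norm_nonneg _) (fun y => ?_) hlim
  rw [norm_sub_rev, norm_sub_rev (Ring.inverse _), ← invSqrt_mul_self (hH y),
    ← invSqrt_mul_self (hH y₀)]
  exact (isPosDef_invSqrt (hH y₀)).norm_sub_le (isPosDef_invSqrt (hH y)) hc0 hpc

end PosDef


/-! ### The quaternionic structure of the tangent bundle of the disk bundle -/

/-- Right multiplication by quaternions on pairs of vectors orthogonal to the unit vector `u`. -/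
def qmul (u : ℍ[ℝ]) (m : ℍ[ℝ] × ℍ[ℝ]) (y : ℍ[ℝ]) : ℍ[ℝ] × ℍ[ℝ] :=
  (y.re • m.1 - y.imI • (u * m.1) - y.imJ • (u * m.2) + y.imK • m.2,
    y.re • m.2 + y.imI • (u * m.2) - y.imJ • (u * m.1) - y.imK • m.1)

/-- Pairs of imaginary quaternions orthogonal to `u`. -/
def IsNormal (u : ℍ[ℝ]) (m : ℍ[ℝ] × ℍ[ℝ]) : Prop :=
  m.1.re = 0 ∧ m.2.re = 0 ∧ inner ℝ u m.1 = (0 : ℝ) ∧ inner ℝ u m.2 = (0 : ℝ)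

theorem qmul_add (u : ℍ[ℝ]) (m : ℍ[ℝ] × ℍ[ℝ]) (y z : ℍ[ℝ]) :
    qmul u m (y + z) = qmul u m y + qmul u m z := by
  simp only [qmul, Quaternion.re_add, Quaternion.imI_add, Quaternion.imJ_add, Quaternion.imK_add,
    add_smul, Prod.mk_add_mk, Prod.mk.injEq]
  constructor <;> abel

theorem qmul_smul (u : ℍ[ℝ]) (m : ℍ[ℝ] × ℍ[ℝ]) (c : ℝ) (y : ℍ[ℝ]) :
    qmul u m (c • y) = c • qmul u m y := by
  simp only [qmul, Quaternion.re_smul, Quaternion.imI_smul, Quaternion.imJ_smul,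
    Quaternion.imK_smul, smul_eq_mul, mul_smul, Prod.smul_mk, smul_add, smul_sub]

@[simp] theorem qmul_one (u : ℍ[ℝ]) (m : ℍ[ℝ] × ℍ[ℝ]) : qmul u m 1 = m := by
  simp [qmul]

/-- `qmul u m` as a linear map. -/
def qmulL (u : ℍ[ℝ]) (m : ℍ[ℝ] × ℍ[ℝ]) : ℍ[ℝ] →ₗ[ℝ] ℍ[ℝ] × ℍ[ℝ] where
  toFun := qmul u m
  map_add' := qmul_add u m
  map_smul' := qmul_smul u m

theorem qmul_neg (u : ℍ[ℝ]) (m : ℍ[ℝ] × ℍ[ℝ]) (y : ℍ[ℝ]) : qmul u m (-y) = -qmul u m y :=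
  map_neg (qmulL u m) y

/-- On the normal pairs, u^⊥ ⊕ u^⊥ becomes a right quaternionic line: i acts as -u on the first
summand and u on the second, k exchanges the summands up to sign. It depends only on the base point
u, hence is defined over the whole disk bundle and trivializes one Sp(1) factor. -/
theorem qmul_mul {u : ℍ[ℝ]} (hu : u * u = -1) (m : ℍ[ℝ] × ℍ[ℝ]) (y z : ℍ[ℝ]) :
    qmul u (qmul u m y) z = qmul u m (y * z) := by
  have h : ∀ w : ℍ[ℝ], u * (u * w) = -w := fun w => by rw [← mul_assoc, hu, neg_one_mul]
  simp only [qmul, mul_add, mul_sub, mul_smul_comm, h, Quaternion.re_mul, Quaternion.imI_mul,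
    Quaternion.imJ_mul, Quaternion.imK_mul, Prod.mk.injEq]
  constructor <;> module

theorem isNormal_qmul {u : ℍ[ℝ]} (h0 : u.re = 0) {m : ℍ[ℝ] × ℍ[ℝ]}
    (hm : IsNormal u m) (y : ℍ[ℝ]) : IsNormal u (qmul u m y) := by
  obtain ⟨h1, h2, h3, h4⟩ := hm
  rw [inner_eq] at h3 h4
  simp only [h0, h1, h2] at h3 h4
  refine ⟨?_, ?_, ?_, ?_⟩ <;>
    simp only [inner_eq, qmul, Quaternion.re_add, Quaternion.imI_add, Quaternion.imJ_add,
      Quaternion.imK_add, Quaternion.re_sub, Quaternion.imI_sub, Quaternion.imJ_sub,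
      Quaternion.imK_sub, Quaternion.re_smul, Quaternion.imI_smul, Quaternion.imJ_smul,
      Quaternion.imK_smul, Quaternion.re_mul, Quaternion.imI_mul,
      Quaternion.imJ_mul, Quaternion.imK_mul, smul_eq_mul, h0, h1, h2]
  · linear_combination y.imI * h3 + y.imJ * h4
  · linear_combination -y.imI * h4 + y.imJ * h3
  · linear_combination y.re * h3 + y.imK * h4
  · linear_combination y.re * h4 - y.imK * h3

theorem inner_qmul {u : ℍ[ℝ]} (h0 : u.re = 0) (h1 : ‖u‖ = 1) (m : ℍ[ℝ] × ℍ[ℝ]) (y z : ℍ[ℝ]) :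
    (inner ℝ (qmul u m y).1 (qmul u m z).1 + inner ℝ (qmul u m y).2 (qmul u m z).2 : ℝ)
      = (‖m.1‖ ^ 2 + ‖m.2‖ ^ 2) * inner ℝ y z := by
  have hs : ∀ a b : ℍ[ℝ], inner ℝ (u * a) (u * b) = (inner ℝ a b : ℝ) :=
    inner_mul_left_of_norm h1
  have hk : ∀ a b : ℍ[ℝ], inner ℝ (u * a) b = (-inner ℝ a (u * b) : ℝ) := fun a b => by
    simp only [inner_eq, Quaternion.re_mul, Quaternion.imI_mul,
      Quaternion.imJ_mul, Quaternion.imK_mul, h0]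
    ring
  have ha : ∀ a : ℍ[ℝ], inner ℝ a (u * a) = (0 : ℝ) := fun a => by
    have := hk a a
    rw [real_inner_comm] at this
    linarith
  simp only [qmul, inner_add_left, inner_add_right, inner_sub_left, inner_sub_right,
    inner_smul_left, inner_smul_right, hs, hk, ha, real_inner_self_eq_norm_sq, conj_trivial]
  have h12 : inner ℝ m.2 (u * m.1) = (-inner ℝ m.1 (u * m.2) : ℝ) := by
    rw [real_inner_comm, hk]
  rw [h12, real_inner_comm m.1 m.2, inner_eq y z]
  ring

/-- The standard model `ℍ → i^⊥ ⊕ i^⊥`. -/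
def psiZero (q : ℍ[ℝ]) : ℍ[ℝ] × ℍ[ℝ] := (q.imK • qJ - q.imJ • qK, q.re • qJ + q.imI • qK)

/-- Conjugation of pairs by a quaternion. -/
def conjPair (x : ℍ[ℝ]) (w : ℍ[ℝ] × ℍ[ℝ]) : ℍ[ℝ] × ℍ[ℝ] := (x * w.1 * star x, x * w.2 * star x)

/-- Equivariance under rotations of the sphere, which reduces computations at an arbitrary base
point to u = i. -/
theorem qmul_conjPair {x : ℍ[ℝ]} (hx : ‖x‖ = 1) (u : ℍ[ℝ]) (w : ℍ[ℝ] × ℍ[ℝ]) (y : ℍ[ℝ]) :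
    qmul (x * u * star x) (conjPair x w) y = conjPair x (qmul u w y) := by
  have h : ∀ a : ℍ[ℝ], x * u * star x * (x * a * star x) = x * (u * a) * star x := fun a => by
    calc x * u * star x * (x * a * star x) = x * u * (star x * x) * a * star x := by noncomm_ring
      _ = _ := by rw [star_mul_self_of_norm hx]; noncomm_ring
  simp only [qmul, conjPair, h, mul_add, mul_sub, add_mul, sub_mul, mul_smul_comm, smul_mul_assoc]

/-- In the model at u = i the quaternionic structure is ordinary right multiplication on ℍ; this is
what the signs in `psiZero` and `qmul` are chosen for. -/
theorem qmul_psiZero (q y : ℍ[ℝ]) : qmul qI (psiZero q) y = psiZero (q * y) := by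
  ext <;> simp [qmul, psiZero] <;> ring

theorem conjPair_conjPair_star {x : ℍ[ℝ]} (hx : ‖x‖ = 1) (w : ℍ[ℝ] × ℍ[ℝ]) :
    conjPair x (conjPair (star x) w) = w := by
  have h : ∀ a : ℍ[ℝ], x * (star x * a * star (star x)) * star x = a := fun a => by
    rw [star_star]
    calc x * (star x * a * x) * star x = (x * star x) * a * (x * star x) := by noncomm_ring
      _ = a := by rw [mul_star_self_of_norm hx]; simp
  simp only [conjPair, h]

theorem inner_conj {x : ℍ[ℝ]} (hx : ‖x‖ = 1) (a b : ℍ[ℝ]) :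
    inner ℝ (x * a * star x) (x * b * star x) = (inner ℝ a b : ℝ) := by
  rw [inner_mul_right_of_norm (by rw [norm_star, hx]), inner_mul_left_of_norm hx]

theorem exists_eq_conjPair_psiZero {x : ℍ[ℝ]} (hx : ‖x‖ = 1) {w : ℍ[ℝ] × ℍ[ℝ]}
    (hw : IsNormal (x * qI * star x) w) : ∃ q, w = conjPair x (psiZero q) := by
  obtain ⟨h1, h2, h3, h4⟩ := hw
  have hw' := conjPair_conjPair_star hx w
  set v := conjPair (star x) w with hv
  rw [← hw'] at h1 h2 h3 h4
  simp only [conjPair] at h3 h4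
  rw [inner_conj hx, inner_eq] at h3 h4
  simp at h3 h4
  have h5 : v.1.re = 0 := by
    rw [hv, conjPair]
    exact imaginary_conj (by rw [← hw']; exact h1)
  have h6 : v.2.re = 0 := by
    rw [hv, conjPair]
    exact imaginary_conj (by rw [← hw']; exact h2)
  refine ⟨⟨v.2.imJ, v.2.imK, -v.1.imK, v.1.imJ⟩, ?_⟩
  conv_lhs => rw [← hw']
  congr 1
  ext <;> simp [psiZero, h3, h4, h5, h6]

theorem norm_psiZero (q : ℍ[ℝ]) : ‖(psiZero q).1‖ ^ 2 + ‖(psiZero q).2‖ ^ 2 = ‖q‖ ^ 2 := by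
  simp only [norm_sq_eq]
  simp [psiZero]; ring

theorem norm_conj {x : ℍ[ℝ]} (hx : ‖x‖ = 1) (a : ℍ[ℝ]) : ‖x * a * star x‖ = ‖a‖ := by
  rw [norm_mul, norm_mul, norm_star, hx]; simp

theorem isNormal_psiZero {x : ℍ[ℝ]} (hx : ‖x‖ = 1) (q : ℍ[ℝ]) :
    IsNormal (x * qI * star x) (conjPair x (psiZero q)) := by
  refine ⟨imaginary_conj (by simp [psiZero]), imaginary_conj (by simp [psiZero]), ?_, ?_⟩
  · rw [conjPair, inner_conj hx, inner_eq]; simp [psiZero]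
  · rw [conjPair, inner_conj hx, inner_eq]; simp [psiZero]

/-- The quaternionic structure is transitive: division of normal pairs. -/
theorem exists_qmul_eq {u : ℍ[ℝ]} (h0 : u.re = 0) (h1 : ‖u‖ = 1) {m n : ℍ[ℝ] × ℍ[ℝ]}
    (hm : IsNormal u m) (hm1 : ‖m.1‖ ^ 2 + ‖m.2‖ ^ 2 = 1) (hn : IsNormal u n) :
    ∃ y, qmul u m y = n := by
  obtain ⟨x, hx, rfl⟩ := exists_conj_I_eq h0 h1
  obtain ⟨q, rfl⟩ := exists_eq_conjPair_psiZero hx hm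
  obtain ⟨q', rfl⟩ := exists_eq_conjPair_psiZero hx hn
  simp only [conjPair, norm_conj hx] at hm1
  rw [norm_psiZero] at hm1
  have hq : q ≠ 0 := by rintro rfl; simp at hm1
  exact ⟨q⁻¹ * q', by rw [qmul_conjPair hx, qmul_psiZero, mul_inv_cancel_left₀ hq]⟩

/-- The tangent vector of the disk bundle at `p` with horizontal and vertical components `n`. -/
def tangentOf (p n : ℍ[ℝ] × ℍ[ℝ]) : ℍ[ℝ] × ℍ[ℝ] := (n.1, n.2 - (inner ℝ n.1 p.2 : ℝ) • p.1)

/-- `tangentOf` as a linear map. -/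
def tangentOfL (p : ℍ[ℝ] × ℍ[ℝ]) : ℍ[ℝ] × ℍ[ℝ] →ₗ[ℝ] ℍ[ℝ] × ℍ[ℝ] where
  toFun := tangentOf p
  map_add' n n' := by
    simp only [tangentOf, Prod.fst_add, Prod.snd_add, inner_add_left, add_smul, Prod.mk_add_mk,
      Prod.mk.injEq, true_and]
    abel
  map_smul' c n := by
    simp [tangentOf, inner_smul_left, smul_sub, mul_smul]

theorem isTangent_tangentOf {p n : ℍ[ℝ] × ℍ[ℝ]} (hp : p ∈ diskBundle) (hn : IsNormal p.1 n) :
    IsTangent p (tangentOf p n) := by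
  obtain ⟨h1, h2, h3, h4, -⟩ := hp
  obtain ⟨k1, k2, k3, k4⟩ := hn
  refine ⟨k1, ?_, k3, ?_⟩
  · simp [tangentOf, k2, h1]
  · simp only [tangentOf, inner_sub_right, inner_smul_right, k4, real_inner_self_eq_norm_sq, h3]
    ring

theorem exists_eq_tangentOf {p w : ℍ[ℝ] × ℍ[ℝ]} (hp : p ∈ diskBundle) (hw : IsTangent p w) :
    ∃ n, IsNormal p.1 n ∧ w = tangentOf p n := by
  obtain ⟨h1, h2, h3, h4, -⟩ := hp
  obtain ⟨k1, k2, k3, k4⟩ := hw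
  refine ⟨(w.1, w.2 + (inner ℝ w.1 p.2 : ℝ) • p.1), ⟨k1, by simp [k2, h1], k3, ?_⟩, ?_⟩
  · simp only [inner_add_right, inner_smul_right, real_inner_self_eq_norm_sq, h3]
    linarith
  · simp [tangentOf]

theorem diskMetric_tangentOf {p n n' : ℍ[ℝ] × ℍ[ℝ]} (hp : p ∈ diskBundle) (hn : IsNormal p.1 n)
    (hn' : IsNormal p.1 n') : diskMetric p (tangentOf p n) (tangentOf p n')
      = inner ℝ n.1 n'.1 + inner ℝ n.2 n'.2 := by
  obtain ⟨-, -, h3, -, -⟩ := hp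
  obtain ⟨-, -, -, k4⟩ := hn
  obtain ⟨-, -, -, l4⟩ := hn'
  simp only [diskMetric, tangentOf, inner_sub_left, inner_sub_right, inner_smul_left,
    inner_smul_right, k4, l4, real_inner_self_eq_norm_sq, h3, conj_trivial]
  rw [real_inner_comm p.1 n.2, k4]
  ring

/-! ### Orientations of frames of the disk bundle -/

theorem coords_add (v w : ℍ[ℝ] × ℍ[ℝ]) (j : Fin 6) : coords (v + w) j = coords v j + coords w j := by
  fin_cases j <;> simp [coords]

theorem coords_smul (c : ℝ) (w : ℍ[ℝ] × ℍ[ℝ]) (j : Fin 6) : coords (c • w) j = c * coords w j := by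
  fin_cases j <;> simp [coords]

/-- The matrix of a linear map in the basis `1, i, j, k`. -/
def qMatrix (R : ℍ[ℝ] →ₗ[ℝ] ℍ[ℝ]) : Matrix (Fin 4) (Fin 4) ℝ :=
  !![(R 1).re, (R 1).imI, (R 1).imJ, (R 1).imK; (R qI).re, (R qI).imI, (R qI).imJ, (R qI).imK;
    (R qJ).re, (R qJ).imI, (R qJ).imJ, (R qJ).imK; (R qK).re, (R qK).imI, (R qK).imJ, (R qK).imK]

theorem det_qMatrix (R : ℍ[ℝ] →ₗ[ℝ] ℍ[ℝ]) : (qMatrix R).det = LinearMap.det R := by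
  rw [← LinearMap.det_toMatrix qBasis, ← Matrix.det_transpose]
  congr 1
  ext i j
  rw [Matrix.transpose_apply, LinearMap.toMatrix_apply]
  fin_cases i <;> fin_cases j <;>
    simp [qMatrix, qBasis_zero, qBasis_one, qBasis_two, qBasis_three, qBasis_repr]

theorem diskDet_eq (p : ℍ[ℝ] × ℍ[ℝ]) (L : ℍ[ℝ] → ℍ[ℝ] × ℍ[ℝ]) :
    diskDet p L = Matrix.det (Matrix.of ![coords (p.1, 0), coords (L 1), coords (L qI),
      coords (0, p.1), coords (L qJ), coords (L qK)]) := rfl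

theorem diskDet_comp (p : ℍ[ℝ] × ℍ[ℝ]) (L : ℍ[ℝ] →ₗ[ℝ] ℍ[ℝ] × ℍ[ℝ]) (R : ℍ[ℝ] →ₗ[ℝ] ℍ[ℝ]) :
    diskDet p (fun a => L (R a)) = LinearMap.det R * diskDet p L := by
  let r := qMatrix R
  -- The matrix of R, bordered by identity rows at positions 0 and 3, where the determinant carries
  -- the fixed normal vectors.
  let B : Matrix (Fin 6) (Fin 6) ℝ :=
    !![1, 0, 0, 0, 0, 0; 0, r 0 0, r 0 1, 0, r 0 2, r 0 3; 0, r 1 0, r 1 1, 0, r 1 2, r 1 3;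
      0, 0, 0, 1, 0, 0; 0, r 2 0, r 2 1, 0, r 2 2, r 2 3; 0, r 3 0, r 3 1, 0, r 3 2, r 3 3]
  have hB : B.det = r.det := by
    simp [B, Matrix.det_succ_row_zero, Fin.sum_univ_succ, Fin.succAbove]
    ring
  have hL : ∀ y : ℍ[ℝ], ∀ j, coords (L y) j = y.re * coords (L 1) j + y.imI * coords (L qI) j
      + y.imJ * coords (L qJ) j + y.imK * coords (L qK) j := by
    intro y j
    have : y = y.re • 1 + y.imI • qI + y.imJ • qJ + y.imK • qK := by ext <;> simp
    conv_lhs => rw [this]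
    simp only [map_add, map_smul, coords_add, coords_smul]
  rw [← det_qMatrix, ← hB, diskDet_eq, diskDet_eq, ← Matrix.det_mul]
  congr 1
  ext i j
  rw [Matrix.mul_apply, Fin.sum_univ_six]
  fin_cases i
  · simp [B]
  · simp only [B, r, qMatrix]; simp; rw [hL (R _)]
  · simp only [B, r, qMatrix]; simp; rw [hL (R _)]
  · simp [B]
  · simp only [B, r, qMatrix]; simp; rw [hL (R _)]
  · simp only [B, r, qMatrix]; simp; rw [hL (R _)]

/-- The basis of pairs of imaginary quaternions corresponding to `coords`. -/
def pairBasis : Fin 6 → ℍ[ℝ] × ℍ[ℝ] := ![(qI, 0), (qJ, 0), (qK, 0), (0, qI), (0, qJ), (0, qK)]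

/-- The matrix of the conjugation of pairs of imaginary quaternions. -/
def conjMatrix (x : ℍ[ℝ]) : Matrix (Fin 6) (Fin 6) ℝ :=
  Matrix.of fun i => coords (conjPair x (pairBasis i))

theorem conjPair_add (x : ℍ[ℝ]) (v w : ℍ[ℝ] × ℍ[ℝ]) :
    conjPair x (v + w) = conjPair x v + conjPair x w := by
  simp [conjPair, mul_add, add_mul]

theorem conjPair_smul (x : ℍ[ℝ]) (c : ℝ) (w : ℍ[ℝ] × ℍ[ℝ]) :
    conjPair x (c • w) = c • conjPair x w := by
  simp [conjPair]

theorem coords_conjPair (x : ℍ[ℝ]) {w : ℍ[ℝ] × ℍ[ℝ]} (h1 : w.1.re = 0) (h2 : w.2.re = 0)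
    (j : Fin 6) : coords (conjPair x w) j = ∑ i, coords w i * conjMatrix x i j := by
  have hw : w = w.1.imI • pairBasis 0 + w.1.imJ • pairBasis 1 + w.1.imK • pairBasis 2
      + w.2.imI • pairBasis 3 + w.2.imJ • pairBasis 4 + w.2.imK • pairBasis 5 := by
    ext <;> simp [pairBasis, h1, h2]
  conv_lhs => rw [hw]
  simp only [conjPair_add, conjPair_smul, coords_add, coords_smul, Fin.sum_univ_six, conjMatrix,
    Matrix.of_apply]
  rfl

theorem conjMatrix_mul (x y : ℍ[ℝ]) : conjMatrix (x * y) = conjMatrix y * conjMatrix x := by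
  ext i j
  rw [Matrix.mul_apply]
  have h : conjPair (x * y) (pairBasis i) = conjPair x (conjPair y (pairBasis i)) := by
    simp [conjPair, mul_assoc]
  have h0 : (pairBasis i).1.re = 0 ∧ (pairBasis i).2.re = 0 := by
    fin_cases i <;> simp [pairBasis]
  conv_lhs => rw [conjMatrix, Matrix.of_apply, h]
  exact coords_conjPair x (imaginary_conj h0.1) (imaginary_conj h0.2) j

theorem conjMatrix_one : conjMatrix 1 = 1 := by
  ext i j
  fin_cases i <;> fin_cases j <;> simp [conjMatrix, conjPair, pairBasis, coords]

theorem det_conjMatrix_pos {x : ℍ[ℝ]} (hx : ‖x‖ = 1) : 0 < (conjMatrix x).det := by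
  obtain ⟨c, -, rfl⟩ := exists_norm_one_sq x hx
  have h1 : (conjMatrix (c * c)).det * (conjMatrix (star (c * c))).det = 1 := by
    rw [← Matrix.det_mul, ← conjMatrix_mul, star_mul_self_of_norm hx, conjMatrix_one,
      Matrix.det_one]
  have h2 : (conjMatrix (c * c)).det = (conjMatrix c).det * (conjMatrix c).det := by
    rw [conjMatrix_mul, Matrix.det_mul]
  have h3 : (conjMatrix (c * c)).det ≠ 0 := left_ne_zero_of_mul_eq_one h1
  rw [h2] at h3 ⊢
  exact lt_of_le_of_ne (mul_self_nonneg _) h3.symm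

/-- The correction in `tangentOf` is a multiple of (0, u), which is row 3 of the determinant, so it
is removed by row operations. -/
theorem diskDet_tangentOf (p : ℍ[ℝ] × ℍ[ℝ]) (L : ℍ[ℝ] → ℍ[ℝ] × ℍ[ℝ]) :
    diskDet p (fun a => tangentOf p (L a)) = diskDet p L := by
  rw [diskDet_eq, diskDet_eq]
  refine Matrix.det_eq_of_forall_row_eq_smul_add_const
    ![0, -inner ℝ (L 1).1 p.2, -inner ℝ (L qI).1 p.2, 0, -inner ℝ (L qJ).1 p.2,
      -inner ℝ (L qK).1 p.2] 3 rfl fun i j => ?_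
  fin_cases i <;> fin_cases j <;> simp [coords, tangentOf] <;> ring

/-- Conjugation by x factors out with positive determinant, leaving a signed permutation matrix of
determinant 1. -/
theorem diskDet_conjPair_psiZero {x : ℍ[ℝ]} (hx : ‖x‖ = 1) (v : ℍ[ℝ]) :
    0 < diskDet (x * qI * star x, v) (fun a => conjPair x (psiZero a)) := by
  have h : (Matrix.of ![coords (x * qI * star x, 0), coords (conjPair x (psiZero 1)),
      coords (conjPair x (psiZero qI)), coords (0, x * qI * star x),
      coords (conjPair x (psiZero qJ)), coords (conjPair x (psiZero qK))])
      = Matrix.of ![coords (qI, 0), coords (psiZero 1), coords (psiZero qI), coords (0, qI),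
        coords (psiZero qJ), coords (psiZero qK)] * conjMatrix x := by
    have e1 : (x * qI * star x, (0 : ℍ[ℝ])) = conjPair x (qI, 0) := by simp [conjPair]
    have e2 : ((0 : ℍ[ℝ]), x * qI * star x) = conjPair x (0, qI) := by simp [conjPair]
    have hp : ∀ q, (psiZero q).1.re = 0 ∧ (psiZero q).2.re = 0 := fun q => by simp [psiZero]
    rw [e1, e2]
    ext i j
    rw [Matrix.mul_apply]
    fin_cases i
    · exact coords_conjPair x rfl rfl j
    · exact coords_conjPair x (hp _).1 (hp _).2 j
    · exact coords_conjPair x (hp _).1 (hp _).2 j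
    · exact coords_conjPair x rfl rfl j
    · exact coords_conjPair x (hp _).1 (hp _).2 j
    · exact coords_conjPair x (hp _).1 (hp _).2 j
  rw [diskDet_eq, h, Matrix.det_mul]
  have h2 : (Matrix.of ![coords (qI, 0), coords (psiZero 1), coords (psiZero qI), coords (0, qI),
        coords (psiZero qJ), coords (psiZero qK)]).det = 1 := by
    have : Matrix.of ![coords (qI, 0), coords (psiZero 1), coords (psiZero qI), coords (0, qI),
        coords (psiZero qJ), coords (psiZero qK)] = !![1, 0, 0, 0, 0, 0; 0, 0, 0, 0, 1, 0;
          0, 0, 0, 0, 0, 1; 0, 0, 0, 1, 0, 0; 0, 0, -1, 0, 0, 0; 0, 1, 0, 0, 0, 0] := by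
      ext i j
      fin_cases i <;> fin_cases j <;> simp [coords, psiZero]
    rw [this]
    simp [Matrix.det_succ_row_zero, Fin.sum_univ_succ, Fin.succAbove]
    norm_num
  rw [h2, one_mul]
  exact det_conjMatrix_pos hx

/-- A unit normal pair corresponds to a unit quaternion q in the model, and its frame is the
reference frame preceded by left multiplication by q, a map of positive determinant. -/
theorem diskDet_qmul {p m : ℍ[ℝ] × ℍ[ℝ]} (hp : p ∈ diskBundle) (hm : IsNormal p.1 m)
    (hm1 : ‖m.1‖ ^ 2 + ‖m.2‖ ^ 2 = 1) : 0 < diskDet p (fun a => tangentOf p (qmul p.1 m a)) := by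
  rw [diskDet_tangentOf]
  obtain ⟨u, v⟩ := p
  obtain ⟨h1, h2, h3, h4, -⟩ := hp
  simp only at h1 h3 hm
  obtain ⟨x, hx, rfl⟩ := exists_conj_I_eq h1 h3
  obtain ⟨q, rfl⟩ := exists_eq_conjPair_psiZero hx hm
  simp only [conjPair, norm_conj hx] at hm1
  rw [norm_psiZero] at hm1
  have hq : ‖q‖ = 1 := by nlinarith [norm_nonneg q]
  have e : qmul (x * qI * star x) (conjPair x (psiZero q))
      = fun a => qmulL (x * qI * star x) (conjPair x (psiZero 1)) (rotL (toSp1 q hq, 1) a) := by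
    ext1 a
    change _ = qmul _ _ _
    rw [qmul_conjPair hx, qmul_psiZero, qmul_conjPair hx, qmul_psiZero]
    simp [rot]
  refine lt_of_lt_of_eq ?_ (congrArg (diskDet (x * qI * star x, v)) e).symm
  rw [diskDet_comp]
  refine mul_pos (det_rotL_pos _) ?_
  have e2 : (qmulL (x * qI * star x) (conjPair x (psiZero 1)) : ℍ[ℝ] → ℍ[ℝ] × ℍ[ℝ])
      = fun a => conjPair x (psiZero a) := by
    ext1 a
    change qmul _ _ _ = _
    rw [qmul_conjPair hx, qmul_psiZero, one_mul]
  rw [e2]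
  exact diskDet_conjPair_psiZero hx v

/-- Conjugation of quaternions, as a linear map. -/
def starL : ℍ[ℝ] →ₗ[ℝ] ℍ[ℝ] where
  toFun := star
  map_add' := star_add
  map_smul' c a := by simp

theorem det_starL : LinearMap.det starL = -1 := by
  rw [← det_qMatrix]
  have : qMatrix starL = Matrix.diagonal ![1, -1, -1, -1] := by
    ext i j
    fin_cases i <;> fin_cases j <;> simp [qMatrix, starL]
  rw [this, Matrix.det_diagonal]
  simp [Fin.prod_univ_four]


/-! ### The spin structure of the disk bundle -/

/-- A continuous map from a compact Hausdorff space to a Hausdorff space whose fibres are the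
orbits of a fixed-point-free continuous involution is a covering map. -/
theorem isCoveringMap_of_involution {E B : Type*} [TopologicalSpace E] [TopologicalSpace B]
    [T2Space E] [CompactSpace E] [T2Space B] {f : E → B} (hf : Continuous f)
    (hs : Function.Surjective f) {η : E → E} (hη : Continuous η)
    (hiff : ∀ x y, f y = f x ↔ y = x ∨ y = η x) (hne : ∀ x, η x ≠ x) : IsCoveringMap f := by
  have hηη : ∀ x, η (η x) = x := by
    intro x
    have h1 : f (η (η x)) = f x := by
      rw [(hiff (η x) (η (η x))).2 (Or.inr rfl), (hiff x (η x)).2 (Or.inr rfl)]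
    rcases (hiff x (η (η x))).1 h1 with h | h
    · exact h
    · exact absurd h (hne _)
  -- The involution is viewed as a free action of a group of order two, for which proper
  -- discontinuity is automatic.
  let act : MulAction ℤˣ E :=
    { smul := fun ε x => if ε = 1 then x else η x
      one_smul := fun x => if_pos rfl
      mul_smul := fun ε δ x => by
        change (if ε * δ = 1 then x else η x)
          = (if ε = 1 then (if δ = 1 then x else η x) else η (if δ = 1 then x else η x))
        rcases Int.units_eq_one_or ε with rfl | rfl <;> rcases Int.units_eq_one_or δ with rfl | rfl
        all_goals simp [hηη] }
  have hone : ∀ x : E, (1 : ℤˣ) • x = x := fun x => if_pos rfl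
  have hneg : ∀ x : E, (-1 : ℤˣ) • x = η x := fun x => if_neg (by decide)
  have hcont : ContinuousConstSMul ℤˣ E := ⟨fun ε => by
    rcases Int.units_eq_one_or ε with rfl | rfl
    · simp only [hone]; exact continuous_id
    · simp only [hneg]; exact hη⟩
  have hcancel : IsCancelSMul ℤˣ E := by
    rw [isCancelSMul_iff_eq_one_of_smul_eq]
    intro ε x h
    rcases Int.units_eq_one_or ε with rfl | rfl
    · rfl
    · rw [hneg] at h; exact absurd h (hne x)
  -- Compactness enters here: f is a closed map, hence a quotient map.
  have hq : Topology.IsQuotientMap f := hf.isClosedMap.isQuotientMap hf hs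
  refine (hq.isQuotientCoveringMap_of_properlyDiscontinuousSMul (G := ℤˣ) ?_).isCoveringMap
  intro x y
  rw [hiff y x]
  constructor
  · rintro (rfl | rfl)
    · exact ⟨1, hone x⟩
    · exact ⟨-1, hneg y⟩
  · rintro ⟨ε, h⟩
    simp only at h
    rcases Int.units_eq_one_or ε with rfl | rfl
    · left; rw [← h, hone]
    · right; rw [← h, hneg]

/-- The total space of the spin structure of the disk bundle: a point of the disk bundle, a unit
normal pair, and a unit quaternion. -/
def diskSpinTotal : Set ((ℍ[ℝ] × ℍ[ℝ]) × (ℍ[ℝ] × ℍ[ℝ]) × ℍ[ℝ]) :=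
  {z | z.1 ∈ diskBundle ∧ IsNormal z.1.1 z.2.1 ∧ ‖z.2.1.1‖ ^ 2 + ‖z.2.1.2‖ ^ 2 = 1 ∧ ‖z.2.2‖ = 1}

/-- The identity or the conjugation of `ℍ`, depending on the orientation of the disk bundle. -/
def conjOf : SpinType → ℍ[ℝ] →ₗ[ℝ] ℍ[ℝ]
  | .plus => LinearMap.id
  | .minus => starL

/-- The identity or the exchange of factors of `Spin(4)`. -/
def swapOf : SpinType → Spin4 → Spin4
  | .plus => id
  | .minus => Prod.swap

theorem swapOf_mul (τ : SpinType) (s t : Spin4) : swapOf τ (s * t) = swapOf τ s * swapOf τ t := by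
  cases τ <;> rfl

@[simp] theorem swapOf_one (τ : SpinType) : swapOf τ 1 = 1 := by cases τ <;> rfl

@[simp] theorem swapOf_neg_one (τ : SpinType) : swapOf τ (-1) = -1 := by cases τ <;> rfl

theorem swapOf_swapOf (τ : SpinType) (s : Spin4) : swapOf τ (swapOf τ s) = s := by
  cases τ <;> rfl

theorem continuous_swapOf (τ : SpinType) : Continuous (swapOf τ) := by
  cases τ
  · exact continuous_id
  · exact continuous_swap

theorem conjOf_conjOf (τ : SpinType) (a : ℍ[ℝ]) : conjOf τ (conjOf τ a) = a := by
  cases τ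
  · rfl
  · exact star_star a

/-- Since (a x b*)* = b x* a*, reversing the orientation of ℍ by conjugation exchanges the factors
of Spin(4). All differences between D₊ and D₋ come from this. -/
theorem conjOf_rot (τ : SpinType) (s : Spin4) (a : ℍ[ℝ]) :
    conjOf τ (rot s a) = rot (swapOf τ s) (conjOf τ a) := by
  cases τ
  · rfl
  · change star _ = _
    simp only [rot, swapOf, conjOf, starL, LinearMap.coe_mk, AddHom.coe_mk, star_mul, star_star,
      mul_assoc]
    rfl

theorem inner_conjOf (τ : SpinType) (a b : ℍ[ℝ]) :
    inner ℝ (conjOf τ a) (conjOf τ b) = (inner ℝ a b : ℝ) := by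
  cases τ
  · rfl
  · exact inner_star_star a b

theorem norm_conjOf (τ : SpinType) (a : ℍ[ℝ]) : ‖conjOf τ a‖ = ‖a‖ := by
  cases τ
  · rfl
  · exact norm_star a

theorem isPositive_conjOf (τ : SpinType) (p : ℍ[ℝ] × ℍ[ℝ]) (L : ℍ[ℝ] →ₗ[ℝ] ℍ[ℝ] × ℍ[ℝ]) :
    IsPositive τ p (fun a => L (conjOf τ a)) ↔ 0 < diskDet p L := by
  cases τ
  · rfl
  · change diskDet p (fun a => L (starL a)) < 0 ↔ _
    rw [diskDet_comp, det_starL]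
    simp

/-- The frame at `z.1` given by a point of the total space. -/
def diskFrameL (z : (ℍ[ℝ] × ℍ[ℝ]) × (ℍ[ℝ] × ℍ[ℝ]) × ℍ[ℝ]) : ℍ[ℝ] →ₗ[ℝ] ℍ[ℝ] × ℍ[ℝ] where
  toFun a := tangentOf z.1 (qmul z.1.1 z.2.1 (a * star z.2.2))
  map_add' a b := by
    rw [add_mul, qmul_add]
    exact map_add (tangentOfL z.1) _ _
  map_smul' c a := by
    rw [smul_mul_assoc, qmul_smul]
    exact map_smul (tangentOfL z.1) _ _

theorem diskFrameL_apply (z : (ℍ[ℝ] × ℍ[ℝ]) × (ℍ[ℝ] × ℍ[ℝ]) × ℍ[ℝ]) (a : ℍ[ℝ]) :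
    diskFrameL z a = tangentOf z.1 (qmul z.1.1 z.2.1 (a * star z.2.2)) := rfl

theorem isTangent_diskFrameL {z} (hz : z ∈ diskSpinTotal) (a : ℍ[ℝ]) :
    IsTangent z.1 (diskFrameL z a) :=
  isTangent_tangentOf hz.1 (isNormal_qmul hz.1.1 hz.2.1 _)

theorem diskMetric_diskFrameL {z} (hz : z ∈ diskSpinTotal) (a b : ℍ[ℝ]) :
    diskMetric z.1 (diskFrameL z a) (diskFrameL z b) = inner ℝ a b := by
  rw [diskFrameL_apply, diskFrameL_apply, diskMetric_tangentOf hz.1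
    (isNormal_qmul hz.1.1 hz.2.1 _) (isNormal_qmul hz.1.1 hz.2.1 _),
    inner_qmul hz.1.1 hz.1.2.2.1, hz.2.2.1, one_mul,
    inner_mul_right_of_norm (by rw [norm_star, hz.2.2.2])]

theorem diskDet_diskFrameL {z} (hz : z ∈ diskSpinTotal) : 0 < diskDet z.1 (diskFrameL z) := by
  have e : (diskFrameL z : ℍ[ℝ] → ℍ[ℝ] × ℍ[ℝ]) = fun a =>
      (tangentOfL z.1 ∘ₗ qmulL z.1.1 z.2.1) (rotL (1, toSp1 z.2.2 hz.2.2.2) a) := by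
    ext1 a
    rw [diskFrameL_apply]
    simp [rot]
    rfl
  rw [e, diskDet_comp]
  exact mul_pos (det_rotL_pos _) (diskDet_qmul hz.1 hz.2.1 hz.2.2.1)

theorem injective_diskFrameL {z} (hz : z ∈ diskSpinTotal) :
    Function.Injective (diskFrameL z) := by
  rw [injective_iff_map_eq_zero]
  intro a ha
  have := diskMetric_diskFrameL hz a a
  rw [ha] at this
  simp only [diskMetric, Prod.fst_zero, Prod.snd_zero, inner_zero_right] at this
  simpa using this.symm

/-- The covering of the frame bundle of the disk bundle. -/
def diskProj (τ : SpinType) (z : diskSpinTotal) : diskFrames τ :=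
  ⟨fun a => (z.1.1, diskFrameL z.1 (conjOf τ a)), z.1.1, z.2.1, diskFrameL z.1 ∘ₗ conjOf τ,
    fun _ => rfl, fun _ => isTangent_diskFrameL z.2 _, fun a b => by
      rw [LinearMap.comp_apply, LinearMap.comp_apply, diskMetric_diskFrameL z.2, inner_conjOf],
    (isPositive_conjOf τ _ _).2 (diskDet_diskFrameL z.2)⟩

theorem norm_eq_one_of_qmul {u : ℍ[ℝ]} (h0 : u.re = 0) (h1 : ‖u‖ = 1) {m : ℍ[ℝ] × ℍ[ℝ]}
    (hm : ‖m.1‖ ^ 2 + ‖m.2‖ ^ 2 = 1) {y : ℍ[ℝ]} :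
    ‖(qmul u m y).1‖ ^ 2 + ‖(qmul u m y).2‖ ^ 2 = ‖y‖ ^ 2 := by
  have := inner_qmul h0 h1 m y y
  rw [hm, one_mul] at this
  simpa only [real_inner_self_eq_norm_sq] using this

/-- The right action of `Spin(4)` on the total space. -/
def diskAct (τ : SpinType) (z : diskSpinTotal) (s : Spin4) : diskSpinTotal :=
  ⟨(z.1.1, qmul z.1.1.1 z.1.2.1 (swapOf τ s).1, z.1.2.2 * (swapOf τ s).2), z.2.1,
    isNormal_qmul z.2.1.1 z.2.2.1 _, by
      rw [norm_eq_one_of_qmul z.2.1.1 z.2.1.2.2.1 z.2.2.2.1, norm_sp1]; simp, by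
      change ‖_ * _‖ = 1
      rw [norm_mul, norm_sp1, z.2.2.2.2]; simp⟩

theorem coe_diskAct (τ : SpinType) (z : diskSpinTotal) (s : Spin4) : (diskAct τ z s).1
    = (z.1.1, qmul z.1.1.1 z.1.2.1 (swapOf τ s).1, z.1.2.2 * (swapOf τ s).2) := rfl

theorem diskFrameL_rot {z} (hz : z ∈ diskSpinTotal) (s : Spin4) (a : ℍ[ℝ]) :
    diskFrameL z (rot s a) = diskFrameL (z.1, qmul z.1.1 z.2.1 s.1, z.2.2 * s.2) a := by
  simp only [diskFrameL_apply, rot,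
    qmul_mul (sq_eq_neg_one_of_imaginary hz.1.1 hz.1.2.2.1), star_mul, mul_assoc]

theorem diskProj_act (τ : SpinType) (z : diskSpinTotal) (s : Spin4) :
    (diskProj τ (diskAct τ z s)).1 = fun a => (diskProj τ z).1 (rot s a) := by
  ext1 a
  simp only [diskProj, conjOf_rot]
  rw [diskFrameL_rot z.2]
  rfl

theorem eq_of_fst_eq {z z' : (ℍ[ℝ] × ℍ[ℝ]) × (ℍ[ℝ] × ℍ[ℝ]) × ℍ[ℝ]} (hz : z ∈ diskSpinTotal)
    (hz' : z' ∈ diskSpinTotal) (h : z'.1 = z.1) :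
    ∃ s : Spin4, z' = (z.1, qmul z.1.1 z.2.1 s.1, z.2.2 * s.2) := by
  have hn := hz'.2.1
  rw [h] at hn
  obtain ⟨y, hy⟩ := exists_qmul_eq hz.1.1 hz.1.2.2.1 hz.2.1 hz.2.2.1 hn
  have hy1 : ‖y‖ = 1 := by
    have := norm_eq_one_of_qmul hz.1.1 hz.1.2.2.1 hz.2.2.1 (y := y)
    rw [hy, hz'.2.2.1] at this
    nlinarith [norm_nonneg y]
  have hb : ‖star z.2.2 * z'.2.2‖ = 1 := by
    rw [norm_mul, norm_star, hz.2.2.2, hz'.2.2.2, one_mul]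
  refine ⟨(toSp1 y hy1, toSp1 _ hb), ?_⟩
  ext1
  · exact h
  · ext1
    · exact hy.symm
    · simp only [coe_toSp1]
      rw [← mul_assoc, mul_star_self_of_norm hz.2.2.2, one_mul]

theorem exists_diskAct_eq (τ : SpinType) {z z' : diskSpinTotal} (h : z'.1.1 = z.1.1) :
    ∃ s, z' = diskAct τ z s := by
  obtain ⟨s, hs⟩ := eq_of_fst_eq z.2 z'.2 h
  exact ⟨swapOf τ s, Subtype.ext (by rw [hs, coe_diskAct, swapOf_swapOf])⟩

theorem diskAct_one (τ : SpinType) (z : diskSpinTotal) : diskAct τ z 1 = z := by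
  apply Subtype.ext
  simp [diskAct]

theorem diskAct_mul (τ : SpinType) (z : diskSpinTotal) (s t : Spin4) :
    diskAct τ z (s * t) = diskAct τ (diskAct τ z s) t := by
  apply Subtype.ext
  simp only [diskAct, swapOf_mul, Prod.fst_mul, Prod.snd_mul, Submonoid.coe_mul,
    qmul_mul (sq_eq_neg_one_of_imaginary z.2.1.1 z.2.1.2.2.1), mul_assoc]

theorem diskAct_neg_one_ne (τ : SpinType) (z : diskSpinTotal) : diskAct τ z (-1) ≠ z := by
  intro h
  have h1 : z.1.2.2 * ((-1 : Spin4).2 : ℍ[ℝ]) = z.1.2.2 := by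
    have := congrArg (fun w : diskSpinTotal => w.1.2.2) h
    simpa only [diskAct, swapOf_neg_one] using this
  have h2 : ((-1 : Spin4).2 : ℍ[ℝ]) = -1 := rfl
  rw [h2, mul_neg_one] at h1
  have h3 : (2 : ℝ) • z.1.2.2 = 0 := by
    rw [two_smul]
    nth_rewrite 1 [← h1]
    simp
  have := z.2.2.2.2
  rw [(smul_eq_zero.1 h3).resolve_left two_ne_zero] at this
  simp at this

theorem diskProj_eq_iff (τ : SpinType) (z z' : diskSpinTotal) :
    diskProj τ z' = diskProj τ z ↔ z' = z ∨ z' = diskAct τ z (-1) := by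
  constructor
  · intro h
    have h1 : ∀ a, (diskProj τ z').1 a = (diskProj τ z).1 a := fun a => by rw [h]
    have h0 := congrArg Prod.fst (h1 0)
    change z'.1.1 = z.1.1 at h0
    obtain ⟨s, hs⟩ := exists_diskAct_eq τ h0
    have h2 : ∀ a, rot s a = rot 1 a := fun a => by
      have := h1 a
      rw [hs, diskProj_act] at this
      have h3 := injective_diskFrameL z.2 (congrArg Prod.snd this)
      have h4 := congrArg (conjOf τ) h3
      rw [conjOf_conjOf, conjOf_conjOf] at h4
      rw [h4, rot_one]
    rcases eq_or_eq_of_rot_eq h2 with h3 | h3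
    · left; rw [hs, h3, diskAct_one]
    · right; rw [hs, h3, one_mul]
  · rintro (rfl | rfl)
    · rfl
    · apply Subtype.ext
      rw [diskProj_act]
      simp

/-- A given frame is compared with the frame of one reference point over the same base point; the
comparison is an orientation-preserving isometry of ℍ, hence comes from Spin(4). -/
theorem diskProj_surjective (τ : SpinType) : Function.Surjective (diskProj τ) := by
  rintro ⟨f, p, hp, L, hf, ht, hm, hpos⟩
  obtain ⟨x, hx, hxu⟩ := exists_conj_I_eq hp.1 hp.2.2.1
  let z₀ : (ℍ[ℝ] × ℍ[ℝ]) × (ℍ[ℝ] × ℍ[ℝ]) × ℍ[ℝ] := (p, conjPair x (psiZero 1), 1)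
  have hz₀ : z₀ ∈ diskSpinTotal := by
    refine ⟨hp, ?_, ?_, by simp [z₀]⟩
    · change IsNormal p.1 _
      rw [← hxu]
      exact isNormal_psiZero hx 1
    · change ‖x * (psiZero 1).1 * star x‖ ^ 2 + ‖x * (psiZero 1).2 * star x‖ ^ 2 = 1
      rw [norm_conj hx, norm_conj hx, norm_psiZero]
      simp
  have hex : ∀ a, ∃ y, diskFrameL z₀ y = L (conjOf τ a) := by
    intro a
    obtain ⟨n, hn, hL⟩ := exists_eq_tangentOf hp (ht (conjOf τ a))
    obtain ⟨y, hy⟩ := exists_qmul_eq hp.1 hp.2.2.1 hz₀.2.1 hz₀.2.2.1 hn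
    refine ⟨y, ?_⟩
    rw [hL, diskFrameL_apply, ← hy]
    simp [z₀]
  choose R hR using hex
  have hinj := injective_diskFrameL hz₀
  let R' : ℍ[ℝ] →ₗ[ℝ] ℍ[ℝ] :=
    { toFun := R
      map_add' := fun a b => hinj (by rw [map_add, hR, hR, hR, map_add, map_add])
      map_smul' := fun c a => hinj (by
        rw [map_smul, hR, hR, map_smul, map_smul, RingHom.id_apply]) }
  have hR' : ∀ a, L (conjOf τ a) = diskFrameL z₀ (R' a) := fun a => (hR a).symm
  have hiso : ∀ a b, inner ℝ (R' a) (R' b) = (inner ℝ a b : ℝ) := fun a b => by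
    rw [← diskMetric_diskFrameL hz₀, ← hR', ← hR']
    exact (hm _ _).trans (inner_conjOf τ a b)
  have hdet : 0 < LinearMap.det R' := by
    have e : (L : ℍ[ℝ] → ℍ[ℝ] × ℍ[ℝ]) = fun a => (diskFrameL z₀ ∘ₗ R') (conjOf τ a) := by
      ext1 a
      rw [LinearMap.comp_apply, ← hR', conjOf_conjOf]
    rw [e, isPositive_conjOf] at hpos
    have := diskDet_comp p (diskFrameL z₀) R'
    change diskDet p (fun a => diskFrameL z₀ (R' a)) > 0 at hpos
    rw [this] at hpos
    exact (mul_pos_iff_of_pos_right (diskDet_diskFrameL hz₀)).1 hpos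
  obtain ⟨s, hs⟩ := exists_rot_eq hiso hdet
  refine ⟨diskAct τ ⟨z₀, hz₀⟩ (swapOf τ s), Subtype.ext ?_⟩
  ext1 a
  rw [diskProj_act]
  change (p, diskFrameL z₀ (conjOf τ (rot (swapOf τ s) a))) = f a
  rw [conjOf_rot, swapOf_swapOf, ← hs, ← hR', conjOf_conjOf, hf]

theorem continuous_qmul : Continuous fun w : ℍ[ℝ] × (ℍ[ℝ] × ℍ[ℝ]) × ℍ[ℝ] =>
    qmul w.1 w.2.1 w.2.2 := by
  have h1 := Quaternion.continuous_re
  have h2 := Quaternion.continuous_imI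
  have h3 := Quaternion.continuous_imJ
  have h4 := Quaternion.continuous_imK
  unfold qmul
  fun_prop

theorem continuous_tangentOf : Continuous fun w : (ℍ[ℝ] × ℍ[ℝ]) × (ℍ[ℝ] × ℍ[ℝ]) =>
    tangentOf w.1 w.2 := by
  unfold tangentOf
  fun_prop

theorem isClosed_diskSpinTotal : IsClosed diskSpinTotal := by
  have h1 := Quaternion.continuous_re
  unfold diskSpinTotal diskBundle IsNormal
  simp only [Set.mem_ofPred_eq, and_assoc]
  repeat' apply IsClosed.and
  all_goals first
    | exact isClosed_eq (by fun_prop) (by fun_prop)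
    | exact isClosed_le (by fun_prop) (by fun_prop)

instance : CompactSpace diskSpinTotal := by
  have : ProperSpace ((ℍ[ℝ] × ℍ[ℝ]) × (ℍ[ℝ] × ℍ[ℝ]) × ℍ[ℝ]) := FiniteDimensional.proper ℝ _
  rw [← isCompact_iff_compactSpace]
  refine Metric.isCompact_of_isClosed_isBounded isClosed_diskSpinTotal ?_
  refine (Metric.isBounded_closedBall (x := 0) (r := 1)).subset fun z hz => ?_
  rw [mem_closedBall_zero_iff]
  have h1 : ‖z.2.1.1‖ ≤ 1 := by
    nlinarith [hz.2.2.1, norm_nonneg z.2.1.1, sq_nonneg ‖z.2.1.2‖]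
  have h2 : ‖z.2.1.2‖ ≤ 1 := by
    nlinarith [hz.2.2.1, norm_nonneg z.2.1.2, sq_nonneg ‖z.2.1.1‖]
  simp only [Prod.norm_def, sup_le_iff]
  exact ⟨⟨hz.1.2.2.1.le, hz.1.2.2.2.2⟩, ⟨h1, h2⟩, hz.2.2.2.le⟩

theorem continuous_diskAct (τ : SpinType) :
    Continuous fun w : diskSpinTotal × Spin4 => diskAct τ w.1 w.2 := by
  have h := continuous_swapOf τ
  refine Continuous.subtype_mk (.prodMk (by fun_prop) (.prodMk ?_ (by fun_prop))) _
  exact continuous_qmul.comp (by fun_prop :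
    Continuous fun w : diskSpinTotal × Spin4 => (w.1.1.1.1, w.1.1.2.1, ((swapOf τ w.2).1 : ℍ[ℝ])))

theorem continuous_diskProj (τ : SpinType) : Continuous (diskProj τ) := by
  refine Continuous.subtype_mk (continuous_pi fun a => .prodMk (by fun_prop) ?_) _
  exact continuous_tangentOf.comp (.prodMk (by fun_prop) (continuous_qmul.comp (by fun_prop :
    Continuous fun z : diskSpinTotal => (z.1.1.1, z.1.2.1, conjOf τ a * star z.1.2.2))))

/-- The spin structure of the disk bundle `D±`. -/
def diskSpin (τ : SpinType) : SpinStructure.{0, 0} (diskFrames τ) where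
  Total := diskSpinTotal
  act := diskAct τ
  act_one := diskAct_one τ
  act_mul := diskAct_mul τ
  continuous_act := continuous_diskAct τ
  proj := diskProj τ
  isCoveringMap := isCoveringMap_of_involution (η := fun z => diskAct τ z (-1))
    (continuous_diskProj τ) (diskProj_surjective τ)
    ((continuous_diskAct τ).comp (by fun_prop : Continuous fun z : diskSpinTotal =>
      (z, (-1 : Spin4))))
    (diskProj_eq_iff τ) (diskAct_neg_one_ne τ)
  surjective := diskProj_surjective τ
  proj_act := diskProj_act τ
  proj_eq_iff := diskProj_eq_iff τ
  act_neg_one_ne := diskAct_neg_one_ne τ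


/-! ### The section of the spin structure over the boundary of the disk bundle -/

theorem psi_eq_psi_plus (τ : SpinType) (x : ℍ[ℝ]) : psi τ x = psi .plus (conjOf τ x) := by
  cases τ
  · rfl
  · simp only [psi, conjOf, starL, LinearMap.coe_mk, AddHom.coe_mk, norm_star, star_star]

theorem psi_plus_eq (x : ℍ[ℝ]) :
    psi .plus x = ((‖x‖ ^ 2)⁻¹ • (x * qI * star x), x * qJ * star x) := rfl

theorem psi_plus_of_norm {x : ℍ[ℝ]} (hx : ‖x‖ = 1) :
    psi .plus x = (x * qI * star x, x * qJ * star x) := by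
  rw [psi_plus_eq, hx]; simp

theorem psi_mem_diskBundle (τ : SpinType) {x : ℍ[ℝ]} (hx : ‖x‖ = 1) :
    psi τ x ∈ diskBundle := by
  rw [psi_eq_psi_plus, psi_plus_of_norm (by rwa [norm_conjOf])]
  have hy : ‖conjOf τ x‖ = 1 := by rwa [norm_conjOf]
  refine ⟨imaginary_conj rfl, imaginary_conj rfl, ?_, ?_, ?_⟩
  · rw [norm_conj hy, norm_qI]
  · rw [inner_conj hy, inner_eq]; simp
  · rw [norm_conj hy, norm_qJ]

theorem hasFDerivAt_star (x : ℍ[ℝ]) :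
    HasFDerivAt (fun y : ℍ[ℝ] => star y) (LinearMap.toContinuousLinearMap starL) x :=
  (LinearMap.toContinuousLinearMap starL).hasFDerivAt

theorem hasFDerivAt_conj (q x : ℍ[ℝ]) : ∃ D : ℍ[ℝ] →L[ℝ] ℍ[ℝ],
    HasFDerivAt (fun y : ℍ[ℝ] => y * q * star y) D x ∧
      ∀ a, D a = a * q * star x + x * q * star a := by
  refine ⟨_, ((hasFDerivAt_id x).mul_const' q).mul' (hasFDerivAt_star x), fun a => ?_⟩
  simp [starL]
  abel

theorem hasFDerivAt_norm_sq_inv {x : ℍ[ℝ]} (hx : ‖x‖ = 1) : ∃ D : ℍ[ℝ] →L[ℝ] ℝ,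
    HasFDerivAt (fun y : ℍ[ℝ] => (‖y‖ ^ 2)⁻¹) D x ∧ ∀ a, D a = -2 * inner ℝ x a := by
  have h1 : HasFDerivAt (fun y : ℍ[ℝ] => ‖y‖ ^ 2) (2 • innerSL ℝ x) x :=
    (hasStrictFDerivAt_norm_sq x).hasFDerivAt
  have h2 : HasDerivAt (fun r : ℝ => r⁻¹) (-((‖x‖ ^ 2) ^ 2)⁻¹) (‖x‖ ^ 2) :=
    hasDerivAt_inv (by rw [hx]; norm_num)
  refine ⟨_, h2.comp_hasFDerivAt x h1, fun a => ?_⟩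
  simp [hx]

/-- In the direction xq, the derivative of x r x* is x(qr + rq*)x*, and the normalizing factor
removes 2 re(q) i from the first component. The point of the formula is that ½ dψ is an orthonormal
frame along the boundary. -/
theorem fderiv_psi_plus {x : ℍ[ℝ]} (hx : ‖x‖ = 1) :
    ∃ D : ℍ[ℝ] →L[ℝ] ℍ[ℝ] × ℍ[ℝ], HasFDerivAt (psi .plus) D x ∧
      ∀ a, D a = (2 : ℝ) • tangentOf (psi .plus x) (conjPair x (psiZero (star x * a))) := by
  obtain ⟨D1, h1, e1⟩ := hasFDerivAt_conj qI x
  obtain ⟨D2, h2, e2⟩ := hasFDerivAt_conj qJ x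
  obtain ⟨D3, h3, e3⟩ := hasFDerivAt_norm_sq_inv hx
  refine ⟨_, (h3.smul h1).prodMk h2, fun a => ?_⟩
  obtain ⟨q, rfl⟩ : ∃ q, a = x * q := ⟨star x * a, by
    rw [← mul_assoc, mul_star_self_of_norm hx, one_mul]⟩
  have hq : star x * (x * q) = q := by rw [← mul_assoc, star_mul_self_of_norm hx, one_mul]
  have hin : inner ℝ x (x * q) = q.re := by
    have := inner_mul_left_of_norm hx 1 q
    rw [mul_one] at this
    rw [this, inner_eq]; simp
  rw [psi_plus_of_norm hx, hq]
  have hc : ∀ r, x * q * r * star x + x * r * star (x * q) = x * (q * r + r * star q) * star x := by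
    intro r
    rw [star_mul]; noncomm_ring
  simp only [ContinuousLinearMap.prod_apply, add_apply,
    smul_apply, ContinuousLinearMap.smulRight_apply, e1, e2, e3, hin, hx, hc,
    tangentOf, conjPair, inner_conj hx, Prod.smul_mk]
  ext1
  · have : q * qI + qI * star q - (2 * q.re) • qI = (2 : ℝ) • (psiZero q).1 := by
      ext <;> simp [psiZero] <;> ring
    calc _ = x * (q * qI + qI * star q - (2 * q.re) • qI) * star x := by
          simp only [mul_sub, sub_mul, mul_smul_comm, smul_mul_assoc]
          simp [sub_eq_add_neg]
      _ = _ := by rw [this]; simp only [mul_smul_comm, smul_mul_assoc]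
  · have : q * qJ + qJ * star q
        = (2 : ℝ) • ((psiZero q).2 - (inner ℝ (psiZero q).1 qJ : ℝ) • qI) := by
      ext <;> simp [psiZero, inner_eq] <;> ring
    simp only [this, mul_smul_comm, smul_mul_assoc, mul_sub, sub_mul]

/-- The lift to the spin structure of the frame `½ dψ` of the disk bundle at a boundary point. -/
def boundaryLift (τ : SpinType) (x : Metric.sphere (0 : ℍ[ℝ]) 1) : diskSpinTotal :=
  have hx : ‖(x : ℍ[ℝ])‖ = 1 := mem_sphere_zero_iff_norm.1 x.2
  have hy : ‖conjOf τ (x : ℍ[ℝ])‖ = 1 := by rwa [norm_conjOf]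
  ⟨(psi τ x, conjPair (conjOf τ x) (psiZero (star (conjOf τ x))), 1),
    psi_mem_diskBundle τ hx, by
      simp only
      rw [psi_eq_psi_plus, psi_plus_of_norm hy]
      exact isNormal_psiZero hy _, by
      simp only [conjPair, norm_conj hy, norm_psiZero, norm_star, hy]; simp, by simp⟩

theorem boundaryLift_eq (τ : SpinType) (x : Metric.sphere (0 : ℍ[ℝ]) 1) :
    (boundaryLift τ x).1
      = (psi τ x, conjPair (conjOf τ x) (psiZero (star (conjOf τ x))), 1) := rfl

theorem fderiv_psi (τ : SpinType) (x : Metric.sphere (0 : ℍ[ℝ]) 1) (a : ℍ[ℝ]) :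
    fderiv ℝ (psi τ) x a = (2 : ℝ) • diskFrameL (boundaryLift τ x).1 (conjOf τ a) := by
  have hx : ‖(x : ℍ[ℝ])‖ = 1 := mem_sphere_zero_iff_norm.1 x.2
  have hy : ‖conjOf τ (x : ℍ[ℝ])‖ = 1 := by rwa [norm_conjOf]
  obtain ⟨D, hD, e⟩ := fderiv_psi_plus hy
  have h1 : HasFDerivAt (psi τ) (D ∘L LinearMap.toContinuousLinearMap (conjOf τ)) (x : ℍ[ℝ]) := by
    have : psi τ = psi .plus ∘ LinearMap.toContinuousLinearMap (conjOf τ) := by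
      ext1 y
      exact psi_eq_psi_plus τ y
    rw [this]
    exact HasFDerivAt.comp _ hD (LinearMap.toContinuousLinearMap (conjOf τ)).hasFDerivAt
  rw [h1.fderiv, ContinuousLinearMap.comp_apply, LinearMap.coe_toContinuousLinearMap', e,
    diskFrameL_apply, boundaryLift_eq]
  simp only
  rw [psi_eq_psi_plus τ x, psi_plus_of_norm hy, star_one, mul_one, qmul_conjPair hy, qmul_psiZero]

theorem neg_mem_sphere (x : Metric.sphere (0 : ℍ[ℝ]) 1) :
    -(x : ℍ[ℝ]) ∈ Metric.sphere (0 : ℍ[ℝ]) 1 := by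
  simp

theorem psi_neg (τ : SpinType) (x : ℍ[ℝ]) : psi τ (-x) = psi τ x := by
  rw [psi_eq_psi_plus, psi_eq_psi_plus τ x, map_neg, psi_plus_eq, psi_plus_eq]
  simp

theorem psiZero_neg (q : ℍ[ℝ]) : psiZero (-q) = -psiZero q := by
  ext <;> simp [psiZero]

theorem conjPair_neg_left (x : ℍ[ℝ]) (w : ℍ[ℝ] × ℍ[ℝ]) : conjPair (-x) w = conjPair x w := by
  simp [conjPair]

theorem conjPair_neg (x : ℍ[ℝ]) (w : ℍ[ℝ] × ℍ[ℝ]) : conjPair x (-w) = -conjPair x w := by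
  simp [conjPair]

theorem conjPair_one (w : ℍ[ℝ] × ℍ[ℝ]) : conjPair 1 w = w := by
  simp [conjPair]

theorem coe_neg_one : ((-1 : Sp1) : ℍ[ℝ]) = -1 := rfl

/-- Conjugation by x does not see the sign of x, but the argument x* of `psiZero` does, so exactly
one Sp(1) factor changes sign. -/
theorem boundaryLift_neg (τ : SpinType) (x : Metric.sphere (0 : ℍ[ℝ]) 1) :
    boundaryLift τ ⟨-x, neg_mem_sphere x⟩ = diskAct τ (boundaryLift τ x) (swapOf τ (-1, 1)) := by
  apply Subtype.ext
  rw [coe_diskAct, swapOf_swapOf, boundaryLift_eq, boundaryLift_eq]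
  simp only [psi_neg, map_neg, star_neg, psiZero_neg, conjPair_neg_left, conjPair_neg,
    coe_neg_one, qmul_neg, qmul_one]
  simp

theorem continuous_psiZero : Continuous psiZero := by
  have h1 := Quaternion.continuous_re
  have h2 := Quaternion.continuous_imI
  have h3 := Quaternion.continuous_imJ
  have h4 := Quaternion.continuous_imK
  unfold psiZero
  fun_prop

theorem continuous_conjPair : Continuous fun w : ℍ[ℝ] × (ℍ[ℝ] × ℍ[ℝ]) => conjPair w.1 w.2 := by
  unfold conjPair
  fun_prop

theorem continuous_boundaryLift (τ : SpinType) : Continuous (boundaryLift τ) := by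
  have h1 : Continuous (conjOf τ) := (LinearMap.toContinuousLinearMap (conjOf τ)).continuous
  have h2 : (fun x : Metric.sphere (0 : ℍ[ℝ]) 1 => psi τ (x : ℍ[ℝ])) =
      fun x : Metric.sphere (0 : ℍ[ℝ]) 1 => (conjOf τ (x : ℍ[ℝ]) * qI * star (conjOf τ (x : ℍ[ℝ])),
        conjOf τ (x : ℍ[ℝ]) * qJ * star (conjOf τ (x : ℍ[ℝ]))) := by
    ext1 x
    rw [psi_eq_psi_plus, psi_plus_of_norm (by
      rw [norm_conjOf]; exact mem_sphere_zero_iff_norm.1 x.2)]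
  refine Continuous.subtype_mk (.prodMk ?_ (.prodMk ?_ continuous_const)) _
  · rw [h2]
    fun_prop
  · have h3 : Continuous fun x : Metric.sphere (0 : ℍ[ℝ]) 1 => conjOf τ (x : ℍ[ℝ]) :=
      h1.comp continuous_subtype_val
    have h4 : Continuous fun x : Metric.sphere (0 : ℍ[ℝ]) 1 =>
        (conjOf τ (x : ℍ[ℝ]), psiZero (star (conjOf τ (x : ℍ[ℝ])))) :=
      h3.prodMk (continuous_psiZero.comp h3.star)
    have h5 := continuous_conjPair.comp h4
    simp only [Function.comp_def] at h5
    exact h5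

/-! ### The monodromy of a spin structure of the disk bundle along the fibre circle -/

/-- The unit complex number `exp (i t)` as a quaternion. -/
def circleQ (t : ℝ) : ℍ[ℝ] := ⟨Real.cos t, Real.sin t, 0, 0⟩

@[simp] theorem re_circleQ (t : ℝ) : (circleQ t).re = Real.cos t := rfl
@[simp] theorem imI_circleQ (t : ℝ) : (circleQ t).imI = Real.sin t := rfl
@[simp] theorem imJ_circleQ (t : ℝ) : (circleQ t).imJ = 0 := rfl
@[simp] theorem imK_circleQ (t : ℝ) : (circleQ t).imK = 0 := rfl

theorem norm_circleQ (t : ℝ) : ‖circleQ t‖ = 1 := norm_eq_one_of_sq (by simp)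

theorem circleQ_zero : circleQ 0 = 1 := by ext <;> simp

theorem circleQ_pi : circleQ Real.pi = -1 := by ext <;> simp

theorem continuous_circleQ : Continuous circleQ := by
  have : circleQ = fun t => Real.cos t • 1 + Real.sin t • qI := by
    ext1 t
    ext <;> simp
  rw [this]
  fun_prop

theorem circleQ_conj_qI (t : ℝ) : circleQ t * qI * star (circleQ t) = qI := by
  have : circleQ t * qI = qI * circleQ t := by ext <;> simp
  rw [this, mul_assoc, mul_star_self_of_norm (norm_circleQ t), mul_one]

/-- With c = exp(it), the second component is c(c* j)c* = jc* = cj. The frame thus turns through c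
while the point cjc* = c²j turns twice as fast, so one turn of the fibre circle ends at c = -1. -/
theorem conjPair_circleQ (t : ℝ) :
    conjPair (circleQ t) (psiZero (star (circleQ t))) = qmul qI (psiZero 1) (circleQ t) := by
  have h := Real.sin_sq_add_cos_sq t
  ext <;> simp [conjPair, psiZero, qmul]
  all_goals first
    | ring1
    | linear_combination (Real.cos t) * h
    | linear_combination (Real.sin t) * h

/-- A disk of points of the spin structure bounded by the lift of the fibre circle. -/
def fibreDisk (w : unitInterval × ℝ) : diskSpinTotal :=
  ⟨((qI, (w.1 : ℝ) • (circleQ w.2 * qJ * star (circleQ w.2))),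
      conjPair (circleQ w.2) (psiZero (star (circleQ w.2))), 1), by
    refine ⟨⟨rfl, ?_, norm_qI, ?_, ?_⟩, ?_, ?_, by simp⟩
    · rw [Quaternion.re_smul, imaginary_conj rfl, smul_zero]
    · simp only
      rw [inner_smul_right]
      conv_lhs => rw [← circleQ_conj_qI w.2]
      rw [inner_conj (norm_circleQ _), inner_eq]
      simp
    · simp only
      rw [norm_smul, norm_conj (norm_circleQ _), norm_qJ, mul_one, Real.norm_eq_abs,
        abs_of_nonneg w.1.2.1]
      exact w.1.2.2
    · have := isNormal_psiZero (norm_circleQ w.2) (star (circleQ w.2))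
      rwa [circleQ_conj_qI] at this
    · simp only [conjPair, norm_conj (norm_circleQ _), norm_psiZero, norm_star, norm_circleQ]
      simp⟩

theorem continuous_fibreDisk : Continuous fibreDisk := by
  have h0 := continuous_psiZero
  have h1 := continuous_circleQ
  refine Continuous.subtype_mk ?_ _
  unfold conjPair
  fun_prop

theorem circle_mem_sphere (τ : SpinType) (t : ℝ) :
    conjOf τ (circleQ t) ∈ Metric.sphere (0 : ℍ[ℝ]) 1 := by
  rw [mem_sphere_zero_iff_norm, norm_conjOf, norm_circleQ]

theorem fibreDisk_one (τ : SpinType) (t : ℝ) :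
    fibreDisk (1, t) = boundaryLift τ ⟨conjOf τ (circleQ t), circle_mem_sphere τ t⟩ := by
  apply Subtype.ext
  rw [boundaryLift_eq]
  simp only [fibreDisk]
  rw [psi_eq_psi_plus, conjOf_conjOf, psi_plus_of_norm (norm_circleQ t), circleQ_conj_qI]
  simp

/-- At the centre of the disk the base point is constant, so the lift moves in one fibre, along the
orbit of a one-parameter subgroup of Spin(4). -/
theorem fibreDisk_zero (τ : SpinType) (t : ℝ) :
    fibreDisk (0, t) = diskAct τ (fibreDisk (0, 0))
      (swapOf τ (toSp1 (circleQ t) (norm_circleQ t), 1)) := by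
  apply Subtype.ext
  rw [coe_diskAct, swapOf_swapOf]
  simp [fibreDisk, conjPair_circleQ, circleQ_zero, conjPair_one]

theorem fibreDisk_pi (τ : SpinType) (r : unitInterval) :
    fibreDisk (r, Real.pi) = diskAct τ (fibreDisk (r, 0)) (swapOf τ (-1, 1)) := by
  apply Subtype.ext
  rw [coe_diskAct, swapOf_swapOf, coe_neg_one, qmul_neg, qmul_one]
  simp [fibreDisk, circleQ_pi, circleQ_zero, psiZero_neg, conjPair_neg, conjPair_neg_left]

/-- Every spin structure of `D±` has the same monodromy along the path from `1` to `-1`. -/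
theorem lift_neg_one (τ : SpinType) (T : SpinStructure.{0, 0} (diskFrames τ))
    {Θ : Metric.sphere (0 : ℍ[ℝ]) 1 → T.Total} (hΘ : Continuous Θ)
    (hproj : ∀ x, T.proj (Θ x) = diskProj τ (boundaryLift τ x)) :
    Θ ⟨conjOf τ (circleQ Real.pi), circle_mem_sphere τ _⟩
      = T.act (Θ ⟨conjOf τ (circleQ 0), circle_mem_sphere τ _⟩) (swapOf τ (-1, 1)) := by
  have hconj : Continuous (conjOf τ) := (LinearMap.toContinuousLinearMap (conjOf τ)).continuous
  have hcirc := continuous_circleQ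
  have hact : ∀ s, Continuous fun y => T.act y s := fun s =>
    T.continuous_act.comp (by fun_prop : Continuous fun y : T.Total => (y, s))
  have hsw := continuous_swapOf τ
  -- The radius is clamped to [0, 1] so that the domain is the simply connected plane, where a lift
  -- to T exists.
  let f : C(ℝ × ℝ, diskFrames τ) :=
    ⟨fun w => diskProj τ (fibreDisk (Set.projIcc 0 1 zero_le_one w.1, w.2)),
      (continuous_diskProj τ).comp (continuous_fibreDisk.comp
        (.prodMk (continuous_projIcc.comp continuous_fst) continuous_snd))⟩
  let x : ℝ → Metric.sphere (0 : ℍ[ℝ]) 1 := fun t => ⟨conjOf τ (circleQ t), circle_mem_sphere τ t⟩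
  have hx : Continuous x := Continuous.subtype_mk (by fun_prop) _
  have h0 : T.proj (Θ (x 0)) = f (1, 0) := by
    have h1 : Set.projIcc (0 : ℝ) 1 zero_le_one 1 = 1 := Set.projIcc_right zero_le_one
    change _ = diskProj τ (fibreDisk (Set.projIcc 0 1 zero_le_one 1, 0))
    rw [hproj, h1]
    exact congrArg (diskProj τ) (fibreDisk_one τ 0).symm
  obtain ⟨F', ⟨hF0, hFl⟩, -⟩ := T.isCoveringMap.existsUnique_continuousMap_lifts f (1, 0) _ h0
  let F : C(unitInterval × ℝ, T.Total) := ⟨fun w => F' (w.1, w.2), by fun_prop⟩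
  have hF : ∀ w, T.proj (F w) = diskProj τ (fibreDisk w) := fun w => by
    have := congrFun hFl ((w.1 : ℝ), w.2)
    have h2 : Set.projIcc (0 : ℝ) 1 zero_le_one w.1 = w.1 := Set.projIcc_val zero_le_one w.1
    change T.proj (F w) = diskProj τ (fibreDisk (Set.projIcc 0 1 zero_le_one w.1, w.2)) at this
    rwa [h2] at this
  have e1 : ∀ t, F (1, t) = Θ (x t) := by
    have := T.isCoveringMap.eq_of_comp_eq (g₁ := fun t => F (1, t)) (g₂ := fun t => Θ (x t))
      (by fun_prop) (hΘ.comp hx) (by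
        ext1 t
        simp only [Function.comp_apply]
        rw [hF, hproj, fibreDisk_one τ]) 0 hF0
    exact congrFun this
  -- Along the centre the right side is an explicit lift of the same path with the same start,
  -- whatever T is; at t = π it gives the monodromy.
  have e0 : ∀ t, F (0, t) = T.act (F (0, 0))
      (swapOf τ (toSp1 (circleQ t) (norm_circleQ t), 1)) := by
    have hc : Continuous fun t : ℝ => (toSp1 (circleQ t) (norm_circleQ t) : Sp1) :=
      Continuous.subtype_mk hcirc _
    have := T.isCoveringMap.eq_of_comp_eq (g₁ := fun t => F (0, t)) (g₂ := fun t => T.act (F (0, 0))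
      (swapOf τ (toSp1 (circleQ t) (norm_circleQ t), 1)))
      (by fun_prop) (T.continuous_act.comp
        (continuous_const.prodMk (hsw.comp (hc.prodMk continuous_const)))) (by
        ext1 t
        simp only [Function.comp_apply]
        apply Subtype.ext
        rw [hF, T.proj_act, hF, fibreDisk_zero τ, diskProj_act]) 0 (by
        have : (toSp1 (circleQ 0) (norm_circleQ 0), (1 : Sp1)) = 1 := by
          ext1
          · exact Subtype.ext circleQ_zero
          · rfl
        rw [this, swapOf_one, T.act_one])
    exact congrFun this
  -- Both sides lift the same radial path and agree at the centre, so the monodromy is transported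
  -- to the boundary r = 1.
  have epi : ∀ r, F (r, Real.pi) = T.act (F (r, 0)) (swapOf τ (-1, 1)) := by
    have := T.isCoveringMap.eq_of_comp_eq (g₁ := fun r => F (r, Real.pi))
      (g₂ := fun r => T.act (F (r, 0)) (swapOf τ (-1, 1)))
      (by fun_prop) ((hact _).comp (by fun_prop)) (by
        ext1 r
        simp only [Function.comp_apply]
        apply Subtype.ext
        rw [hF, T.proj_act, hF, fibreDisk_pi τ, diskProj_act]) 0 (by
        rw [e0 Real.pi]
        have : (toSp1 (circleQ Real.pi) (norm_circleQ Real.pi), (1 : Sp1)) = (-1, 1) := by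
          ext1
          · exact Subtype.ext circleQ_pi
          · rfl
        rw [this])
    exact congrFun this
  have := epi 1
  rwa [e1, e1] at this


/-! ### Frames and the fibres of spin structures -/

theorem frameOrientation_eq_iff {V : Type*} [AddCommGroup V] [Module ℝ V] (L L' : ℍ[ℝ] ≃ₗ[ℝ] V) :
    frameOrientation L = frameOrientation L' ↔
      0 < LinearMap.det ((L'.trans L.symm : ℍ[ℝ] ≃ₗ[ℝ] ℍ[ℝ]) : ℍ[ℝ] →ₗ[ℝ] ℍ[ℝ]) := by
  change (qBasis.map L).orientation = (qBasis.map L').orientation ↔ _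
  rw [Module.Basis.orientation_eq_iff_det_pos, Module.Basis.det_map]
  have : (L.symm : V → ℍ[ℝ]) ∘ (qBasis.map L')
      = ((L'.trans L.symm : ℍ[ℝ] ≃ₗ[ℝ] ℍ[ℝ]) : ℍ[ℝ] →ₗ[ℝ] ℍ[ℝ]) ∘ qBasis := by
    ext1 i
    simp
  rw [this, Module.Basis.det_comp, Module.Basis.det_self, mul_one]

section Manifold

variable {X : Type*} [TopologicalSpace X] [ChartedSpace E4 X] [IsManifold 𝓘(ℝ, E4) ∞ X]
  {G : Metric X} {o : ManifoldOrientation X}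

theorem exists_rot_of_frames {f f' : ℍ[ℝ] → TangentBundle 𝓘(ℝ, E4) X} (hf : f ∈ frames G o)
    (hf' : f' ∈ frames G o) (h : (f 0).proj = (f' 0).proj) :
    ∃ s : Spin4, ∀ a, f' a = f (rot s a) := by
  obtain ⟨x, L, hL, hi, ho⟩ := hf
  obtain ⟨x', L', hL', hi', ho'⟩ := hf'
  rw [hL, hL'] at h
  obtain rfl : x = x' := h
  have hR : ∀ a, L (L.symm (L' a)) = L' a := fun a => L.apply_symm_apply _
  obtain ⟨s, hs⟩ := exists_rot_eq (R := ((L'.trans L.symm : ℍ[ℝ] ≃ₗ[ℝ] ℍ[ℝ]) : ℍ[ℝ] →ₗ[ℝ] ℍ[ℝ]))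
    (fun a b => by
      rw [← hi]
      change G.inner x (L (L.symm (L' a))) (L (L.symm (L' b))) = _
      rw [hR, hR, hi'])
    ((frameOrientation_eq_iff L L').1 (ho.trans ho'.symm))
  refine ⟨s, fun a => ?_⟩
  rw [hL, hL', ← hs]
  exact congrArg _ (hR a).symm

/-- Two oriented orthonormal frames at one point differ by a rotation that lifts to Spin(4); the
sign ambiguity of the covering is absorbed by the factor -1. -/
theorem SpinStructure.exists_act_eq (S : SpinStructure (frames G o)) {y y' : S.Total}
    (h : S.base y' = S.base y) : ∃ s, y' = S.act y s := by
  obtain ⟨s, hs⟩ := exists_rot_of_frames (S.proj y).2 (S.proj y').2 h.symm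
  have : S.proj y' = S.proj (S.act y s) := by
    apply Subtype.ext
    rw [S.proj_act]
    ext1 a
    exact hs a
  rcases (S.proj_eq_iff _ _).1 this with h | h
  · exact ⟨s, h⟩
  · exact ⟨s * (-1), by rw [h, S.act_mul]⟩

theorem frame_injective {f : ℍ[ℝ] → TangentBundle 𝓘(ℝ, E4) X} (hf : f ∈ frames G o) :
    Function.Injective f := by
  obtain ⟨x, L, hL, -⟩ := hf
  intro a b hab
  rw [hL, hL] at hab
  exact L.injective (Bundle.TotalSpace.mk_inj.1 hab)

theorem SpinStructure.act_injective (S : SpinStructure (frames G o)) {y : S.Total} {s t : Spin4}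
    (h : S.act y s = S.act y t) : s = t := by
  have h1 : ∀ a, rot s a = rot t a := fun a => by
    have h2 := S.proj_act y s
    rw [h, S.proj_act] at h2
    exact (frame_injective (S.proj y).2 (congrFun h2 a)).symm
  rcases eq_or_eq_of_rot_eq h1 with h2 | h2
  · exact h2
  · rw [h2, S.act_mul] at h
    exact absurd h (S.act_neg_one_ne _)

/-! ### The pulled back metric in antipodal coordinates -/

/-- The inner product of two tangent vectors (over the same base point). -/
def inn (G : Metric X) (v w : TangentBundle 𝓘(ℝ, E4) X) : ℝ :=
  (G.inner v.proj : E4 →L[ℝ] E4 →L[ℝ] ℝ) v.2 w.2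

theorem continuous_inn {Y : Type*} [TopologicalSpace Y] {v w : Y → TangentBundle 𝓘(ℝ, E4) X}
    (hv : Continuous v) (hw : Continuous w) (h : ∀ y, (v y).proj = (w y).proj) :
    Continuous fun y => inn G (v y) (w y) := by
  have hg := G.contMDiff.continuous
  have hb : Continuous fun y => (v y).proj := (FiberBundle.continuous_proj E4 _).comp hv
  let b : Y → X := fun y => (v y).proj
  -- The base points of v and w agree only propositionally, so w is re-read over the base point of
  -- v.
  let w' : ∀ y, TangentSpace 𝓘(ℝ, E4) (b y) := fun y => ((w y).2 : E4)
  have hw' : ∀ y, (⟨b y, w' y⟩ : TangentBundle 𝓘(ℝ, E4) X) = w y := fun y =>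
    Bundle.TotalSpace.ext (h y) HEq.rfl
  have e : (fun y => inn G (v y) (w y)) = fun y => G.inner (b y) (v y).2 (w' y) := by
    rfl
  rw [e, continuous_iff_continuousAt]
  intro y
  have hw2 : ContinuousAt (fun m => (⟨b m, w' m⟩ : TangentBundle 𝓘(ℝ, E4) X)) y := by
    simp only [hw']
    exact hw.continuousAt
  have : ContinuousWithinAt
      (fun m => Bundle.TotalSpace.mk' ℝ (E := Bundle.Trivial X ℝ) (b m)
        (G.inner (b m) (v m).2 (w' m))) Set.univ y :=
    ((hg.comp hb).continuousAt.continuousWithinAt).clm_bundle_apply₂ (F₁ := E4) (F₂ := E4)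
      (v := fun m => (v m).2) (w := w') hv.continuousAt.continuousWithinAt hw2.continuousWithinAt
  simp only [FiberBundle.continuousWithinAt_totalSpace] at this
  exact this.2.continuousAt Filter.univ_mem

end Manifold


section Chart

variable {X : Type*} [TopologicalSpace X] [ChartedSpace E4 X] [IsManifold 𝓘(ℝ, E4) ∞ X]
  {G : Metric X} {o : ManifoldOrientation X} {g : X → X} {P : X}

/-- The differential of antipodal coordinates. -/
def AntipodalChart.tmap (c : AntipodalChart o g P) (x v : ℍ[ℝ]) : TangentBundle 𝓘(ℝ, E4) X :=
  tangentMap 𝓘(ℝ, ℍ[ℝ]) 𝓘(ℝ, E4) c.e ⟨x, v⟩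

theorem AntipodalChart.mdifferentiableAt (c : AntipodalChart o g P) {x : ℍ[ℝ]}
    (hx : x ∈ c.e.source) : MDifferentiableAt 𝓘(ℝ, ℍ[ℝ]) 𝓘(ℝ, E4) c.e x :=
  (c.smooth.contMDiffAt (c.e.open_source.mem_nhds hx)).mdifferentiableAt (by simp)

theorem AntipodalChart.neg_mem (c : AntipodalChart o g P) {x : ℍ[ℝ]}
    (hx : x ∈ c.e.source) : -x ∈ c.e.source := by
  rw [c.source_eq] at hx ⊢
  simpa using hx

theorem AntipodalChart.continuous_tmap (c : AntipodalChart o g P) {Y : Type*} [TopologicalSpace Y]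
    {x v : Y → ℍ[ℝ]} (hx : Continuous x) (hv : Continuous v) (hs : ∀ y, x y ∈ c.e.source) :
    Continuous fun y => c.tmap (x y) (v y) := by
  have hu : UniqueMDiffOn 𝓘(ℝ, ℍ[ℝ]) c.e.source := c.e.open_source.uniqueMDiffOn
  have h1 := c.smooth.continuousOn_tangentMapWithin (by simp) hu
  have h2 : Continuous fun y => (⟨x y, v y⟩ : TangentBundle 𝓘(ℝ, ℍ[ℝ]) ℍ[ℝ]) :=
    (tangentBundleModelSpaceHomeomorph 𝓘(ℝ, ℍ[ℝ])).symm.continuous.comp (hx.prodMk hv)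
  have h3 := h1.comp_continuous h2 hs
  refine h3.congr fun y => ?_
  exact tangentMapWithin_eq_tangentMap (hu _ (hs y)) (c.mdifferentiableAt (hs y))

/-- The chain rule applied to both sides of g ∘ e = e ∘ (-1). -/
theorem AntipodalChart.tangentMap_tmap (c : AntipodalChart o g P)
    (hsmooth : ContMDiff 𝓘(ℝ, E4) 𝓘(ℝ, E4) ∞ g) {x : ℍ[ℝ]} (hx : x ∈ c.e.source) (v : ℍ[ℝ]) :
    tangentMap 𝓘(ℝ, E4) 𝓘(ℝ, E4) g (c.tmap x v) = c.tmap (-x) (-v) := by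
  have hu : UniqueMDiffOn 𝓘(ℝ, ℍ[ℝ]) c.e.source := c.e.open_source.uniqueMDiffOn
  have hg : MDifferentiableAt 𝓘(ℝ, E4) 𝓘(ℝ, E4) g (c.e x) := hsmooth.mdifferentiableAt (by simp)
  have hn : DifferentiableAt ℝ (fun z : ℍ[ℝ] => -z) x := differentiableAt_id.neg
  have hnm : MDifferentiableAt 𝓘(ℝ, ℍ[ℝ]) 𝓘(ℝ, ℍ[ℝ]) (fun z : ℍ[ℝ] => -z) x :=
    hn.mdifferentiableAt
  have he := c.mdifferentiableAt hx
  have he' := c.mdifferentiableAt (c.neg_mem hx)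
  have h1 : tangentMap 𝓘(ℝ, ℍ[ℝ]) 𝓘(ℝ, E4) (g ∘ c.e) ⟨x, v⟩
      = tangentMap 𝓘(ℝ, E4) 𝓘(ℝ, E4) g (c.tmap x v) := tangentMap_comp_at _ hg he
  have h2 : tangentMap 𝓘(ℝ, ℍ[ℝ]) 𝓘(ℝ, E4) (c.e ∘ fun z : ℍ[ℝ] => -z) ⟨x, v⟩
      = tangentMap 𝓘(ℝ, ℍ[ℝ]) 𝓘(ℝ, E4) c.e
        (tangentMap 𝓘(ℝ, ℍ[ℝ]) 𝓘(ℝ, ℍ[ℝ]) (fun z : ℍ[ℝ] => -z) ⟨x, v⟩) :=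
    tangentMap_comp_at _ he' hnm
  have h3 : tangentMap 𝓘(ℝ, ℍ[ℝ]) 𝓘(ℝ, ℍ[ℝ]) (fun z : ℍ[ℝ] => -z) ⟨x, v⟩
      = (⟨-x, -v⟩ : TangentBundle 𝓘(ℝ, ℍ[ℝ]) ℍ[ℝ]) := by
    have : mfderiv 𝓘(ℝ, ℍ[ℝ]) 𝓘(ℝ, ℍ[ℝ]) (fun z : ℍ[ℝ] => -z) x v = -v := by
      rw [mfderiv_eq_fderiv, fderiv_fun_neg, fderiv_fun_id]
      rfl
    exact congrArg (fun u : ℍ[ℝ] => (⟨-x, u⟩ : TangentBundle 𝓘(ℝ, ℍ[ℝ]) ℍ[ℝ])) this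
  have h4 : tangentMap 𝓘(ℝ, ℍ[ℝ]) 𝓘(ℝ, E4) (g ∘ c.e) ⟨x, v⟩
      = tangentMap 𝓘(ℝ, ℍ[ℝ]) 𝓘(ℝ, E4) (c.e ∘ fun z : ℍ[ℝ] => -z) ⟨x, v⟩ := by
    have h5 := tangentMapWithin_congr (I := 𝓘(ℝ, ℍ[ℝ])) (I' := 𝓘(ℝ, E4)) (f := g ∘ c.e)
      (f₁ := c.e ∘ fun z : ℍ[ℝ] => -z) (s := c.e.source)
      (fun z hz => (c.antipodal z hz).symm) (⟨x, v⟩ : TangentBundle 𝓘(ℝ, ℍ[ℝ]) ℍ[ℝ]) hx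
    rwa [tangentMapWithin_eq_tangentMap (hu _ hx) (hg.comp x he),
      tangentMapWithin_eq_tangentMap (hu _ hx) (MDifferentiableAt.comp x he' hnm)] at h5
  rw [← h1, h4, h2, h3]
  rfl

theorem inn_tangentMap (hmetric : PreservesMetric G g) {v w : TangentBundle 𝓘(ℝ, E4) X}
    (h : v.proj = w.proj) : inn G (tangentMap 𝓘(ℝ, E4) 𝓘(ℝ, E4) g v)
      (tangentMap 𝓘(ℝ, E4) 𝓘(ℝ, E4) g w) = inn G v w := by
  obtain ⟨x, v⟩ := v
  obtain ⟨x', w⟩ := w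
  obtain rfl : x = x' := h
  exact hmetric x v w

/-- The differential of antipodal coordinates, as an operator between model spaces. -/
def AntipodalChart.dmap (c : AntipodalChart o g P) (x : ℍ[ℝ]) : ℍ[ℝ] →L[ℝ] E4 :=
  mfderiv 𝓘(ℝ, ℍ[ℝ]) 𝓘(ℝ, E4) c.e x

/-- The metric at a point of the antipodal coordinates, as a form on the model space. -/
def AntipodalChart.form (c : AntipodalChart o g P) (G : Metric X) (x : ℍ[ℝ]) :
    E4 →L[ℝ] E4 →L[ℝ] ℝ :=
  G.inner (c.e x)

/-- The metric in antipodal coordinates. -/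
def AntipodalChart.pull (c : AntipodalChart o g P) (G : Metric X) (x v w : ℍ[ℝ]) : ℝ :=
  inn G (c.tmap x v) (c.tmap x w)

theorem AntipodalChart.pull_symm (c : AntipodalChart o g P) (x v w : ℍ[ℝ]) :
    c.pull G x v w = c.pull G x w v :=
  G.symm (c.e x) (c.tmap x v).2 (c.tmap x w).2

theorem AntipodalChart.pull_add (c : AntipodalChart o g P) (x v v' w : ℍ[ℝ]) :
    c.pull G x (v + v') w = c.pull G x v w + c.pull G x v' w := by
  change c.form G x (c.dmap x (v + v')) (c.dmap x w)
    = c.form G x (c.dmap x v) (c.dmap x w) + c.form G x (c.dmap x v') (c.dmap x w)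
  rw [map_add, map_add, add_apply]

theorem AntipodalChart.pull_smul (c : AntipodalChart o g P) (x : ℍ[ℝ]) (r : ℝ) (v w : ℍ[ℝ]) :
    c.pull G x (r • v) w = r * c.pull G x v w := by
  change c.form G x (c.dmap x (r • v)) (c.dmap x w) = r * c.form G x (c.dmap x v) (c.dmap x w)
  rw [map_smul, map_smul, smul_apply, smul_eq_mul]

theorem AntipodalChart.tmap_snd_ne_zero (c : AntipodalChart o g P) {x v : ℍ[ℝ]}
    (hx : x ∈ c.e.source) (hv : v ≠ 0) : (c.tmap x v).2 ≠ 0 := by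
  obtain ⟨L, hL, -⟩ := c.oriented x hx
  intro h
  have h0 : L v = 0 := (hL v).trans h
  exact hv (L.map_eq_zero_iff.1 h0)

theorem AntipodalChart.pull_pos (c : AntipodalChart o g P) {x v : ℍ[ℝ]}
    (hx : x ∈ c.e.source) (hv : v ≠ 0) : 0 < c.pull G x v v :=
  G.pos (c.e x) _ (c.tmap_snd_ne_zero hx hv)

/-- The symmetric operator representing the metric in antipodal coordinates. -/
def AntipodalChart.pullOp (c : AntipodalChart o g P) (G : Metric X) (x : ℍ[ℝ]) :
    ℍ[ℝ] →L[ℝ] ℍ[ℝ] :=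
  LinearMap.toContinuousLinearMap
    { toFun := fun v => c.pull G x v 1 • 1 + c.pull G x v qI • qI + c.pull G x v qJ • qJ
        + c.pull G x v qK • qK
      map_add' := fun v w => by simp only [c.pull_add]; module
      map_smul' := fun r v => by simp only [c.pull_smul, RingHom.id_apply]; module }

theorem AntipodalChart.pullOp_apply (c : AntipodalChart o g P) (x v : ℍ[ℝ]) :
    c.pullOp G x v = c.pull G x v 1 • 1 + c.pull G x v qI • qI + c.pull G x v qJ • qJ
        + c.pull G x v qK • qK := rfl

theorem AntipodalChart.inner_pullOp (c : AntipodalChart o g P) (x v w : ℍ[ℝ]) :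
    inner ℝ (c.pullOp G x v) w = c.pull G x v w := by
  have hw : w = w.re • 1 + w.imI • qI + w.imJ • qJ + w.imK • qK := by ext <;> simp
  have h2 : c.pull G x v w = w.re * c.pull G x v 1 + w.imI * c.pull G x v qI
      + w.imJ * c.pull G x v qJ + w.imK * c.pull G x v qK := by
    rw [c.pull_symm]
    conv_lhs => rw [hw]
    simp only [c.pull_add, c.pull_smul]
    rw [c.pull_symm x 1 v, c.pull_symm x qI v, c.pull_symm x qJ v, c.pull_symm x qK v]
  rw [h2, inner_eq, c.pullOp_apply]
  simp
  ring

theorem AntipodalChart.isPosDef_pullOp (c : AntipodalChart o g P) {x : ℍ[ℝ]}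
    (hx : x ∈ c.e.source) : IsPosDef (c.pullOp G x) := by
  refine ⟨fun a b => ?_, fun a ha => ?_⟩
  · rw [c.inner_pullOp, real_inner_comm, c.inner_pullOp, c.pull_symm]
  · rw [c.inner_pullOp]; exact c.pull_pos hx ha

/-- Because g is an isometry; the signs that dg puts on the two vectors cancel by bilinearity. This
makes the orthonormal frame field compatible with g. -/
theorem AntipodalChart.pull_neg (c : AntipodalChart o g P)
    (hsmooth : ContMDiff 𝓘(ℝ, E4) 𝓘(ℝ, E4) ∞ g) (hmetric : PreservesMetric G g) {x : ℍ[ℝ]}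
    (hx : x ∈ c.e.source) (v w : ℍ[ℝ]) : c.pull G (-x) v w = c.pull G x v w := by
  have h := inn_tangentMap hmetric (v := c.tmap x (-v)) (w := c.tmap x (-w)) rfl
  rw [c.tangentMap_tmap hsmooth hx, c.tangentMap_tmap hsmooth hx, neg_neg, neg_neg] at h
  have h1 : c.pull G (-x) v w = c.pull G x (-v) (-w) := h
  rw [h1, ← neg_one_smul ℝ v, ← neg_one_smul ℝ w, c.pull_smul, c.pull_symm, c.pull_smul,
    c.pull_symm]
  ring

theorem AntipodalChart.pullOp_neg (c : AntipodalChart o g P)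
    (hsmooth : ContMDiff 𝓘(ℝ, E4) 𝓘(ℝ, E4) ∞ g) (hmetric : PreservesMetric G g) {x : ℍ[ℝ]}
    (hx : x ∈ c.e.source) : c.pullOp G (-x) = c.pullOp G x := by
  ext1 v
  rw [c.pullOp_apply, c.pullOp_apply]
  simp only [c.pull_neg hsmooth hmetric hx]

theorem AntipodalChart.continuous_pullOp (c : AntipodalChart o g P) {Y : Type*}
    [TopologicalSpace Y] {x : Y → ℍ[ℝ]} (hx : Continuous x) (hs : ∀ y, x y ∈ c.e.source) :
    Continuous fun y => c.pullOp G (x y) := by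
  rw [continuous_clm_apply]
  intro v
  have : ∀ w, Continuous fun y => c.pull G (x y) v w := fun w =>
    continuous_inn (c.continuous_tmap hx continuous_const hs)
      (c.continuous_tmap hx continuous_const hs) fun _ => rfl
  simp only [c.pullOp_apply]
  have h1 := this 1
  have h2 := this qI
  have h3 := this qJ
  have h4 := this qK
  fun_prop

/-! ### The orthonormal frame field in antipodal coordinates -/

/-- The radial retraction of `ℍ` onto the unit ball. -/
def retr (x : ℍ[ℝ]) : ℍ[ℝ] := (max 1 ‖x‖)⁻¹ • x

theorem retr_neg (x : ℍ[ℝ]) : retr (-x) = -retr x := by simp [retr]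

theorem retr_zero : retr 0 = 0 := by simp [retr]

theorem retr_of_norm {x : ℍ[ℝ]} (hx : ‖x‖ = 1) : retr x = x := by simp [retr, hx]

theorem continuous_retr : Continuous retr := by
  unfold retr
  refine Continuous.smul ((continuous_const.max continuous_norm).inv₀ fun x => ?_) continuous_id
  have : (1 : ℝ) ≤ max 1 ‖x‖ := le_max_left _ _
  positivity

theorem AntipodalChart.retr_mem (c : AntipodalChart o g P) (x : ℍ[ℝ]) : retr x ∈ c.e.source := by
  rw [c.source_eq, mem_ball_zero_iff, retr, norm_smul, norm_inv, Real.norm_eq_abs]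
  have h1 : (1 : ℝ) ≤ max 1 ‖x‖ := le_max_left _ _
  have h2 : ‖x‖ ≤ max 1 ‖x‖ := le_max_right _ _
  rw [abs_of_pos (by linarith), inv_mul_lt_iff₀ (by linarith)]
  linarith

/-- The symmetric positive orthonormal frame in antipodal coordinates. -/
def AntipodalChart.symFrame (c : AntipodalChart o g P) (G : Metric X) (x : ℍ[ℝ]) :
    ℍ[ℝ] →L[ℝ] ℍ[ℝ] := invSqrt (c.pullOp G (retr x))

theorem AntipodalChart.isPosDef_symFrame (c : AntipodalChart o g P) (x : ℍ[ℝ]) :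
    IsPosDef (c.symFrame G x) := isPosDef_invSqrt (c.isPosDef_pullOp (c.retr_mem x))

theorem AntipodalChart.continuous_symFrame (c : AntipodalChart o g P) :
    Continuous (c.symFrame G) :=
  continuous_invSqrt (fun x => c.isPosDef_pullOp (c.retr_mem x))
    (c.continuous_pullOp continuous_retr c.retr_mem)

theorem AntipodalChart.symFrame_neg (c : AntipodalChart o g P)
    (hsmooth : ContMDiff 𝓘(ℝ, E4) 𝓘(ℝ, E4) ∞ g) (hmetric : PreservesMetric G g) (x : ℍ[ℝ]) :
    c.symFrame G (-x) = c.symFrame G x := by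
  rw [AntipodalChart.symFrame, retr_neg, c.pullOp_neg hsmooth hmetric (c.retr_mem x)]
  rfl

theorem AntipodalChart.pull_symFrame (c : AntipodalChart o g P) (x a b : ℍ[ℝ]) :
    c.pull G (retr x) (c.symFrame G x a) (c.symFrame G x b) = inner ℝ a b := by
  rw [← c.inner_pullOp, real_inner_comm, (c.isPosDef_symFrame x).1, real_inner_comm]
  have := invSqrt_mul_mul (c.isPosDef_pullOp (G := G) (c.retr_mem x))
  have h2 := congrArg (fun f : ℍ[ℝ] →L[ℝ] ℍ[ℝ] => f a) this
  exact congrArg (fun z => (inner ℝ z b : ℝ)) h2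

theorem IsPosDef.det_pos {p : ℍ[ℝ] →L[ℝ] ℍ[ℝ]} (hp : IsPosDef p) :
    0 < LinearMap.det (p : ℍ[ℝ] →ₗ[ℝ] ℍ[ℝ]) := by
  obtain ⟨q, hq, rfl⟩ := hp.exists_sqrt
  have h1 : LinearMap.det ((q * q : ℍ[ℝ] →L[ℝ] ℍ[ℝ]) : ℍ[ℝ] →ₗ[ℝ] ℍ[ℝ])
      = LinearMap.det (q : ℍ[ℝ] →ₗ[ℝ] ℍ[ℝ]) * LinearMap.det (q : ℍ[ℝ] →ₗ[ℝ] ℍ[ℝ]) := by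
    rw [← LinearMap.det_comp]
    rfl
  have h2 : LinearMap.det (q : ℍ[ℝ] →ₗ[ℝ] ℍ[ℝ]) ≠ 0 := by
    have hu : IsUnit (LinearMap.det (q : ℍ[ℝ] →ₗ[ℝ] ℍ[ℝ])) := by
      have := LinearEquiv.isUnit_det' (LinearEquiv.ofInjectiveEndo (q : ℍ[ℝ] →ₗ[ℝ] ℍ[ℝ])
        hq.injective)
      exact this
    exact hu.ne_zero
  rw [h1]
  exact lt_of_le_of_ne (mul_self_nonneg _) (mul_ne_zero h2 h2).symm

/-- The orthonormal frame field in antipodal coordinates. -/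
def AntipodalChart.frameFun (c : AntipodalChart o g P) (G : Metric X) (x a : ℍ[ℝ]) :
    TangentBundle 𝓘(ℝ, E4) X := c.tmap (retr x) (c.symFrame G x a)

theorem AntipodalChart.frameFun_mem (c : AntipodalChart o g P) (x : ℍ[ℝ]) :
    c.frameFun G x ∈ frames G o := by
  obtain ⟨L, hL, ho⟩ := c.oriented _ (c.retr_mem x)
  have hp := c.isPosDef_symFrame (G := G) x
  let W : ℍ[ℝ] ≃ₗ[ℝ] ℍ[ℝ] :=
    LinearEquiv.ofInjectiveEndo (c.symFrame G x : ℍ[ℝ] →ₗ[ℝ] ℍ[ℝ]) hp.injective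
  have hW : ∀ a, W a = c.symFrame G x a := fun a => rfl
  refine ⟨c.e (retr x), W.trans L, fun a => ?_, fun a b => ?_, ?_⟩
  · rw [LinearEquiv.trans_apply, hL, hW]
    rfl
  · rw [LinearEquiv.trans_apply, LinearEquiv.trans_apply, hL, hL, hW, hW]
    exact c.pull_symFrame x a b
  · rw [← ho, eq_comm, frameOrientation_eq_iff]
    have e : (((W.trans L).trans L.symm : ℍ[ℝ] ≃ₗ[ℝ] ℍ[ℝ]) : ℍ[ℝ] →ₗ[ℝ] ℍ[ℝ])
        = (c.symFrame G x : ℍ[ℝ] →ₗ[ℝ] ℍ[ℝ]) := by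
      ext1 a
      exact L.symm_apply_apply _
    rw [e]
    exact hp.det_pos

/-- The orthonormal frame field in antipodal coordinates, as a map to the frame bundle. -/
def AntipodalChart.frame (c : AntipodalChart o g P) (G : Metric X) (x : ℍ[ℝ]) : frames G o :=
  ⟨c.frameFun G x, c.frameFun_mem x⟩

theorem AntipodalChart.frame_apply (c : AntipodalChart o g P) (x a : ℍ[ℝ]) :
    (c.frame G x).1 a = c.tmap (retr x) (c.symFrame G x a) := rfl

theorem AntipodalChart.continuous_frame (c : AntipodalChart o g P) : Continuous (c.frame G) := by
  refine Continuous.subtype_mk (continuous_pi fun a => ?_) _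
  have := c.continuous_symFrame (G := G)
  exact c.continuous_tmap continuous_retr (this.clm_apply continuous_const) c.retr_mem

theorem AntipodalChart.tangentMap_frame (c : AntipodalChart o g P)
    (hsmooth : ContMDiff 𝓘(ℝ, E4) 𝓘(ℝ, E4) ∞ g) (hmetric : PreservesMetric G g) (x a : ℍ[ℝ]) :
    tangentMap 𝓘(ℝ, E4) 𝓘(ℝ, E4) g ((c.frame G x).1 a) = (c.frame G (-x)).1 (-a) := by
  rw [c.frame_apply, c.frame_apply, c.tangentMap_tmap hsmooth (c.retr_mem x), retr_neg,
    c.symFrame_neg hsmooth hmetric, map_neg]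

/-- The retraction extends the frame field to all of ℍ, which is simply connected, so it lifts
through the double covering. -/
theorem exists_section (S : SpinStructure (frames G o)) (c : AntipodalChart o g P) :
    ∃ F : ℍ[ℝ] → S.Total, Continuous F ∧ ∀ x, S.proj (F x) = c.frame G x := by
  obtain ⟨y, hy⟩ := S.surjective (c.frame G 0)
  obtain ⟨F, ⟨-, hF⟩, -⟩ := S.isCoveringMap.existsUnique_continuousMap_lifts
    ⟨c.frame G, c.continuous_frame⟩ 0 y hy
  exact ⟨F, F.continuous, fun x => congrFun hF x⟩

theorem base_section {S : SpinStructure (frames G o)} {c : AntipodalChart o g P}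
    {F : ℍ[ℝ] → S.Total} (hF : ∀ x, S.proj (F x) = c.frame G x) (x : ℍ[ℝ]) :
    S.base (F x) = c.e (retr x) := by
  rw [SpinStructure.base, hF]
  rfl

/-! ### The monodromy of the lift -/

/-- The two elements of `Spin(4)` over `-1 ∈ SO(4)`. -/
def antipode (τ : SpinType) : Spin4 := swapOf τ (-1, 1)

theorem rot_antipode (τ : SpinType) (a : ℍ[ℝ]) : rot (antipode τ) a = -a := by
  cases τ <;> simp [rot, antipode, swapOf, coe_neg_one]

theorem antipode_comm (τ : SpinType) (s : Spin4) : antipode τ * s = s * antipode τ := by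
  cases τ <;> ext1 <;> simp [antipode, swapOf]

theorem antipode_mul_self (τ : SpinType) : antipode τ * antipode τ = 1 := by
  cases τ <;> ext1 <;> simp [antipode, swapOf]

theorem antipode_mul_neg_one :
    antipode .plus * (-1) = antipode .minus := by
  ext1 <;> simp [antipode, swapOf]

/-- The lift acts on the fibre over `P` as the element `antipode τ`. -/
def Lift.ActsAs {S : SpinStructure (frames G o)} (l : Lift S g) (P : X) (τ : SpinType) : Prop :=
  ∀ y, S.base y = P → l.toHomeo y = S.act y (antipode τ)

/-- As dg = -1 at P, the lift moves F(0) to one of the two points over the opposite frame.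
Equivariance and centrality of the antipodes extend this from F(0) to the whole fibre. -/
theorem Lift.exists_actsAs {S : SpinStructure (frames G o)} (l : Lift S g)
    (c : AntipodalChart o g P) (hsmooth : ContMDiff 𝓘(ℝ, E4) 𝓘(ℝ, E4) ∞ g)
    (hmetric : PreservesMetric G g) : ∃ τ, l.ActsAs P τ := by
  obtain ⟨F, -, hF⟩ := exists_section S c
  have hP : S.base (F 0) = P := by rw [base_section hF, retr_zero, c.map_zero]
  have key : ∀ τ, l.toHomeo (F 0) = S.act (F 0) (antipode τ) → l.ActsAs P τ := by
    intro τ h y hy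
    obtain ⟨s, rfl⟩ := S.exists_act_eq (hy.trans hP.symm)
    rw [l.equivariant, h, ← S.act_mul, ← S.act_mul, antipode_comm]
  have h1 : S.proj (l.toHomeo (F 0)) = S.proj (S.act (F 0) (antipode .plus)) := by
    apply Subtype.ext
    rw [l.covers, S.proj_act, hF]
    ext1 a
    rw [c.tangentMap_frame hsmooth hmetric, rot_antipode, neg_zero]
  rcases (S.proj_eq_iff _ _).1 h1 with h | h
  · exact ⟨_, key .plus h⟩
  · rw [← S.act_mul, antipode_mul_neg_one] at h
    exact ⟨_, key .minus h⟩

/-- Both sides lift the same map from ℍ to the frame bundle and agree at 0, so they agree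
everywhere, in particular on the link. -/
theorem Lift.toHomeo_section {S : SpinStructure (frames G o)} (l : Lift S g)
    {c : AntipodalChart o g P} (hsmooth : ContMDiff 𝓘(ℝ, E4) 𝓘(ℝ, E4) ∞ g)
    (hmetric : PreservesMetric G g) {F : ℍ[ℝ] → S.Total} (hFc : Continuous F)
    (hF : ∀ x, S.proj (F x) = c.frame G x) {τ : SpinType} (hτ : l.ActsAs P τ) (x : ℍ[ℝ]) :
    l.toHomeo (F x) = S.act (F (-x)) (antipode τ) := by
  have hP : S.base (F 0) = P := by rw [base_section hF, retr_zero, c.map_zero]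
  have := S.isCoveringMap.eq_of_comp_eq (g₁ := fun x => l.toHomeo (F x))
    (g₂ := fun x => S.act (F (-x)) (antipode τ)) (l.toHomeo.continuous.comp hFc)
    (S.continuous_act.comp (by fun_prop : Continuous fun x => (F (-x), antipode τ))) (by
      ext1 x
      apply Subtype.ext
      simp only [Function.comp_apply]
      rw [l.covers, S.proj_act, hF, hF]
      ext1 a
      rw [c.tangentMap_frame hsmooth hmetric, rot_antipode]) 0 (by
      simp only [neg_zero]
      exact hτ _ hP)
  exact congrFun this x

end Chart


/-! ### Half-spin traces and the Atiyah–Bott sign. -/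

theorem su2_mul (p q : ℍ[ℝ]) : su2 (p * q) = su2 p * su2 q := by
  ext i j
  fin_cases i <;> fin_cases j <;> apply Complex.ext <;>
    simp [su2, Matrix.mul_apply, Fin.sum_univ_two] <;> ring

theorem su2_one : su2 1 = 1 := by
  ext i j
  fin_cases i <;> fin_cases j <;> apply Complex.ext <;> simp [su2]

theorem su2_neg_one : su2 (-1) = -1 := by
  ext i j
  fin_cases i <;> fin_cases j <;> apply Complex.ext <;> simp [su2]

/-- The half-spin representation on `S₊`, as a homomorphism. -/
def spinPlusHom : Spin4 →* Matrix (Fin 2) (Fin 2) ℂ where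
  toFun := spinPlus
  map_one' := su2_one
  map_mul' _ _ := su2_mul _ _

/-- The half-spin representation on `S₋`, as a homomorphism. -/
def spinMinusHom : Spin4 →* Matrix (Fin 2) (Fin 2) ℂ where
  toFun := spinMinus
  map_one' := su2_one
  map_mul' _ _ := su2_mul _ _

section Chart

variable {X : Type*} [TopologicalSpace X] [ChartedSpace E4 X] [IsManifold 𝓘(ℝ, E4) ∞ X]
  {G : Metric X} {o : ManifoldOrientation X} {g : X → X} {P : X}

/-- Spin(4) acts simply transitively on the fibre over P, so an equivariant function is determined
by an arbitrary value at y₀. -/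
theorem finrank_spinorFibre (S : SpinStructure (frames G o))
    (r : Spin4 →* Matrix (Fin 2) (Fin 2) ℂ) (y₀ : S.Total) (h₀ : S.base y₀ = P) :
    Module.finrank ℂ (spinorFibre S r P) = 2 := by
  have hex : ∀ y : {y : S.Total // S.base y = P}, ∃ s, y.1 = S.act y₀ s :=
    fun y => S.exists_act_eq (y.2.trans h₀.symm)
  choose k hk using hex
  have hk' : ∀ (y : {y : S.Total // S.base y = P}) s, S.act y₀ s = y.1 → k y = s :=
    fun y s h => S.act_injective ((hk y).symm.trans h.symm)
  let ev : spinorFibre S r P →ₗ[ℂ] (Fin 2 → ℂ) :=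
    { toFun := fun σ => σ.1 ⟨y₀, h₀⟩
      map_add' := fun _ _ => rfl
      map_smul' := fun _ _ => rfl }
  have hrr : ∀ s (v : Fin 2 → ℂ), r s⁻¹ *ᵥ (r s *ᵥ v) = v := fun s v => by
    rw [Matrix.mulVec_mulVec, ← map_mul, inv_mul_cancel, map_one, Matrix.one_mulVec]
  have hbij : Function.Bijective ev := by
    constructor
    · rw [← LinearMap.ker_eq_bot, LinearMap.ker_eq_bot']
      intro σ hσ
      ext1
      funext y
      have h1 := σ.2 ⟨y₀, h₀⟩ (k y)
      have h2 : σ.1 ⟨y₀, h₀⟩ = 0 := hσ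
      have h3 : (⟨S.act y₀ (k y), (S.base_act y₀ (k y)).trans h₀⟩ :
        {y : S.Total // S.base y = P}) = y := Subtype.ext (hk y).symm
      simp only [h2, h3] at h1
      have h4 := hrr (k y) (σ.1 y)
      rw [h1, Matrix.mulVec_zero] at h4
      exact h4.symm
    · intro v
      refine ⟨⟨fun y => r (k y)⁻¹ *ᵥ v, fun y s => ?_⟩, ?_⟩
      · have : k ⟨S.act y.1 s, (S.base_act y.1 s).trans y.2⟩ = k y * s :=
          hk' _ _ (by rw [S.act_mul, ← hk])
        simp only [this, Matrix.mulVec_mulVec]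
        rw [← map_mul]
        simp
      · have : k ⟨y₀, h₀⟩ = 1 := hk' _ _ (S.act_one _)
        change r (k ⟨y₀, h₀⟩)⁻¹ *ᵥ v = v
        rw [this]
        simp
  rw [(LinearEquiv.ofBijective ev hbij).finrank_eq]
  simp

theorem Lift.trace_onSpinors {S : SpinStructure (frames G o)} (l : Lift S g)
    (r : Spin4 →* Matrix (Fin 2) (Fin 2) ℂ) (hg : Function.Involutive g) (hP : g P = P)
    {τ : SpinType} (hτ : l.ActsAs P τ) {y₀ : S.Total} (h₀ : S.base y₀ = P) {z : ℂ}
    (hr : r (antipode τ) = z • 1) (hz : z * z = 1) :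
    LinearMap.trace ℂ _ (l.onSpinors r hg hP) = z * 2 := by
  have hs : l.onSpinors r hg hP = z • LinearMap.id := by
    ext1 σ
    apply Subtype.ext
    funext y
    have h1 := σ.2 y (antipode τ)
    rw [hr, Matrix.smul_mulVec, Matrix.one_mulVec] at h1
    -- The inverse in the action on spinors does no harm: an antipode is its own inverse.
    have h2 : l.toHomeo.symm y.1 = S.act y.1 (antipode τ) := by
      rw [Homeomorph.symm_apply_eq, l.equivariant, hτ _ y.2, ← S.act_mul, antipode_mul_self,
        S.act_one]
    change σ.1 ⟨l.toHomeo.symm y.1, _⟩ = z • σ.1 y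
    simp only [h2]
    rw [← h1, smul_smul, hz, one_smul]
  have hfin := finrank_spinorFibre S r y₀ h₀
  have : Module.Finite ℂ (spinorFibre S r P) :=
    Module.finite_of_finrank_pos (by rw [hfin]; norm_num)
  rw [hs, map_smul, LinearMap.trace_id, finrank_spinorFibre S r y₀ h₀]
  simp

omit [IsManifold 𝓘(ℝ, E4) ∞ X] in
theorem mk_differentialAt (hP : g P = P) (v : TangentSpace 𝓘(ℝ, E4) P) :
    (⟨P, differentialAt g hP v⟩ : TangentBundle 𝓘(ℝ, E4) X)
      = tangentMap 𝓘(ℝ, E4) 𝓘(ℝ, E4) g ⟨P, v⟩ := by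
  -- The cast along g P = P is eliminated by generalizing the endpoint and substituting.
  have key : ∀ (Q R : X) (h : R = Q)
      (D : TangentSpace 𝓘(ℝ, E4) P →ₗ[ℝ] TangentSpace 𝓘(ℝ, E4) R),
      (⟨Q, (Eq.rec (motive := fun Q _ => TangentSpace 𝓘(ℝ, E4) P →ₗ[ℝ] TangentSpace 𝓘(ℝ, E4) Q)
        D h : TangentSpace 𝓘(ℝ, E4) P →ₗ[ℝ] TangentSpace 𝓘(ℝ, E4) Q) v⟩ :
        TangentBundle 𝓘(ℝ, E4) X) = ⟨R, D v⟩ := by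
    intro Q R h D
    subst h
    rfl
  exact key P (g P) hP _

theorem AntipodalChart.differentialAt_eq (c : AntipodalChart o g P)
    (hsmooth : ContMDiff 𝓘(ℝ, E4) 𝓘(ℝ, E4) ∞ g) (hP : g P = P) :
    differentialAt g hP = -LinearMap.id := by
  have h0 : (0 : ℍ[ℝ]) ∈ c.e.source := by
    rw [c.source_eq]
    simp
  obtain ⟨L, hL, -⟩ := c.oriented 0 h0
  have hsurj : ∀ v : E4, ∃ a, c.dmap 0 a = v := fun v =>
    ⟨L.symm v, (hL (L.symm v)).symm.trans (L.apply_symm_apply v)⟩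
  have ht : ∀ a, c.tmap 0 a = (⟨P, (c.dmap 0 a : E4)⟩ : TangentBundle 𝓘(ℝ, E4) X) := fun a =>
    congrArg (fun p => (⟨p, (c.dmap 0 a : E4)⟩ : TangentBundle 𝓘(ℝ, E4) X)) c.map_zero
  ext1 v
  obtain ⟨a, ha⟩ := hsurj v
  have h1 := mk_differentialAt hP v
  have h2 := c.tangentMap_tmap hsmooth h0 a
  rw [neg_zero, ht, ht, ha, map_neg, ha] at h2
  exact Bundle.TotalSpace.mk_inj.1 (h1.trans h2)

theorem AntipodalChart.det_eq (c : AntipodalChart o g P)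
    (hsmooth : ContMDiff 𝓘(ℝ, E4) 𝓘(ℝ, E4) ∞ g) (hP : g P = P) :
    LinearMap.det (LinearMap.id - differentialAt g hP) = 16 := by
  rw [c.differentialAt_eq hsmooth]
  have : (LinearMap.id - -LinearMap.id : E4 →ₗ[ℝ] E4) = (2 : ℝ) • LinearMap.id := by
    rw [sub_neg_eq_add, two_smul]
  have h2 : LinearMap.det (LinearMap.id - -LinearMap.id : E4 →ₗ[ℝ] E4) = 16 := by
    rw [this, LinearMap.det_smul, LinearMap.det_id]
    norm_num
  exact h2

/-- The Atiyah–Bott sign of a fixed point over which the lift acts as `antipode τ`. -/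
def signOf : SpinType → SignType
  | .plus => -1
  | .minus => 1

theorem Lift.epsilon_eq {S : SpinStructure (frames G o)} (l : Lift S g)
    (c : AntipodalChart o g P) (hsmooth : ContMDiff 𝓘(ℝ, E4) 𝓘(ℝ, E4) ∞ g)
    (hg : Function.Involutive g) (hP : g P = P) {τ : SpinType} (hτ : l.ActsAs P τ) :
    l.epsilon hg hP = signOf τ := by
  obtain ⟨F, -, hF⟩ := exists_section S c
  have h₀ : S.base (F 0) = P := by rw [base_section hF, retr_zero, c.map_zero]
  rw [Lift.epsilon, Lift.nu, c.det_eq hsmooth]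
  have hone : su2 ((1 : Sp1) : ℍ[ℝ]) = (1 : ℂ) • 1 := by
    rw [one_smul]
    exact su2_one
  have hneg : su2 ((-1 : Sp1) : ℍ[ℝ]) = (-1 : ℂ) • 1 := by
    rw [neg_one_smul, coe_neg_one]
    exact su2_neg_one
  cases τ
  · have h1 := l.trace_onSpinors spinPlusHom hg hP hτ h₀ (z := -1) hneg (by norm_num)
    have h2 := l.trace_onSpinors spinMinusHom hg hP hτ h₀ (z := 1) hone (by norm_num)
    have h1' : LinearMap.trace ℂ _ (l.onSpinors spinPlus hg hP) = -1 * 2 := h1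
    have h2' : LinearMap.trace ℂ _ (l.onSpinors spinMinus hg hP) = 1 * 2 := h2
    rw [h1', h2']
    have : ((-1 * 2 - 1 * 2 : ℂ) / ((|16| : ℝ) : ℂ)).re = -1 / 4 := by
      norm_num
    rw [this]
    exact sign_neg (by norm_num)
  · have h1 := l.trace_onSpinors spinPlusHom hg hP hτ h₀ (z := 1) hone (by norm_num)
    have h2 := l.trace_onSpinors spinMinusHom hg hP hτ h₀ (z := -1) hneg (by norm_num)
    have h1' : LinearMap.trace ℂ _ (l.onSpinors spinPlus hg hP) = 1 * 2 := h1
    have h2' : LinearMap.trace ℂ _ (l.onSpinors spinMinus hg hP) = -1 * 2 := h2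
    rw [h1', h2']
    have : ((1 * 2 - -1 * 2 : ℂ) / ((|16| : ℝ) : ℂ)).re = 1 / 4 := by
      norm_num
    rw [this]
    exact sign_pos (by norm_num)

end Chart


/-! ### Linearization of the involution and existence of antipodal coordinates. -/

/-- An involution with an isolated fixed point is antipodal in suitable coordinates. -/
theorem exists_linearization {E : Type*} [NormedAddCommGroup E] [NormedSpace ℝ E]
    [CompleteSpace E] {U : Set E} (hU : IsOpen U) {h : E → E} {p : E} (hp : p ∈ U)
    (hs : ContDiffOn ℝ ∞ h U) (hh : ∀ z ∈ U, h (h z) = z) (hfp : h p = p)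
    (hiso : ∀ᶠ z in 𝓝 p, h z = z → z = p) :
    ∃ Q : OpenPartialHomeomorph E E, p ∈ Q.source ∧ Q p = 0 ∧
      (∀ᶠ u in 𝓝 0, Q.symm (-u) = h (Q.symm u)) ∧
      (∀ᶠ u in 𝓝 0, ContDiffAt ℝ ∞ Q.symm u ∧ ContDiffAt ℝ ∞ Q (Q.symm u)) ∧
      HasFDerivAt Q.symm ((1 / 2 : ℝ) • ContinuousLinearMap.id ℝ E) 0 := by
  have hs' : ∀ z ∈ U, ContDiffAt ℝ ∞ h z := fun z hz => hs.contDiffAt (hU.mem_nhds hz)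
  set A := fderiv ℝ h p with hAdef
  have hA : HasFDerivAt h A p := ((hs' p hp).differentiableAt (by simp)).hasFDerivAt
  have hAA : A.comp A = ContinuousLinearMap.id ℝ E := by
    have h1 : HasFDerivAt (h ∘ h) (A.comp A) p := by
      refine HasFDerivAt.comp p ?_ hA
      rwa [hfp]
    have h2 : h ∘ h =ᶠ[𝓝 p] id := Filter.eventually_of_mem (hU.mem_nhds hp) hh
    exact h1.unique ((hasFDerivAt_id p).congr_of_eventuallyEq h2)
  have hAA' : ∀ v, A (A v) = v := fun v => congrArg (fun f : E →L[ℝ] E => f v) hAA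
  -- The sum over the group of order two: q ∘ h = A ∘ q because A² = 1. It is not divided by 2, so
  -- its derivative at p is 1 + A² = 2.
  let q : E → E := fun z => (z - p) + A (h z - p)
  have hqs : ∀ z ∈ U, ContDiffAt ℝ ∞ q z := fun z hz =>
    (contDiffAt_id.sub contDiffAt_const).add
      (A.contDiff.contDiffAt.comp z ((hs' z hz).sub contDiffAt_const))
  let D : E ≃L[ℝ] E := ContinuousLinearEquiv.equivOfInverse
    ((2 : ℝ) • ContinuousLinearMap.id ℝ E) ((1 / 2 : ℝ) • ContinuousLinearMap.id ℝ E)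
    (fun x => by simp [smul_smul]) (fun x => by simp [smul_smul])
  have hqD : HasFDerivAt q (D : E →L[ℝ] E) p := by
    have h1 : HasFDerivAt q (ContinuousLinearMap.id ℝ E + A.comp A) p :=
      ((hasFDerivAt_id p).sub_const p).add (A.hasFDerivAt.comp p (hA.sub_const p))
    convert h1 using 1
    rw [hAA, ← two_smul ℝ]
    rfl
  have hne : (∞ : WithTop ℕ∞) ≠ 0 := by simp
  let Q := (hqs p hp).toOpenPartialHomeomorph q hqD hne
  have hQ : ∀ z, Q z = q z := fun _ => rfl
  have hpQ : p ∈ Q.source := (hqs p hp).mem_toOpenPartialHomeomorph_source hqD hne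
  have hQp : Q p = 0 := by rw [hQ]; simp [q, hfp]
  have h0 : (0 : E) ∈ Q.target := by rw [← hQp]; exact Q.map_source hpQ
  have hs0 : Q.symm 0 = p := by rw [← hQp]; exact Q.left_inv hpQ
  have hc : Filter.Tendsto Q.symm (𝓝 0) (𝓝 p) := by
    have := Q.continuousAt_symm h0
    rwa [ContinuousAt, hs0] at this
  have hqh : ∀ z ∈ U, q (h z) = A (q z) := fun z hz => by
    simp only [q, hh z hz, map_add, hAA']
    abel
  have hUev : ∀ᶠ u in 𝓝 0, Q.symm u ∈ U := hc (hU.mem_nhds hp)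
  have hsym : ∀ᶠ u in 𝓝 0, Q.symm (A u) = h (Q.symm u) := by
    have h1 : ∀ᶠ u in 𝓝 0, h (Q.symm u) ∈ Q.source := by
      have h2 : Filter.Tendsto h (𝓝 p) (𝓝 p) := by
        have := (hs' p hp).continuousAt
        rwa [ContinuousAt, hfp] at this
      exact (h2.comp hc) (Q.open_source.mem_nhds hpQ)
    filter_upwards [Q.open_target.mem_nhds h0, hUev, h1] with u hu1 hu2 hu3
    have h4 : Q (h (Q.symm u)) = A u := by
      rw [hQ, hqh _ hu2, ← hQ, Q.right_inv hu1]
    rw [← h4, Q.left_inv hu3]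
  -- A nonzero vector fixed by A would give fixed points of h accumulating at p, against isolation.
  have hfix : ∀ v, A v = v → v = 0 := by
    intro v hv
    have ht : Filter.Tendsto (fun t : ℝ => t • v) (𝓝 0) (𝓝 0) := by
      have : Continuous fun t : ℝ => t • v := by fun_prop
      have := this.tendsto 0
      rwa [zero_smul] at this
    have h1 : ∀ᶠ t : ℝ in 𝓝 0, t • v = 0 := by
      filter_upwards [ht.eventually hsym, ht.eventually (hc.eventually hiso),
        ht.eventually (Q.open_target.mem_nhds h0)] with t h2 h3 h4
      rw [map_smul, hv] at h2
      have h5 := h3 h2.symm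
      rw [← Q.right_inv h4, h5, hQp]
    have h2 : ∀ᶠ t : ℝ in 𝓝[≠] 0, t • v = 0 := h1.filter_mono nhdsWithin_le_nhds
    obtain ⟨t, h3, h4⟩ := (h2.and self_mem_nhdsWithin).exists
    exact (smul_eq_zero.1 h3).resolve_left h4
  have hAneg : ∀ v, A v = -v := fun v => by
    have := hfix (v + A v) (by rw [map_add, hAA', add_comm])
    exact eq_neg_of_add_eq_zero_right this
  refine ⟨Q, hpQ, hQp, ?_, ?_, ?_⟩
  · filter_upwards [hsym] with u hu
    rwa [hAneg] at hu
  -- Invertibility of the derivative is an open condition, so the inverse is smooth at all nearby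
  -- points and not just at 0.
  · have h1 : ∀ᶠ z in 𝓝 p, fderiv ℝ q z ∈ Set.range ((↑) : (E ≃L[ℝ] E) → E →L[ℝ] E) := by
      have h2 : ContinuousAt (fderiv ℝ q) p := (hqs p hp).continuousAt_fderiv (by simp)
      have h3 := ContinuousLinearEquiv.nhds D
      rw [← hqD.fderiv] at h3
      exact h2 h3
    filter_upwards [hUev, hc.eventually h1, Q.open_target.mem_nhds h0] with u hu ⟨D', hD'⟩ hu'
    refine ⟨Q.contDiffAt_symm (f₀' := D') hu' ?_ (hqs _ hu), hqs _ hu⟩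
    rw [hD']
    exact ((hqs _ hu).differentiableAt (by simp)).hasFDerivAt
  · have := Q.hasFDerivAt_symm (f' := D) h0 (by rw [hs0]; exact hqD)
    exact this

section Chart

variable {X : Type*} [TopologicalSpace X] [ChartedSpace E4 X] [IsManifold 𝓘(ℝ, E4) ∞ X]
  {G : Metric X} {o : ManifoldOrientation X} {g : X → X} {P : X}

omit [ChartedSpace E4 X] [IsManifold 𝓘(ℝ, E4) ∞ X] in
theorem eventually_eq_of_discrete (hdiscrete : DiscreteTopology (Function.fixedPoints g))
    (hP : g P = P) : ∀ᶠ y in 𝓝 P, g y = y → y = P := by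
  have h := isOpen_discrete ({⟨P, hP⟩} : Set (Function.fixedPoints g))
  obtain ⟨V, hV, hV'⟩ := isOpen_induced_iff.1 h
  have hPV : P ∈ V := by
    have : (⟨P, hP⟩ : Function.fixedPoints g) ∈ Subtype.val ⁻¹' V := by rw [hV']; rfl
    exact this
  filter_upwards [hV.mem_nhds hPV] with y hy hgy
  have : (⟨y, hgy⟩ : Function.fixedPoints g) ∈ Subtype.val ⁻¹' V := hy
  rw [hV'] at this
  exact congrArg Subtype.val this

/-- A germ of antipodal coordinates extends to the ball of radius `2` after rescaling. -/
theorem exists_antipodalChart_of_eventually (ψ : OpenPartialHomeomorph ℍ[ℝ] X)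
    (h0 : 0 ∈ ψ.source) (hP : ψ 0 = P)
    (h : ∀ᶠ x in 𝓝 (0 : ℍ[ℝ]), ContMDiffAt 𝓘(ℝ, ℍ[ℝ]) 𝓘(ℝ, E4) ∞ ψ x ∧
      ContMDiffAt 𝓘(ℝ, E4) 𝓘(ℝ, ℍ[ℝ]) ∞ ψ.symm (ψ x) ∧ ψ (-x) = g (ψ x) ∧
      ∃ L : ℍ[ℝ] ≃ₗ[ℝ] TangentSpace 𝓘(ℝ, E4) (ψ x),
        (∀ a : ℍ[ℝ], L a = mfderiv 𝓘(ℝ, ℍ[ℝ]) 𝓘(ℝ, E4) ψ x a) ∧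
          frameOrientation L = o.at_point (ψ x)) : Nonempty (AntipodalChart o g P) := by
  obtain ⟨δ, hδ, hball⟩ := Metric.eventually_nhds_iff_ball.1
    (h.and (ψ.open_source.mem_nhds h0))
  have hr : δ / 2 ≠ 0 := by positivity
  -- This scaling takes the ball of radius 2 to the ball of radius δ on which the germ conditions
  -- hold.
  let m : ℍ[ℝ] ≃ₜ ℍ[ℝ] := Homeomorph.smulOfNeZero (δ / 2) hr
  have hm : ∀ x, m x = (δ / 2) • x := fun _ => rfl
  have hmb : ∀ x ∈ Metric.ball (0 : ℍ[ℝ]) 2, m x ∈ Metric.ball (0 : ℍ[ℝ]) δ := by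
    intro x hx
    rw [mem_ball_zero_iff] at hx ⊢
    rw [hm, norm_smul, Real.norm_eq_abs, abs_of_pos (by positivity)]
    nlinarith
  let e := (m.toOpenPartialHomeomorph.trans ψ).restrOpen (Metric.ball 0 2) Metric.isOpen_ball
  have hes : e.source = Metric.ball 0 2 := by
    ext x
    refine ⟨fun hx => hx.2, fun hx => ⟨⟨trivial, (hball _ (hmb x hx)).2⟩, hx⟩⟩
  have he : ∀ x, e x = ψ (m x) := fun _ => rfl
  have hmd : ∀ x, HasFDerivAt (fun x : ℍ[ℝ] => (δ / 2) • x)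
    ((δ / 2) • ContinuousLinearMap.id ℝ ℍ[ℝ]) x := fun x =>
      ((δ / 2) • ContinuousLinearMap.id ℝ ℍ[ℝ]).hasFDerivAt
  have hmsm : ContMDiff 𝓘(ℝ, ℍ[ℝ]) 𝓘(ℝ, ℍ[ℝ]) ∞ m :=
    ((δ / 2) • ContinuousLinearMap.id ℝ ℍ[ℝ]).contDiff.contMDiff
  have hmsm' : ContMDiff 𝓘(ℝ, ℍ[ℝ]) 𝓘(ℝ, ℍ[ℝ]) ∞ m.symm :=
    ((δ / 2)⁻¹ • ContinuousLinearMap.id ℝ ℍ[ℝ]).contDiff.contMDiff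
  refine ⟨⟨e, hes, ?_, ?_, ?_, ?_, ?_⟩⟩
  · rw [he, hm, smul_zero, hP]
  · intro x hx
    rw [hes] at hx
    exact (((hball _ (hmb x hx)).1.1).comp x hmsm.contMDiffAt).contMDiffWithinAt
  · intro y hy
    obtain ⟨x, hx, rfl⟩ : ∃ x ∈ e.source, e x = y := ⟨e.symm y, e.map_target hy, e.right_inv hy⟩
    rw [hes] at hx
    exact (hmsm'.contMDiffAt.comp (e x) (hball _ (hmb x hx)).1.2.1).contMDiffWithinAt
  · intro x hx
    rw [hes] at hx
    rw [he, he, hm, smul_neg]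
    exact (hball _ (hmb x hx)).1.2.2.1
  · intro x hx
    rw [hes] at hx
    obtain ⟨hψ, -, -, L, hL, ho⟩ := (hball _ (hmb x hx)).1
    let M : ℍ[ℝ] ≃ₗ[ℝ] ℍ[ℝ] := LinearEquiv.smulOfNeZero ℝ ℍ[ℝ] (δ / 2) hr
    refine ⟨M.trans L, fun a => ?_, ?_⟩
    · have h1 : mfderiv 𝓘(ℝ, ℍ[ℝ]) 𝓘(ℝ, E4) (ψ ∘ m) x
          = (mfderiv 𝓘(ℝ, ℍ[ℝ]) 𝓘(ℝ, E4) ψ (m x)).comp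
            (mfderiv 𝓘(ℝ, ℍ[ℝ]) 𝓘(ℝ, ℍ[ℝ]) m x) :=
        mfderiv_comp x (hψ.mdifferentiableAt (by simp))
          (hmsm.contMDiffAt.mdifferentiableAt (by simp))
      have h2 : (mfderiv 𝓘(ℝ, ℍ[ℝ]) 𝓘(ℝ, ℍ[ℝ]) m x : ℍ[ℝ] → ℍ[ℝ]) a = (δ / 2) • a := by
        rw [mfderiv_eq_fderiv]
        exact congrArg (fun f : ℍ[ℝ] →L[ℝ] ℍ[ℝ] => f a) (hmd x).fderiv
      have h3 : (mfderiv 𝓘(ℝ, ℍ[ℝ]) 𝓘(ℝ, E4) (ψ ∘ m) x : ℍ[ℝ] → E4) a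
          = (mfderiv 𝓘(ℝ, ℍ[ℝ]) 𝓘(ℝ, E4) ψ (m x) : ℍ[ℝ] → E4)
            ((mfderiv 𝓘(ℝ, ℍ[ℝ]) 𝓘(ℝ, ℍ[ℝ]) m x : ℍ[ℝ] → ℍ[ℝ]) a) :=
        congrArg (fun f : ℍ[ℝ] →L[ℝ] E4 => f a) h1
      rw [h2] at h3
      exact (hL _).trans h3.symm
    · rw [he, ← ho, eq_comm, frameOrientation_eq_iff]
      have h1 : (((M.trans L).trans L.symm : ℍ[ℝ] ≃ₗ[ℝ] ℍ[ℝ]) : ℍ[ℝ] →ₗ[ℝ] ℍ[ℝ])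
          = (δ / 2) • LinearMap.id := by
        ext1 a
        exact L.symm_apply_apply _
      rw [h1, LinearMap.det_smul, LinearMap.det_id]
      positivity

end Chart

theorem frameOrientation_trans {V W : Type*} [AddCommGroup V] [Module ℝ V] [AddCommGroup W]
    [Module ℝ W] (L : ℍ[ℝ] ≃ₗ[ℝ] V) (M : V ≃ₗ[ℝ] W) :
    frameOrientation (L.trans M) = Orientation.map (Fin 4) M (frameOrientation L) := by
  unfold frameOrientation
  rw [← Module.Basis.orientation_map]
  rfl

theorem exists_frameOrientation_eq (θ : Orientation ℝ E4 (Fin 4)) :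
    ∃ B : ℍ[ℝ] ≃ₗ[ℝ] E4, frameOrientation B = θ := by
  have hfin : Module.finrank ℝ ℍ[ℝ] = Module.finrank ℝ E4 := by
    rw [Quaternion.finrank_eq_four]
    simp
  let B := LinearEquiv.ofFinrankEq ℍ[ℝ] E4 hfin
  have hcard : Fintype.card (Fin 4) = Module.finrank ℝ E4 := by simp
  rcases Orientation.eq_or_eq_neg θ (frameOrientation B) hcard with h | h
  · exact ⟨B, h.symm⟩
  · let R : ℍ[ℝ] ≃ₗ[ℝ] ℍ[ℝ] := LinearEquiv.ofInvolutive starL star_star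
    refine ⟨R.trans B, ?_⟩
    rcases Orientation.eq_or_eq_neg (frameOrientation (R.trans B)) (frameOrientation B) hcard
      with h1 | h1
    · rw [eq_comm, frameOrientation_eq_iff] at h1
      have h2 : (((R.trans B).trans B.symm : ℍ[ℝ] ≃ₗ[ℝ] ℍ[ℝ]) : ℍ[ℝ] →ₗ[ℝ] ℍ[ℝ]) = starL := by
        ext1 a
        exact B.symm_apply_apply _
      rw [h2, det_starL] at h1
      norm_num at h1
    · rw [h1, h]

section Chart

variable {X : Type*} [TopologicalSpace X] [ChartedSpace E4 X] [IsManifold 𝓘(ℝ, E4) ∞ X]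
  {o : ManifoldOrientation X} {g : X → X} {P : X}

theorem nonempty_antipodalChart (hg : Function.Involutive g)
    (hsmooth : ContMDiff 𝓘(ℝ, E4) 𝓘(ℝ, E4) ∞ g)
    (hdiscrete : DiscreteTopology (Function.fixedPoints g)) (hP : g P = P) :
    Nonempty (AntipodalChart o g P) := by
  let φ := chartAt E4 P
  let p := φ P
  have hPs : P ∈ φ.source := mem_chart_source E4 P
  have hpt : p ∈ φ.target := φ.map_source hPs
  have hpP : φ.symm p = P := φ.left_inv hPs
  let U := φ.target ∩ φ.symm ⁻¹' (g ⁻¹' φ.source)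
  have hU : IsOpen U :=
    φ.isOpen_inter_preimage_symm (φ.open_source.preimage hsmooth.continuous)
  have hpU : p ∈ U := ⟨hpt, by
    change g (φ.symm p) ∈ φ.source
    rwa [hpP, hP]⟩
  let h : E4 → E4 := fun z => φ (g (φ.symm z))
  have hs : ContDiffOn ℝ ∞ h U := by
    rw [← contMDiffOn_iff_contDiffOn]
    exact (contMDiffOn_chart (x := P)).comp
      (hsmooth.comp_contMDiffOn ((contMDiffOn_chart_symm (x := P)).mono Set.inter_subset_left))
      fun z hz => hz.2
  have hgφ : ∀ z ∈ U, φ.symm (h z) = g (φ.symm z) := fun z hz => φ.left_inv hz.2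
  have hh : ∀ z ∈ U, h (h z) = z := fun z hz => by
    change φ (g (φ.symm (h z))) = z
    rw [hgφ z hz, hg, φ.right_inv hz.1]
  have hfp : h p = p := by
    change φ (g (φ.symm p)) = φ P
    rw [hpP, hP]
  have hφc : Filter.Tendsto φ.symm (𝓝 p) (𝓝 P) := by
    have := φ.continuousAt_symm hpt
    rwa [ContinuousAt, hpP] at this
  have hiso : ∀ᶠ z in 𝓝 p, h z = z → z = p := by
    filter_upwards [hφc.eventually (eventually_eq_of_discrete hdiscrete hP), hU.mem_nhds hpU]
      with z h1 h2 h3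
    have h4 : φ.symm z = P := h1 (by rw [← hgφ z h2, h3])
    rw [← φ.right_inv h2.1, h4]
  obtain ⟨Q, hpQ, hQp, hQneg, hQs, hQd⟩ := exists_linearization hU hpU hs hh hfp hiso
  obtain ⟨θ, hθ⟩ := o.locally_constant P
  -- The linearization is free up to a linear isomorphism from ℍ; this one is chosen to match the
  -- orientation of X near P.
  obtain ⟨B', hB'⟩ := exists_frameOrientation_eq θ
  let B : ℍ[ℝ] ≃L[ℝ] E4 := B'.toContinuousLinearEquiv
  have h0 : (0 : E4) ∈ Q.target := by rw [← hQp]; exact Q.map_source hpQ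
  have hs0 : Q.symm 0 = p := by rw [← hQp]; exact Q.left_inv hpQ
  have hB0 : Filter.Tendsto B (𝓝 0) (𝓝 0) := by
    have := B.continuous.tendsto 0
    rwa [map_zero] at this
  let f : ℍ[ℝ] → E4 := fun x => Q.symm (B x)
  have hf0 : f 0 = p := by
    change Q.symm (B 0) = p
    rw [map_zero, hs0]
  have hfc : Filter.Tendsto f (𝓝 0) (𝓝 p) := by
    have := Q.continuousAt_symm h0
    rw [ContinuousAt, hs0] at this
    exact this.comp hB0
  let ψ : OpenPartialHomeomorph ℍ[ℝ] X :=
    (B.toHomeomorph.toOpenPartialHomeomorph.trans Q.symm).trans φ.symm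
  have hψ : ∀ x, ψ x = φ.symm (f x) := fun _ => rfl
  have hψ0 : ψ 0 = P := by rw [hψ, hf0, hpP]
  have hψc : Filter.Tendsto ψ (𝓝 0) (𝓝 P) := hφc.comp hfc
  have hfs : ∀ᶠ x in 𝓝 (0 : ℍ[ℝ]), ContDiffAt ℝ ∞ f x := by
    filter_upwards [hB0.eventually hQs] with x hx
    exact hx.1.comp x B.contDiff.contDiffAt
  have hfd : HasFDerivAt f ((1 / 2 : ℝ) • (B : ℍ[ℝ] →L[ℝ] E4)) 0 := by
    have h1 : HasFDerivAt Q.symm ((1 / 2 : ℝ) • ContinuousLinearMap.id ℝ E4) (B 0) := by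
      rwa [map_zero]
    exact h1.comp 0 B.hasFDerivAt
  -- The derivative of the coordinates compared with B. It is ½ at the origin, so its determinant
  -- stays positive nearby, which is the orientation condition.
  let M : ℍ[ℝ] → ℍ[ℝ] →L[ℝ] ℍ[ℝ] := fun x =>
    (B.symm : E4 →L[ℝ] ℍ[ℝ]).comp (fderiv ℝ f x)
  have hdet : ∀ᶠ x in 𝓝 (0 : ℍ[ℝ]), 0 < (M x).det := by
    have h1 : ContinuousAt (fderiv ℝ f) 0 := hfs.self_of_nhds.continuousAt_fderiv (by simp)
    have h2 : ContinuousAt (fun x => (M x).det) 0 :=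
      ContinuousLinearMap.continuous_det.continuousAt.comp (continuousAt_const.clm_comp h1)
    refine h2.eventually (lt_mem_nhds ?_)
    have h3 : M 0 = (1 / 2 : ℝ) • ContinuousLinearMap.id ℝ ℍ[ℝ] := by
      ext1 a
      change B.symm (fderiv ℝ f 0 a) = _
      rw [hfd.fderiv]
      change B.symm ((1 / 2 : ℝ) • B a) = (1 / 2 : ℝ) • a
      rw [map_smul, B.symm_apply_apply]
    have h4 : (M 0).det = (1 / 2 : ℝ) ^ 4 := by
      rw [h3, ← Quaternion.finrank_eq_four (R := ℝ)]
      change LinearMap.det ((1 / 2 : ℝ) • (LinearMap.id : ℍ[ℝ] →ₗ[ℝ] ℍ[ℝ])) = _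
      rw [LinearMap.det_smul, LinearMap.det_id, mul_one]
    change 0 < (M 0).det
    rw [h4]
    positivity
  refine exists_antipodalChart_of_eventually ψ ?_ hψ0 ?_
  · refine ⟨⟨trivial, ?_⟩, ?_⟩
    · change B 0 ∈ Q.target
      rwa [map_zero]
    · change f 0 ∈ φ.target
      rwa [hf0]
  filter_upwards [hfs, hB0.eventually hQs, hB0.eventually hQneg, hfc.eventually
    (hU.mem_nhds hpU), hdet, hψc.eventually hθ, hB0.eventually (Q.open_target.mem_nhds h0)]
    with x hx1 hx2 hx3 hx4 hx5 hx6 hx7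
  have hψx : ψ x ∈ φ.source := φ.map_target hx4.1
  have hφψ : φ (ψ x) = f x := φ.right_inv hx4.1
  have hsm : ContMDiffAt 𝓘(ℝ, ℍ[ℝ]) 𝓘(ℝ, E4) ∞ ψ x :=
    ((contMDiffOn_chart_symm (x := P)).contMDiffAt (φ.open_target.mem_nhds hx4.1)).comp x
      hx1.contMDiffAt
  refine ⟨hsm, ?_, ?_, ?_⟩
  · have h1 : ContMDiffAt 𝓘(ℝ, E4) 𝓘(ℝ, E4) ∞ φ (ψ x) :=
      (contMDiffOn_chart (x := P)).contMDiffAt (φ.open_source.mem_nhds hψx)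
    have h2 : ContMDiffAt 𝓘(ℝ, E4) 𝓘(ℝ, E4) ∞ Q (φ (ψ x)) := by
      rw [hφψ]
      exact hx2.2.contMDiffAt
    exact B.symm.contDiff.contMDiff.contMDiffAt.comp _ (h2.comp _ h1)
  · rw [hψ, hψ, ← hgφ _ hx4]
    change φ.symm (Q.symm (B (-x))) = _
    rw [map_neg, hx3]
  · have hbase : ψ x ∈ (trivializationAt E4 (TangentSpace 𝓘(ℝ, E4) : X → Type) P).baseSet := hψx
    let tr := (trivializationAt E4 (TangentSpace 𝓘(ℝ, E4) : X → Type) P).linearEquivAt ℝ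
      (ψ x) hbase
    -- The trivialization of the tangent bundle at P is the derivative of the chart at P, so it
    -- turns dψ into df.
    have htr : ∀ a : ℍ[ℝ], tr (mfderiv 𝓘(ℝ, ℍ[ℝ]) 𝓘(ℝ, E4) ψ x a) = fderiv ℝ f x a := by
      intro a
      have h1 : ∀ v : TangentSpace 𝓘(ℝ, E4) (ψ x),
          tr v = mfderiv 𝓘(ℝ, E4) 𝓘(ℝ, E4) (extChartAt 𝓘(ℝ, E4) P) (ψ x) v := fun v => by
        rw [← TangentBundle.continuousLinearMapAt_trivializationAt hψx]
        exact (Bundle.Trivialization.continuousLinearMapAt_apply_of_mem ℝ _ hbase v).symm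
      have h2 := mfderiv_comp x
        (mdifferentiableAt_extChartAt (I := 𝓘(ℝ, E4)) (x := P) hψx)
        (hsm.mdifferentiableAt (by simp))
      have h3 : extChartAt 𝓘(ℝ, E4) P ∘ ψ =ᶠ[𝓝 x] f := by
        filter_upwards [hx1.continuousAt.eventually (φ.open_target.mem_nhds hx4.1)] with z hz
        exact φ.right_inv hz
      rw [h3.mfderiv_eq, mfderiv_eq_fderiv] at h2
      exact (h1 _).trans (congrArg (fun T : ℍ[ℝ] →L[ℝ] E4 => T a) h2).symm
    have hu : IsUnit (LinearMap.det (M x : ℍ[ℝ] →ₗ[ℝ] ℍ[ℝ])) := hx5.ne'.isUnit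
    let N : ℍ[ℝ] ≃ₗ[ℝ] ℍ[ℝ] := LinearEquiv.ofIsUnitDet (v := qBasis) (v' := qBasis)
      (f := (M x : ℍ[ℝ] →ₗ[ℝ] ℍ[ℝ])) (by rwa [LinearMap.det_toMatrix])
    have hN : ∀ a, N a = M x a := fun _ => rfl
    refine ⟨(N.trans B').trans tr.symm, fun a => ?_, ?_⟩
    · rw [LinearEquiv.trans_apply, LinearEquiv.symm_apply_eq, htr, LinearEquiv.trans_apply, hN]
      exact B'.apply_symm_apply _
    · apply (Orientation.map (Fin 4) tr).injective
      rw [hx6 hbase, ← frameOrientation_trans]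
      have h1 : ((N.trans B').trans tr.symm).trans tr = N.trans B' := by
        ext a
        simp
      rw [h1, ← hB', eq_comm, frameOrientation_eq_iff]
      have h2 : (((N.trans B').trans B'.symm : ℍ[ℝ] ≃ₗ[ℝ] ℍ[ℝ]) : ℍ[ℝ] →ₗ[ℝ] ℍ[ℝ])
          = (M x : ℍ[ℝ] →ₗ[ℝ] ℍ[ℝ]) := by
        ext1 a
        exact B'.symm_apply_apply _
      rw [h2]
      exact hx5

end Chart


/-! ### Matching the spin structure on the link with those of the disk bundles. -/

/-- The orthogonal factor in the polar decomposition of a positive operator is trivial. -/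
theorem rot_eq_id_of_polar {w : ℍ[ℝ] →L[ℝ] ℍ[ℝ]} (hw : IsPosDef w) {s : Spin4}
    (hsym : ∀ a b, inner ℝ (rot s a) (w b) = (inner ℝ (rot s b) (w a) : ℝ))
    (hpos : ∀ a, a ≠ 0 → 0 < (inner ℝ (rot s a) (w a) : ℝ)) (a : ℍ[ℝ]) : rot s a = a := by
  let R : ℍ[ℝ] →L[ℝ] ℍ[ℝ] := (LinearMap.toContinuousLinearMap (rotL s⁻¹)).comp w
  have hR : ∀ a, rot s (R a) = w a := fun a => rot_rot_inv s (w a)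
  have hin : ∀ a b, inner ℝ (rot s a) (w b) = (inner ℝ a (R b) : ℝ) := fun a b => by
    rw [← hR b, inner_rot]
  have hRpos : IsPosDef R := by
    refine ⟨fun a b => ?_, fun a ha => ?_⟩
    · rw [real_inner_comm, ← hin, hsym, hin]
    · rw [real_inner_comm, ← hin]
      exact hpos a ha
  -- The rotation drops out of the inner products, so R and w are positive square roots of the same
  -- operator.
  have hsq : R * R = w * w := by
    ext1 a
    refine ext_inner_right ℝ fun b => ?_
    change inner ℝ (R (R a)) b = (inner ℝ (w (w a)) b : ℝ)
    rw [hRpos.1, hw.1, ← hR a, ← hR b, inner_rot]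
  have hRw : R = w := hRpos.eq_of_mul_self_eq hw hsq
  obtain ⟨u, hu⟩ := hw.isUnit
  have h1 : w ((↑u⁻¹ : ℍ[ℝ] →L[ℝ] ℍ[ℝ]) a) = a := by
    have := congrArg (fun f : ℍ[ℝ] →L[ℝ] ℍ[ℝ] => f a) u.mul_inv
    rw [hu] at this
    exact this
  have h2 := hR ((↑u⁻¹ : ℍ[ℝ] →L[ℝ] ℍ[ℝ]) a)
  rwa [hRw, h1] at h2

theorem diskMetric_fderiv_psi (τ : SpinType) (x : Metric.sphere (0 : ℍ[ℝ]) 1) (a b : ℍ[ℝ]) :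
    diskMetric (psi τ x) ((diskProj τ (boundaryLift τ x)).1 a).2 (fderiv ℝ (psi τ) x b)
      = 2 * inner ℝ a b := by
  rw [fderiv_psi, ← inner_conjOf τ, ← diskMetric_diskFrameL (boundaryLift τ x).2]
  change diskMetric (psi τ x) (diskFrameL (boundaryLift τ x).1 (conjOf τ a)) _
    = 2 * diskMetric (psi τ x) _ _
  simp only [diskMetric, Prod.smul_fst, Prod.smul_snd, inner_smul_right]
  ring

/-- Needed to make S³ × Spin(4) compact. -/
theorem isCompact_unitary : IsCompact ((unitary ℍ[ℝ] : Submonoid ℍ[ℝ]) : Set ℍ[ℝ]) := by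
  have : ((unitary ℍ[ℝ] : Submonoid ℍ[ℝ]) : Set ℍ[ℝ]) = Metric.sphere 0 1 := by
    ext q
    rw [mem_sphere_zero_iff_norm]
    exact ⟨fun h => norm_sp1 ⟨q, h⟩, fun h => (toSp1 q h).2⟩
  rw [this]
  have : ProperSpace ℍ[ℝ] := FiniteDimensional.proper ℝ _
  exact isCompact_sphere _ _

instance : CompactSpace Sp1 := isCompact_iff_compactSpace.1 isCompact_unitary

section Chart

variable {X : Type*} [TopologicalSpace X] [ChartedSpace E4 X] [IsManifold 𝓘(ℝ, E4) ∞ X]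
  {G : Metric X} {o : ManifoldOrientation X} {g : X → X} {P : X}

theorem t2Space_tangentBundle [T2Space X] : T2Space (TangentBundle 𝓘(ℝ, E4) X) := by
  refine ⟨fun v w hvw => ?_⟩
  have hc : Continuous fun v : TangentBundle 𝓘(ℝ, E4) X => v.proj := FiberBundle.continuous_proj E4 _
  by_cases h : v.proj = w.proj
  · let e := trivializationAt E4 (TangentSpace 𝓘(ℝ, E4) : X → Type) v.proj
    have hv : v ∈ e.source := e.mem_source.2 (FiberBundle.mem_baseSet_trivializationAt' v.proj)
    have hw : w ∈ e.source :=
      e.mem_source.2 (h ▸ FiberBundle.mem_baseSet_trivializationAt' v.proj)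
    have hne : e v ≠ e w := fun he => hvw (e.injOn hv hw he)
    obtain ⟨A, B, hA, hB, hvA, hwB, hAB⟩ := t2_separation hne
    refine ⟨_, _, e.toOpenPartialHomeomorph.isOpen_inter_preimage hA,
      e.toOpenPartialHomeomorph.isOpen_inter_preimage hB, ⟨hv, hvA⟩, ⟨hw, hwB⟩, ?_⟩
    exact (hAB.preimage e).mono Set.inter_subset_right Set.inter_subset_right
  · obtain ⟨A, B, hA, hB, hvA, hwB, hAB⟩ := t2_separation h
    exact ⟨_, _, hA.preimage hc, hB.preimage hc, hvA, hwB, hAB.preimage _⟩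

/-- Points over different frames are separated below, points over one frame by the covering
property. It lets a continuous injection from a compact space be an embedding. -/
theorem SpinStructure.t2Space [T2Space X] (S : SpinStructure (frames G o)) : T2Space S.Total := by
  have : T2Space (TangentBundle 𝓘(ℝ, E4) X) := t2Space_tangentBundle
  refine ⟨fun y y' hne => ?_⟩
  by_cases h : S.proj y = S.proj y'
  · exact S.isCoveringMap.isSeparatedMap y y' h hne
  · obtain ⟨A, B, hA, hB, hyA, hyB, hAB⟩ := t2_separation h
    exact ⟨_, _, hA.preimage S.isCoveringMap.continuous, hB.preimage S.isCoveringMap.continuous,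
      hyA, hyB, hAB.preimage _⟩

theorem AntipodalChart.mem_source (c : AntipodalChart o g P) {x : ℍ[ℝ]} (hx : ‖x‖ = 1) :
    x ∈ c.e.source := by
  rw [c.source_eq, mem_ball_zero_iff, hx]
  norm_num

theorem AntipodalChart.tmap_injective (c : AntipodalChart o g P) {x : ℍ[ℝ]}
    (hx : x ∈ c.e.source) : Function.Injective (c.tmap x) := by
  intro a b hab
  obtain ⟨L, hL, -⟩ := c.oriented x hx
  have h := Bundle.TotalSpace.mk_inj.1 hab
  exact L.injective ((hL a).trans (h.trans (hL b).symm))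

theorem SpinStructure.proj_section {S : SpinStructure (frames G o)} {c : AntipodalChart o g P}
    {F : ℍ[ℝ] → S.Total} (hF : ∀ x, S.proj (F x) = c.frame G x) {x : ℍ[ℝ]} (hx : ‖x‖ = 1)
    (t : Spin4) (a : ℍ[ℝ]) :
    (S.proj (S.act (F x) t)).1 a = c.tmap x (c.symFrame G x (rot t a)) := by
  rw [S.proj_act, hF]
  change (c.frame G x).1 (rot t a) = _
  rw [c.frame_apply, retr_of_norm hx]

theorem base_section_of_norm {S : SpinStructure (frames G o)} {c : AntipodalChart o g P}
    {F : ℍ[ℝ] → S.Total} (hF : ∀ x, S.proj (F x) = c.frame G x) {x : ℍ[ℝ]} (hx : ‖x‖ = 1) :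
    S.base (F x) = c.e x := by
  rw [base_section hF, retr_of_norm hx]

/-- Transport F by Φ. The disk bundle prescribes the step from x₀ to -x₀ as `antipode τ'`,
invariance under the lift prescribes the step back as `antipode τ`. The product must fix a point,
hence cannot be -1. No choice of coordinates or of T enters the answer. -/
theorem Lift.eq_of_hasSpinType {S : SpinStructure (frames G o)} (l : Lift S g)
    (hsmooth : ContMDiff 𝓘(ℝ, E4) 𝓘(ℝ, E4) ∞ g) (hmetric : PreservesMetric G g)
    {τ τ' : SpinType} (hτ : l.ActsAs P τ) (h : l.HasSpinType P τ') : τ' = τ := by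
  obtain ⟨c, T, Φ, hΦc, hΦ⟩ := h
  obtain ⟨F, hFc, hF⟩ := exists_section S c
  have hnorm : ∀ x : Metric.sphere (0 : ℍ[ℝ]) 1, ‖(x : ℍ[ℝ])‖ = 1 := fun x =>
    mem_sphere_zero_iff_norm.1 x.2
  have hbase : ∀ x : Metric.sphere (0 : ℍ[ℝ]) 1,
      S.base (F x) ∈ c.e '' Metric.sphere (0 : ℍ[ℝ]) 1 := fun x =>
    ⟨x, x.2, (base_section_of_norm hF (hnorm x)).symm⟩
  let Θ : Metric.sphere (0 : ℍ[ℝ]) 1 → T.Total := fun x => Φ (F x)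
  have hΘ : Continuous Θ := hΦc.comp_continuous (hFc.comp continuous_subtype_val) hbase
  have hproj : ∀ x, T.proj (Θ x) = diskProj τ' (boundaryLift τ' x) := by
    intro x
    obtain ⟨-, -, hcov⟩ := hΦ (F x) (hbase x)
    -- F(x) lies over the coordinate frame preceded by the positive symmetric operator, so the polar
    -- conditions apply with w equal to it.
    obtain ⟨h1, h2, h3⟩ := hcov x x.2 (c.symFrame G x) fun a => by
      rw [hF, c.frame_apply, retr_of_norm (hnorm x)]
      rfl
    obtain ⟨z, hz⟩ := diskProj_surjective τ' (T.proj (Φ (F x)))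
    have hz1 : z.1.1 = (boundaryLift τ' x).1.1 := by
      have := h1 0
      rw [← hz] at this
      exact this
    obtain ⟨s, rfl⟩ := exists_diskAct_eq τ' hz1
    have hV : ∀ a, (T.proj (Φ (F x))).1 a = (diskProj τ' (boundaryLift τ' x)).1 (rot s a) :=
      fun a => by rw [← hz, diskProj_act]
    simp only [hV, diskMetric_fderiv_psi] at h2 h3
    have hrot := rot_eq_id_of_polar (c.isPosDef_symFrame (G := G) x)
      (fun a b => mul_left_cancel₀ two_ne_zero (h2 a b))
      (fun a ha => by linarith [h3 a ha])
    apply Subtype.ext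
    funext a
    change (T.proj (Φ (F x))).1 a = _
    rw [hV, hrot]
  have hmono := lift_neg_one τ' T hΘ hproj
  let x₀ : Metric.sphere (0 : ℍ[ℝ]) 1 := ⟨conjOf τ' (circleQ 0), circle_mem_sphere τ' _⟩
  have hx₁ : (conjOf τ' (circleQ Real.pi)) = -(x₀ : ℍ[ℝ]) := by
    change _ = -(conjOf τ' (circleQ 0))
    rw [circleQ_pi, circleQ_zero, map_neg]
  have h1 : Φ (F (-(x₀ : ℍ[ℝ]))) = T.act (Φ (F x₀)) (antipode τ') := by
    rw [← hx₁]
    exact hmono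
  have h2 : Φ (F x₀) = T.act (Φ (F (-(x₀ : ℍ[ℝ])))) (antipode τ) := by
    have h3 := (hΦ (F x₀) (hbase x₀)).2.1
    rw [l.toHomeo_section hsmooth hmetric hFc hF hτ] at h3
    rw [← h3]
    exact (hΦ (F (-(x₀ : ℍ[ℝ]))) (hbase ⟨-x₀, neg_mem_sphere x₀⟩)).1 _
  rw [h1, ← T.act_mul] at h2
  by_contra hne
  have h4 : antipode τ' * antipode τ = -1 := by
    cases τ <;> cases τ' <;> first | exact absurd rfl hne | (ext1 <;> simp [antipode, swapOf])
  rw [h4] at h2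
  exact T.act_neg_one_ne _ h2.symm

/-- Over the link the sections F and `boundaryLift` trivialize both Spin(4)-bundles; equality of
their monodromies makes the resulting equivariant map invariant under the lift. -/
theorem Lift.hasSpinType_of_actsAs [T2Space X] {S : SpinStructure (frames G o)} (l : Lift S g)
    (c : AntipodalChart o g P)
    (hsmooth : ContMDiff 𝓘(ℝ, E4) 𝓘(ℝ, E4) ∞ g) (hmetric : PreservesMetric G g)
    {τ : SpinType} (hτ : l.ActsAs P τ) : l.HasSpinType P τ := by
  obtain ⟨F, hFc, hF⟩ := exists_section S c
  have hT2 : T2Space S.Total := S.t2Space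
  have : ProperSpace ℍ[ℝ] := FiniteDimensional.proper ℝ _
  have hnorm : ∀ x : Metric.sphere (0 : ℍ[ℝ]) 1, ‖(x : ℍ[ℝ])‖ = 1 := fun x =>
    mem_sphere_zero_iff_norm.1 x.2
  let m : Metric.sphere (0 : ℍ[ℝ]) 1 × Spin4 → S.Total := fun q => S.act (F q.1) q.2
  have hmc : Continuous m := S.continuous_act.comp
    (((hFc.comp continuous_subtype_val).comp continuous_fst).prodMk continuous_snd)
  have hmbase : ∀ q, S.base (m q) = c.e q.1 := fun q => by
    rw [S.base_act, base_section_of_norm hF (hnorm q.1)]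
  have hminj : Function.Injective m := by
    intro q q' h
    have h1 := congrArg S.base h
    rw [hmbase, hmbase] at h1
    have h2 : q.1 = q'.1 := Subtype.ext
      (c.e.injOn (c.mem_source (hnorm _)) (c.mem_source (hnorm _)) h1)
    refine Prod.ext h2 (S.act_injective (y := F q.1) ?_)
    change S.act (F q.1) q.2 = S.act (F q'.1) q'.2 at h
    rw [h, h2]
  -- Compact source and Hausdorff target; this gives continuity of Φ on the image.
  have hmemb := hmc.isClosedEmbedding hminj
  have hrange : ∀ y, S.base y ∈ c.e '' Metric.sphere (0 : ℍ[ℝ]) 1 → ∃ q, m q = y := by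
    rintro y ⟨x, hx, hxy⟩
    obtain ⟨t, ht⟩ := S.exists_act_eq (y := F x) (y' := y) (by
      rw [base_section_of_norm hF (mem_sphere_zero_iff_norm.1 hx), hxy])
    exact ⟨(⟨x, hx⟩, t), ht.symm⟩
  let φ : Metric.sphere (0 : ℍ[ℝ]) 1 × Spin4 → diskSpinTotal := fun q =>
    diskAct τ (boundaryLift τ q.1) q.2
  have hφc : Continuous φ := (continuous_diskAct τ).comp
    (((continuous_boundaryLift τ).comp continuous_fst).prodMk continuous_snd)
  -- The value away from the link is an arbitrary point; no condition concerns it.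
  let Φ : S.Total → diskSpinTotal := Function.extend m φ fun _ => boundaryLift τ ⟨1, by simp⟩
  have hΦ : ∀ q, Φ (m q) = φ q := fun q => hminj.extend_apply _ _ q
  refine ⟨c, diskSpin τ, Φ, ?_, ?_⟩
  · intro y hy
    obtain ⟨q, rfl⟩ := hrange y hy
    have h1 : ContinuousWithinAt Φ (Set.range m) (m q) := by
      rw [ContinuousWithinAt, ← hmemb.isEmbedding.isInducing.map_nhds_eq, Filter.tendsto_map'_iff,
        hΦ]
      exact (hφc.tendsto q).congr fun q' => (hΦ q').symm
    exact h1.mono fun y hy => hrange y hy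
  · intro y hy
    obtain ⟨⟨x, t⟩, rfl⟩ := hrange y hy
    refine ⟨fun s => ?_, ?_, fun x' hx' w hw => ?_⟩
    · have h1 : S.act (m (x, t)) s = m (x, t * s) := (S.act_mul _ _ _).symm
      rw [h1, hΦ, hΦ]
      exact diskAct_mul τ _ _ _
    · have h1 : l.toHomeo (m (x, t)) = m (⟨-x, neg_mem_sphere x⟩, antipode τ * t) := by
        change l.toHomeo (S.act (F x) t) = S.act (F (-x)) (antipode τ * t)
        rw [l.equivariant, l.toHomeo_section hsmooth hmetric hFc hF hτ, S.act_mul]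
      rw [h1, hΦ, hΦ]
      change diskAct τ (boundaryLift τ ⟨-x, neg_mem_sphere x⟩) (antipode τ * t)
        = diskAct τ (boundaryLift τ x) t
      -- The sign change of F under the lift and that of the boundary section are the same antipode,
      -- whose square is 1.
      rw [boundaryLift_neg, ← diskAct_mul]
      change diskAct τ _ (antipode τ * (antipode τ * t)) = _
      rw [← mul_assoc, antipode_mul_self, one_mul]
    · have hw' : ∀ a, c.tmap x (c.symFrame G x (rot t a)) = c.tmap x' (w a) := fun a => by
        rw [← S.proj_section hF (hnorm x)]
        exact hw a
      have hxx : (x : ℍ[ℝ]) = x' := by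
        refine c.e.injOn (c.mem_source (hnorm _))
          (c.mem_source (mem_sphere_zero_iff_norm.1 hx')) ?_
        exact congrArg Bundle.TotalSpace.proj (hw' 0)
      subst hxx
      have hwa : ∀ a, w a = c.symFrame G x (rot t a) := fun a =>
        (c.tmap_injective (c.mem_source (hnorm x)) (hw' a)).symm
      have hp := c.isPosDef_symFrame (G := G) x
      have hV : ∀ a, (((diskSpin τ).proj (Φ (m (x, t)))).1 a)
          = (diskProj τ (boundaryLift τ x)).1 (rot t a) := fun a => by
        rw [hΦ]
        exact congrFun (diskProj_act τ _ _) a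
      refine ⟨fun a => ?_, fun a b => ?_, fun a ha => ?_⟩
      · rw [hV]
        rfl
      · rw [hV, hV, diskMetric_fderiv_psi, diskMetric_fderiv_psi, hwa, hwa, ← hp.1,
          real_inner_comm]
      · rw [hV, diskMetric_fderiv_psi, hwa, real_inner_comm]
        have h1 : rot t a ≠ 0 := fun h0 => ha (by
          rw [← rot_inv_rot t a, h0]
          simp [rot])
        linarith [hp.2 _ h1]

theorem Lift.exists_type [T2Space X] {S : SpinStructure (frames G o)} (l : Lift S g)
    (hg : Function.Involutive g) (hsmooth : ContMDiff 𝓘(ℝ, E4) 𝓘(ℝ, E4) ∞ g)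
    (hmetric : PreservesMetric G g)
    (hdiscrete : DiscreteTopology (Function.fixedPoints g)) (hP : g P = P) :
    ∃ τ, l.epsilon hg hP = signOf τ ∧ ∀ τ', l.HasSpinType P τ' ↔ τ' = τ := by
  obtain ⟨c⟩ := nonempty_antipodalChart (o := o) hg hsmooth hdiscrete hP
  obtain ⟨τ, hτ⟩ := l.exists_actsAs c hsmooth hmetric
  refine ⟨τ, l.epsilon_eq c hsmooth hg hP hτ, fun τ' => ⟨l.eq_of_hasSpinType hsmooth hmetric hτ, ?_⟩⟩
  rintro rfl
  exact l.hasSpinType_of_actsAs c hsmooth hmetric hτ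

end Chart

end SpinFour

end


/-! ### Comparison of the two fixed points. -/

theorem proposition2p6 {X : Type*} [TopologicalSpace X] [T2Space X]
    [ChartedSpace SpinFour.E4 X] [IsManifold 𝓘(ℝ, SpinFour.E4) ∞ X]
    (G : SpinFour.Metric X) (o : SpinFour.ManifoldOrientation X)
    (S : SpinFour.SpinStructure (SpinFour.frames G o))
    (g : X → X) (hg : Function.Involutive g)
    (hsmooth : ContMDiff 𝓘(ℝ, SpinFour.E4) 𝓘(ℝ, SpinFour.E4) ∞ g)
    (hmetric : SpinFour.PreservesMetric G g) (horient : SpinFour.PreservesOrientation o g)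
    (hdiscrete : DiscreteTopology (Function.fixedPoints g))
    (l : SpinFour.Lift S g)
    (P Q : X) (hP : g P = P) (hQ : g Q = Q) (hPQ : P ≠ Q) :
    (l.epsilon hg hP = l.epsilon hg hQ ↔
      ∃ τ : SpinFour.SpinType, l.HasSpinType P τ ∧ l.HasSpinType Q τ) ∧
    (l.epsilon hg hP = -l.epsilon hg hQ ↔
      ∃ τ τ' : SpinFour.SpinType, τ ≠ τ' ∧ l.HasSpinType P τ ∧ l.HasSpinType Q τ') := by
  obtain ⟨τ, hτ, hτP⟩ := l.exists_type hg hsmooth hmetric hdiscrete hP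
  obtain ⟨σ, hσ, hσQ⟩ := l.exists_type hg hsmooth hmetric hdiscrete hQ
  have h1 : SpinFour.signOf τ = SpinFour.signOf σ ↔ τ = σ := by
    cases τ <;> cases σ <;> simp [SpinFour.signOf]
  have h2 : SpinFour.signOf τ = -SpinFour.signOf σ ↔ τ ≠ σ := by
    cases τ <;> cases σ <;> simp [SpinFour.signOf]
  simp only [hτ, hσ, hτP, hσQ, h1, h2]
  constructor
  · exact ⟨fun h => ⟨τ, rfl, h⟩, fun ⟨ρ, hρ, hρ'⟩ => hρ.symm.trans hρ'⟩
  · refine ⟨fun h => ⟨τ, σ, h, rfl, rfl⟩, ?_⟩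
    rintro ⟨_, _, h, rfl, rfl⟩
    exact h
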